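/- **Setting.** For $\varepsilon>0$ let $\Lambda_\varepsilon=\varepsilon\mathbb Z$ and $D_\varepsilon^+=[0,\infty)\times\Lambda_\varepsilon$. For $z=(t,x)$ put $\|z\|_{\mathfrak s}=\sqrt{|t|}+|x|$, and for $j=(j_0,j_1)\in\mathbb N^2$ (with $0\in\mathbb N$) put $|j|_{\mathfrak s}=2j_0+j_1$. Let $$\nabla_\varepsilon^{\pm}g(x)=\pm\varepsilon^{-1}\big(g(x\pm\varepsilon)-g(x)\big),\qquad \Delta_\varepsilon g(x)=\varepsilon^{-2}\big(g(x+\varepsilon)-2g(x)+g(x-\varepsilon)\big),\qquad D_\varepsilon^j=\partial_t^{j_0}(\nabla_\varepsilon^-)^{j_1},$$ where time derivatives at $t=0$ are one-sided. For functions on $D_\varepsilon^+$ write $$(f\star g)(t,x)=\int_0^t\varepsilon\sum_{y\in\Lambda_\varepsilon}f(t-s,x-y)\,g(s,y)\,ds,\qquad \int_{D_\varepsilon^+}f=\int_0^\infty\varepsilon\sum_{x\in\Lambda_\varepsilon}f(t,x)\,dt .$$ Let $$G^\varepsilon(t,x)=\int_{-1/(2\varepsilon)}^{1/(2\varepsilon)}e^{-\varepsilon^{-2}(1-\cos(2\pi\varepsilon\omega))t}\,e^{2\pi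 i\omega x}\,d\omega$$ be the discrete heat kernel, i.e. the bounded solution of $\partial_tG^\varepsilon=\tfrac12\Delta_\varepsilon G^\varepsilon$, $G^\varepsilon(0,x)=\varepsilon^{-1}\mathbf 1_{x=0}$. Let $Q^\varepsilon=\nabla_\varepsilon^-G^\varepsilon\,\nabla_\varepsilon^+G^\varepsilon$ (pointwise product), let $\mathcal Q^\varepsilon f=f+(1+\sqrt\varepsilon)\,\varepsilon\,Q^\varepsilon\star f$ for bounded measurable $f$ on $D_\varepsilon^+$, and define the Neumann series $$(\mathcal Q^\varepsilon)^{-1}f=f+\sum_{n\ge1}(-\varepsilon)^n(1+\sqrt\varepsilon)^n(Q^\varepsilon)^{\star n}\star f,\qquad S^\varepsilon=\sum_{n\ge1}(-\varepsilon)^n(1+\sqrt\varepsilon)^n(Q^\varepsilon)^{\star n},\qquad \widetilde G^\varepsilon=(\mathcal Q^\varepsilon)^{-1}G^\varepsilon .$$ **Lemma.** There are $\Theta\in(0,1)$ and $\varepsilon_1\in(0,1)$ such that the following hold. 1. For every $\varepsilon>0$, $\int_{D_\varepsilon^+}|Q^\varepsilon|\le\Theta/\varepsilon$. 2. For every $\varepsilon\in(0,\varepsilon_1)$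 the series for $S^\varepsilon$, and the series for $(\mathcal Q^\varepsilon)^{-1}f$ with $f$ bounded and measurable, converge absolutely at every point of $D_\varepsilon^+$. Both $\mathcal Q^\varepsilon$ and $(\mathcal Q^\varepsilon)^{-1}$ map bounded measurable functions to bounded measurable functions and are inverse to each other. Moreover $\int_{D_\varepsilon^+}|S^\varepsilon|<\infty$ and $(\mathcal Q^\varepsilon)^{-1}f-f=S^\varepsilon\star f$ for all such $f$, i.e. $S^\varepsilon$ is the kernel of $(\mathcal Q^\varepsilon)^{-1}-\mathrm{Id}$. The functions $S^\varepsilon$, $G^\varepsilon$ and $\widetilde G^\varepsilon$ are smooth in $t\in[0,\infty)$. 3. For every $j\in\mathbb N^2$ there are $C>0$ and $\varepsilon_0\in(0,\varepsilon_1]$, depending on $j$, such that $$|D_\varepsilon^jS^\varepsilon(z)|\le C\varepsilon\,(\|z\|_{\mathfrak s}+\varepsilon)^{-|j|_{\mathfrak s}-4}\qquad\text{for all }z\in D_\varepsilon^+,\ \varepsilon\in(0,\varepsilon_0).$$ 4. For every $j\in\mathbb N^2$ and $\alpha\in[0,1]$ there are $C>0$ and $\varepsilon_0\in(0,\varepsilon_1]$,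 depending on $j$ and $\alpha$, such that for all $z\in D_\varepsilon^+$ and $\varepsilon\in(0,\varepsilon_0)$ $$|D_\varepsilon^j(\widetilde G^\varepsilon-G^\varepsilon)(z)|\le C\varepsilon^\alpha(\|z\|_{\mathfrak s}+\varepsilon)^{-|j|_{\mathfrak s}-1-\alpha},\qquad |D_\varepsilon^j\widetilde G^\varepsilon(z)|\le C(\|z\|_{\mathfrak s}+\varepsilon)^{-|j|_{\mathfrak s}-1}.$$ -/

import Mathlib

open Set MeasureTheory

noncomputable section

namespace SemiDiscrete

/-! Functions on the semidiscrete domain `[0, ∞) × Λ_ε`, where `Λ_ε = ε ℤ` and `ε > 0`, are written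
as functions `f : ℝ → ℤ → ℝ`: the number `f t k` is the value at time `t` and at the lattice point
`x = ε k`. Only the values at times `t ≥ 0` matter. -/

/-- The parabolic norm `√|t| + |x|` of the point `(t, x)` with `x = ε k`. -/
def parNorm (ε : ℝ) (t : ℝ) (k : ℤ) : ℝ := √|t| + |ε * (k : ℝ)|

/-- The parabolic order `2 j₀ + j₁` of a multiindex `j = (j₀, j₁)`. -/
def parOrder (j : ℕ × ℕ) : ℕ := 2 * j.1 + j.2

/-- The backward difference `ε⁻¹ (g(x) - g(x - ε))`. -/
def gradMinus (ε : ℝ) (g : ℤ → ℝ) (k : ℤ) : ℝ := ε⁻¹ * (g k - g (k - 1))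

/-- The forward difference `ε⁻¹ (g(x + ε) - g(x))`. -/
def gradPlus (ε : ℝ) (g : ℤ → ℝ) (k : ℤ) : ℝ := ε⁻¹ * (g (k + 1) - g k)

/-- The discrete Laplacian `ε⁻² (g(x + ε) - 2 g(x) + g(x - ε))`. -/
def discLaplace (ε : ℝ) (g : ℤ → ℝ) (k : ℤ) : ℝ :=
  (ε ^ 2)⁻¹ * (g (k + 1) - 2 * g k + g (k - 1))

/-- The mixed derivative `∂_t ^ j₀ (∇⁻) ^ j₁` on `[0, ∞) × Λ_ε`; at the time `t = 0` the time
derivatives are one-sided. -/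
def mixedDeriv (ε : ℝ) (j : ℕ × ℕ) (f : ℝ → ℤ → ℝ) (t : ℝ) (k : ℤ) : ℝ :=
  iteratedDerivWithin j.1 (fun s => ((gradMinus ε)^[j.2] (f s)) k) (Ici 0) t

/-- Smoothness in time, up to and including `t = 0`, at every lattice point. -/
def TimeSmooth (f : ℝ → ℤ → ℝ) : Prop :=
  ∀ k : ℤ, ContDiffOn ℝ ((⊤ : ℕ∞) : WithTop ℕ∞) (fun t => f t k) (Ici 0)

/-- The space-time convolution `(f ⋆ g)(t, x) = ∫₀ᵗ ε ∑_y f(t - s, x - y) g(s, y) ds`. -/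
def conv (ε : ℝ) (f g : ℝ → ℤ → ℝ) (t : ℝ) (k : ℤ) : ℝ :=
  ∫ s in (0 : ℝ)..t, ε * ∑' l : ℤ, f (t - s) (k - l) * g s l

/-- The symbol `ε⁻² (1 - cos (2 π ε ω))` of `-½ Δ_ε`. -/
def symbol (ε ω : ℝ) : ℝ := (ε ^ 2)⁻¹ * (1 - Real.cos (2 * Real.pi * ε * ω))

/-- The discrete heat kernel `G^ε(t, x) = ∫ exp (-f_ε(ω) t) exp (2 π i ω x) dω` over
`|ω| ≤ 1 / (2 ε)`, where `f_ε` is the symbol; the imaginary part of the integrand is odd in `ω` and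
integrates to zero. It is the bounded solution of `∂_t G = ½ Δ_ε G`, `G(0, x) = ε⁻¹ 1_{x = 0}`, see
`heatKernel_zero`, `hasDerivAt_heatKernel` and `abs_heatKernel_le`. -/
def heatKernel (ε : ℝ) (t : ℝ) (k : ℤ) : ℝ :=
  ∫ ω in (-(1 / (2 * ε)))..(1 / (2 * ε)),
    Real.exp (-symbol ε ω * t) * Real.cos (2 * Real.pi * ω * (ε * (k : ℝ)))

theorem symbol_nonneg (ε ω : ℝ) : 0 ≤ symbol ε ω := by
  unfold symbol
  have := Real.cos_le_one (2 * Real.pi * ε * ω)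
  have h2 : 0 ≤ (ε ^ 2)⁻¹ := by positivity
  exact mul_nonneg h2 (by linarith)

theorem continuous_symbol (ε : ℝ) : Continuous (symbol ε) := by
  unfold symbol
  fun_prop

/-- The initial condition of the discrete heat kernel. -/
theorem heatKernel_zero {ε : ℝ} (hε : 0 < ε) (k : ℤ) :
    heatKernel ε 0 k = if k = 0 then ε⁻¹ else 0 := by
  unfold heatKernel
  split_ifs with h
  · subst h
    simp
    field_simp
    norm_num
  · have hk : (k : ℝ) ≠ 0 := by exact_mod_cast h
    have hc : 2 * Real.pi * (ε * (k : ℝ)) ≠ 0 := by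
      have := Real.pi_pos
      positivity
    have h1 : ∀ ω : ℝ, Real.exp (-symbol ε ω * 0) * Real.cos (2 * Real.pi * ω * (ε * (k : ℝ)))
        = Real.cos ((2 * Real.pi * (ε * (k : ℝ))) * ω) := by
      intro ω
      rw [mul_zero, Real.exp_zero, one_mul]
      congr 1
      ring
    simp_rw [h1]
    rw [intervalIntegral.integral_comp_mul_left _ hc, integral_cos]
    have e1 : 2 * Real.pi * (ε * (k : ℝ)) * (1 / (2 * ε)) = (k : ℝ) * Real.pi := by
      field_simp
    have e2 : 2 * Real.pi * (ε * (k : ℝ)) * (-(1 / (2 * ε))) = -((k : ℝ) * Real.pi) := by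
      rw [mul_neg, e1]
    rw [e1, e2, Real.sin_neg, Real.sin_int_mul_pi]
    simp

/-- The discrete heat equation for the discrete heat kernel. -/
theorem hasDerivAt_heatKernel {ε : ℝ} (hε : 0 < ε) (t : ℝ) (k : ℤ) :
    HasDerivAt (fun s => heatKernel ε s k) ((1 / 2) * discLaplace ε (heatKernel ε t) k) t := by
  have hsym : ∀ ω, symbol ε ω ≤ 2 * (ε ^ 2)⁻¹ := by
    intro ω
    unfold symbol
    have := Real.neg_one_le_cos (2 * Real.pi * ε * ω)
    have h2 : 0 ≤ (ε ^ 2)⁻¹ := by positivity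
    nlinarith
  have hcs := continuous_symbol ε
  set B : ℝ := 2 * (ε ^ 2)⁻¹ with hB
  have hB0 : 0 ≤ B := by positivity
  have key := intervalIntegral.hasDerivAt_integral_of_dominated_loc_of_deriv_le
    (μ := volume) (𝕜 := ℝ) (E := ℝ) (a := -(1 / (2 * ε))) (b := 1 / (2 * ε))
    (F := fun s ω => Real.exp (-symbol ε ω * s) * Real.cos (2 * Real.pi * ω * (ε * (k : ℝ))))
    (F' := fun s ω => Real.exp (-symbol ε ω * s) * (-symbol ε ω) *
      Real.cos (2 * Real.pi * ω * (ε * (k : ℝ))))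
    (x₀ := t) (s := Metric.ball t 1) (bound := fun _ => Real.exp (B * (|t| + 1)) * B)
    (Metric.ball_mem_nhds t one_pos)
    (Filter.Eventually.of_forall fun s => by
      apply Continuous.aestronglyMeasurable
      fun_prop)
    (by
      apply Continuous.intervalIntegrable
      fun_prop)
    (by
      apply Continuous.aestronglyMeasurable
      fun_prop)
    (by
      refine Filter.Eventually.of_forall fun ω _ s hs => ?_
      have hs' : |s| ≤ |t| + 1 := by
        have h1 : |s - t| < 1 := by simpa [Real.dist_eq] using hs
        have h2 : |s| ≤ |t| + |s - t| := by
          simpa using abs_add_le t (s - t)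
        linarith
      have h0 := symbol_nonneg ε ω
      rw [Real.norm_eq_abs, abs_mul, abs_mul, Real.abs_exp, abs_neg, abs_of_nonneg h0]
      have hc := Real.abs_cos_le_one (2 * Real.pi * ω * (ε * (k : ℝ)))
      have he : Real.exp (-symbol ε ω * s) ≤ Real.exp (B * (|t| + 1)) := by
        apply Real.exp_le_exp.mpr
        calc -symbol ε ω * s ≤ |-symbol ε ω * s| := le_abs_self _
          _ = symbol ε ω * |s| := by rw [abs_mul, abs_neg, abs_of_nonneg h0]
          _ ≤ B * (|t| + 1) := mul_le_mul (hsym ω) hs' (abs_nonneg _) hB0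
      calc _ ≤ Real.exp (-symbol ε ω * s) * symbol ε ω * 1 := by
            apply mul_le_mul_of_nonneg_left hc
            positivity
        _ ≤ Real.exp (B * (|t| + 1)) * B := by
            rw [mul_one]
            exact mul_le_mul he (hsym ω) h0 (Real.exp_nonneg _))
    intervalIntegrable_const
    (by
      refine Filter.Eventually.of_forall fun ω _ s _ => ?_
      apply HasDerivAt.mul_const
      have h1 : HasDerivAt (fun s : ℝ => -symbol ε ω * s) (-symbol ε ω) s := by
        simpa using (hasDerivAt_id s).const_mul (-symbol ε ω)
      exact h1.exp)
  have hval := key.2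
  have hint : ∀ m : ℤ, IntervalIntegrable (fun ω => Real.exp (-symbol ε ω * t) *
      Real.cos (2 * Real.pi * ω * (ε * (m : ℝ)))) volume (-(1 / (2 * ε))) (1 / (2 * ε)) := by
    intro m
    apply Continuous.intervalIntegrable
    fun_prop
  have heq : (1 / 2) * discLaplace ε (heatKernel ε t) k =
      ∫ ω in (-(1 / (2 * ε)))..(1 / (2 * ε)), Real.exp (-symbol ε ω * t) * (-symbol ε ω) *
        Real.cos (2 * Real.pi * ω * (ε * (k : ℝ))) := by
    unfold discLaplace heatKernel
    rw [← intervalIntegral.integral_const_mul, ← intervalIntegral.integral_sub (hint _)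
      ((hint _).const_mul _), ← intervalIntegral.integral_add ((hint _).sub ((hint _).const_mul _))
      (hint _), ← intervalIntegral.integral_const_mul, ← intervalIntegral.integral_const_mul]
    apply intervalIntegral.integral_congr
    intro ω _
    have a1 : Real.cos (2 * Real.pi * ω * (ε * ((k + 1 : ℤ) : ℝ))) =
        Real.cos (2 * Real.pi * ω * (ε * (k : ℝ)) + 2 * Real.pi * ε * ω) := by
      congr 1
      push_cast
      ring
    have a2 : Real.cos (2 * Real.pi * ω * (ε * ((k - 1 : ℤ) : ℝ))) =
        Real.cos (2 * Real.pi * ω * (ε * (k : ℝ)) - 2 * Real.pi * ε * ω) := by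
      congr 1
      push_cast
      ring
    simp only [a1, a2, Real.cos_add, Real.cos_sub, symbol]
    ring
  rw [heq]
  exact hval

/-- The discrete heat kernel is bounded. -/
theorem abs_heatKernel_le {ε : ℝ} (hε : 0 < ε) {t : ℝ} (ht : 0 ≤ t) (k : ℤ) :
    |heatKernel ε t k| ≤ ε⁻¹ := by
  have h := intervalIntegral.norm_integral_le_of_norm_le_const (a := -(1 / (2 * ε)))
    (b := 1 / (2 * ε)) (C := 1) (f := fun ω => Real.exp (-symbol ε ω * t) *
      Real.cos (2 * Real.pi * ω * (ε * (k : ℝ)))) (by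
      intro ω _
      rw [norm_mul, Real.norm_eq_abs, Real.norm_eq_abs, Real.abs_exp]
      have h1 : Real.exp (-symbol ε ω * t) ≤ 1 := by
        apply Real.exp_le_one_iff.mpr
        have := mul_nonneg (symbol_nonneg ε ω) ht
        linarith
      exact mul_le_one₀ h1 (abs_nonneg _) (Real.abs_cos_le_one _))
  have h2 : (1 : ℝ) * |1 / (2 * ε) - -(1 / (2 * ε))| = ε⁻¹ := by
    rw [sub_neg_eq_add, abs_of_pos (by positivity)]
    field_simp
    norm_num
  rw [h2] at h
  exact h

/-- The kernel `Q^ε = ∇⁻ G^ε ∇⁺ G^ε` (a pointwise product). -/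
def qKernel (ε : ℝ) (t : ℝ) (k : ℤ) : ℝ :=
  gradMinus ε (heatKernel ε t) k * gradPlus ε (heatKernel ε t) k

/-- `qPower ε n` is the convolution power of `Q^ε` with `n + 1` factors. -/
def qPower (ε : ℝ) : ℕ → ℝ → ℤ → ℝ
  | 0 => qKernel ε
  | n + 1 => conv ε (qKernel ε) (qPower ε n)

/-- The operator `𝒬^ε f = f + (1 + √ε) ε Q^ε ⋆ f`. -/
def qOp (ε : ℝ) (f : ℝ → ℤ → ℝ) (t : ℝ) (k : ℤ) : ℝ :=
  f t k + (1 + √ε) * ε * conv ε (qKernel ε) f t k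

/-- The Neumann series `(𝒬^ε)⁻¹ f = f + ∑_{n ≥ 1} (-ε)ⁿ (1 + √ε)ⁿ (Q^ε)^{⋆ n} ⋆ f`. -/
def qOpInv (ε : ℝ) (f : ℝ → ℤ → ℝ) (t : ℝ) (k : ℤ) : ℝ :=
  f t k + ∑' n : ℕ, (-ε) ^ (n + 1) * (1 + √ε) ^ (n + 1) * conv ε (qPower ε n) f t k

/-- The kernel `∑_{n ≥ 1} (-ε)ⁿ (1 + √ε)ⁿ (Q^ε)^{⋆ n}` of the operator `(𝒬^ε)⁻¹ - Id`. -/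
def sKernel (ε : ℝ) (t : ℝ) (k : ℤ) : ℝ :=
  ∑' n : ℕ, (-ε) ^ (n + 1) * (1 + √ε) ^ (n + 1) * qPower ε n t k

/-- The modified heat kernel `(𝒬^ε)⁻¹ G^ε`. -/
def modHeatKernel (ε : ℝ) : ℝ → ℤ → ℝ := qOpInv ε (heatKernel ε)

/-- Bounded measurable functions on `[0, ∞) × Λ_ε` (each class in `L^∞` has such representatives,
and convolutions do not depend on the representative). -/
structure IsBoundedMeas (f : ℝ → ℤ → ℝ) : Prop where
  measurable : ∀ k : ℤ, AEStronglyMeasurable (fun t => f t k) (volume.restrict (Ici 0))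
  bounded : ∃ M : ℝ, ∀ t : ℝ, 0 ≤ t → ∀ k : ℤ, |f t k| ≤ M

/-- The Neumann series inverts `𝒬^ε`: on bounded measurable functions it converges absolutely at
every point, it defines an operator that is a two-sided inverse of `𝒬^ε`, and `S` is an absolutely
integrable convolution kernel of `(𝒬^ε)⁻¹ - Id`. -/
structure IsInverseWithKernel (ε : ℝ) (S : ℝ → ℤ → ℝ) : Prop where
  summable : ∀ f : ℝ → ℤ → ℝ, IsBoundedMeas f → ∀ t : ℝ, 0 ≤ t → ∀ k : ℤ,
    Summable fun n : ℕ => (-ε) ^ (n + 1) * (1 + √ε) ^ (n + 1) * conv ε (qPower ε n) f t k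
  qOp_mem : ∀ f : ℝ → ℤ → ℝ, IsBoundedMeas f → IsBoundedMeas (qOp ε f)
  qOpInv_mem : ∀ f : ℝ → ℤ → ℝ, IsBoundedMeas f → IsBoundedMeas (qOpInv ε f)
  right_inv : ∀ f : ℝ → ℤ → ℝ, IsBoundedMeas f → ∀ t : ℝ, 0 ≤ t → ∀ k : ℤ,
    qOp ε (qOpInv ε f) t k = f t k
  left_inv : ∀ f : ℝ → ℤ → ℝ, IsBoundedMeas f → ∀ t : ℝ, 0 ≤ t → ∀ k : ℤ,
    qOpInv ε (qOp ε f) t k = f t k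
  integrable : ∫⁻ t in Ici (0 : ℝ), ENNReal.ofReal ε * ∑' k : ℤ, ‖S t k‖ₑ < ⊤
  kernel : ∀ f : ℝ → ℤ → ℝ, IsBoundedMeas f → ∀ t : ℝ, 0 ≤ t → ∀ k : ℤ,
    qOpInv ε f t k - f t k = conv ε S f t k

end SemiDiscrete

end

/-! Parabolic scaling removes ε from the kernels. With p = G^1 and q = Q^1 one has G^ε(t, εk) = ε⁻¹
p(t/ε², k) and Q^ε(t, εk) = ε⁻⁴ q(t/ε², k), so ε survives only in the parameter λ = 1 + √ε. For
convolution on ℤ with counting measure, the kernel of Id - 𝒬^ε becomes a = -λq. Then S^ε is ε⁻³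
times the sum y of the convolution powers of a, and the difference of the modified heat kernel and
the heat kernel is ε⁻¹ times h = y ⋆ p, both evaluated at (t/ε², k). It remains to show, uniformly
in λ, that derivatives of parabolic order r of h and of y decay like the powers -2 - r and -4 - r of
1 + √t + |k|. Undoing the scaling then produces one factor ε in both cases
(`Tower.abs_mixedDeriv_le`), and ε ≤ ‖z‖ + ε trades powers of ε for powers of the norm.

Contraction. One has |∇⁻p ∇⁺p| = ½(|∇⁻p|² + |∇⁺p|²) - ½(|∇⁻p| - |∇⁺p|)². By the ℓ² energy identity
of the heat equation the first term has total mass at most 1, and the second one does not vanish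
identically. Hence ‖q‖₁ ≤ Θ < 1 (`exists_l1Bd_qT`), and the Neumann series converges for all 0 ≤ λ ≤
Λ with ΛΘ < 1. Its algebra is that of the convolution algebra of the group ℤ × ℝ, after extension by
zero to negative times (`Contr`, `zext_conv`).

Cancellation. As p has order of decay 1 only, convolution with the integrable q alone would not give
order 2 for v = q ⋆ p. But P(k) = p(k) p(k+1) solves the heat equation with source -½(q(k) + q(k+1))
and zero initial value, so Duhamel's formula gives v(k) + v(k+1) = -2P(k) (`convT_qT_pT_zero`). Thus
v is -P minus half a difference of v, that difference is q ⋆ ∇⁻p, and both P and ∇⁻p have order 2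
(`decU_convT_qT_pT`).

Propagation. The function h solves h = -λv - λ q ⋆ h. In `space_estimate` and `time_estimate` the
convolution with q is cut at a fraction 1/N of the distance, or of the time, of the point
considered. Where the argument of q is small, all derivatives stay on the other factor, which is
then evaluated at comparably far points, and the contribution is at most Θ times a supremum. In the
remaining part the derivatives are moved to q, by summation by parts in space and by `jetE_eq` in
time; there q decays to the full order and only the mass of the other factor enters. So a derivative
of h of order of decay d at a point of size x is at most C x^(-d) plus ΛΘ times its supremum over
points of size at least (1 - 1/N) x. Since ΛΘ < 1, some N satisfies ΛΘ < (1 - 1/N)^d, and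
`decay_of_contraction` yields the decay. No smallness beyond ΛΘ < 1 is needed for any order
(`decU_solT`).

The kernel. As p is the fundamental solution, the heat operator maps h = y ⋆ p back to y. This is
proved in `csum_eq_heatOp` by uniqueness for the equation y = a + a ⋆ y. The heat operator has
parabolic order 2, which raises the decay from order 2 to order 4.

Time derivatives are carried along as explicit sequences (`Tower`). Those of h are defined
recursively (`solT`), because the n-th derivative of q ⋆ h, with derivatives put on q, involves only
lower derivatives of h. -/

noncomputable section

namespace SemiDiscrete

/-! ### Finite differences on ℤ. -/

/-- The backward difference on `ℤ`, as a linear operator. -/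
def bd : Module.End ℝ (ℤ → ℝ) where
  toFun f k := f k - f (k - 1)
  map_add' f g := by ext k; simp only [Pi.add_apply]; ring
  map_smul' c f := by ext k; simp only [Pi.smul_apply, smul_eq_mul, RingHom.id_apply]; ring

theorem bd_apply (f : ℤ → ℝ) (k : ℤ) : bd f k = f k - f (k - 1) := rfl

theorem bd_pow_succ (m : ℕ) (f : ℤ → ℝ) : (bd ^ (m + 1)) f = (bd ^ m) (bd f) := by
  rw [pow_succ]; rfl

theorem bd_pow_succ' (m : ℕ) (f : ℤ → ℝ) : (bd ^ (m + 1)) f = bd ((bd ^ m) f) := by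
  rw [pow_succ']; rfl

theorem bd_pow_add (m n : ℕ) (f : ℤ → ℝ) : (bd ^ (m + n)) f = (bd ^ m) ((bd ^ n) f) := by
  rw [pow_add]; rfl

theorem gradMinus_iterate (ε : ℝ) (m : ℕ) (f : ℤ → ℝ) (k : ℤ) :
    ((gradMinus ε)^[m] f) k = (ε⁻¹) ^ m * (bd ^ m) f k := by
  induction m generalizing f k with
  | zero => simp
  | succ m ih =>
    rw [Function.iterate_succ_apply', bd_pow_succ']
    simp only [gradMinus, ih, bd_apply]
    ring

theorem bd_pow_shift (m : ℕ) (f : ℤ → ℝ) (a k : ℤ) :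
    (bd ^ m) (fun l => f (l + a)) k = (bd ^ m) f (k + a) := by
  induction m generalizing k with
  | zero => simp
  | succ m ih =>
    rw [bd_pow_succ', bd_pow_succ', bd_apply, bd_apply, ih, ih, sub_add_eq_add_sub]

theorem bd_pow_congr {m : ℕ} {f g : ℤ → ℝ} {k : ℤ}
    (h : ∀ l, k - m ≤ l → l ≤ k → f l = g l) : (bd ^ m) f k = (bd ^ m) g k := by
  induction m generalizing k with
  | zero => simpa using h k (by simp) le_rfl
  | succ m ih =>
    rw [bd_pow_succ', bd_pow_succ', bd_apply, bd_apply, ih, ih]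
    · intro l h1 h2; apply h <;> push_cast <;> linarith
    · intro l h1 h2; apply h <;> push_cast <;> linarith

theorem bd_pow_eq_zero {m : ℕ} {f : ℤ → ℝ} {k : ℤ}
    (h : ∀ l, k - m ≤ l → l ≤ k → f l = 0) : (bd ^ m) f k = 0 := by
  rw [bd_pow_congr (g := 0) h]; simp

theorem abs_bd_pow_le {m : ℕ} {f : ℤ → ℝ} {k : ℤ} {B : ℝ}
    (h : ∀ l, k - m ≤ l → l ≤ k → |f l| ≤ B) : |(bd ^ m) f k| ≤ 2 ^ m * B := by
  induction m generalizing k with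
  | zero => simpa using h k (by simp) le_rfl
  | succ m ih =>
    rw [bd_pow_succ', bd_apply]
    have h1 := ih (k := k) (fun l h1 h2 => h l (by push_cast; linarith) h2)
    have h2 := ih (k := k - 1) (fun l h1 h2 => h l (by push_cast; linarith) (by linarith))
    calc _ ≤ |(bd ^ m) f k| + |(bd ^ m) f (k - 1)| := abs_sub _ _
      _ ≤ _ := by rw [pow_succ]; linarith

/-- Reflection turns backward differences into forward ones up to sign, and m forward differences
are m backward ones read m sites further to the right. -/
theorem bd_pow_reflect (m : ℕ) (f : ℤ → ℝ) (k : ℤ) :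
    (bd ^ m) f (-k) = (-1) ^ m * (bd ^ m) (fun l => f (-l)) (k + m) := by
  induction m generalizing k with
  | zero => simp
  | succ m ih =>
    have e : -k - 1 = -(k + 1) := by ring
    rw [bd_pow_succ', bd_pow_succ', bd_apply, bd_apply, e, ih, ih]
    have e1 : k + 1 + (m : ℤ) = k + ((m + 1 : ℕ) : ℤ) := by push_cast; ring
    have e2 : k + ((m + 1 : ℕ) : ℤ) - 1 = k + m := by push_cast; ring
    rw [e1, e2]
    ring

/-- Multiplication by the position. -/
theorem bd_pow_mul_id (m : ℕ) (f : ℤ → ℝ) (k : ℤ) :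
    (bd ^ (m + 1)) (fun l => (l : ℝ) * f l) k
      = k * (bd ^ (m + 1)) f k + (m + 1) * (bd ^ m) f (k - 1) := by
  induction m generalizing k with
  | zero => simp [bd_apply]; ring
  | succ m ih =>
    rw [bd_pow_succ', bd_apply, ih, ih, bd_pow_succ' (m + 1), bd_apply, bd_pow_succ' m f, bd_apply,
      bd_apply]
    push_cast
    ring

theorem hasDerivWithinAt_bd_pow {f : ℝ → ℤ → ℝ} {f' : ℤ → ℝ} {s : Set ℝ} {t : ℝ} (m : ℕ)
    (h : ∀ k, HasDerivWithinAt (fun x => f x k) (f' k) s t) (k : ℤ) :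
    HasDerivWithinAt (fun x => (bd ^ m) (f x) k) ((bd ^ m) f' k) s t := by
  induction m generalizing k with
  | zero => simpa using h k
  | succ m ih =>
    simp only [bd_pow_succ', bd_apply]
    exact (ih k).sub (ih (k - 1))

theorem bd_pow_integral {f : ℝ → ℤ → ℝ} {a b : ℝ}
    (h : ∀ k, IntervalIntegrable (fun x => f x k) volume a b) (m : ℕ) (k : ℤ) :
    IntervalIntegrable (fun x => (bd ^ m) (f x) k) volume a b ∧
    (bd ^ m) (fun l => ∫ x in a..b, f x l) k = ∫ x in a..b, (bd ^ m) (f x) k := by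
  induction m generalizing k with
  | zero => simpa using h k
  | succ m ih =>
    simp only [bd_pow_succ', bd_apply]
    refine ⟨(ih k).1.sub (ih (k - 1)).1, ?_⟩
    rw [(ih k).2, (ih (k - 1)).2, intervalIntegral.integral_sub (ih k).1 (ih (k - 1)).1]

/-! ### The heat kernel on `ℤ` -/

theorem bd_pow_cos (m : ℕ) (a : ℝ) (k : ℤ) :
    (bd ^ m) (fun l => Real.cos (a * l)) k
      = (2 * Real.sin (a / 2)) ^ m * Real.cos (a * k + m * (Real.pi / 2 - a / 2)) := by
  induction m generalizing k with
  | zero => simp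
  | succ m ih =>
    rw [bd_pow_succ', bd_apply, ih, ih, ← mul_sub, Real.cos_sub_cos, pow_succ]
    have e1 : (a * k + m * (Real.pi / 2 - a / 2) + (a * ((k - 1 : ℤ) : ℝ) +
      m * (Real.pi / 2 - a / 2))) / 2
      = (a * k + (m + 1 : ℕ) * (Real.pi / 2 - a / 2)) - Real.pi / 2 := by push_cast; ring
    have e2 : (a * k + m * (Real.pi / 2 - a / 2) - (a * ((k - 1 : ℤ) : ℝ) +
      m * (Real.pi / 2 - a / 2))) / 2 = a / 2 := by push_cast; ring
    rw [e1, e2, Real.sin_sub_pi_div_two]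
    ring

/-- In the Fourier representation each spatial difference is worth one factor |ω|, hence one power
of 1 / √t. -/
theorem abs_bd_pow_cos_le (m : ℕ) (a : ℝ) (k : ℤ) :
    |(bd ^ m) (fun l => Real.cos (a * l)) k| ≤ |a| ^ m := by
  rw [bd_pow_cos, abs_mul, abs_pow]
  have h1 : |2 * Real.sin (a / 2)| ≤ |a| := by
    rw [abs_mul, abs_two]
    have := Real.abs_sin_le_abs (x := a / 2)
    rw [abs_div, abs_two] at this
    linarith
  calc _ ≤ |a| ^ m * 1 := by
        gcongr
        exact Real.abs_cos_le_one _
    _ = _ := mul_one _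

/-- The bound cos x ≤ 1 - 2x²/π² holds exactly on [-π, π], which is the range of 2πω over one period
cell. -/
theorem symbol_one_ge {ω : ℝ} (h : |ω| ≤ 1 / 2) : 8 * ω ^ 2 ≤ symbol 1 ω := by
  have := Real.cos_le_one_sub_mul_cos_sq (x := 2 * Real.pi * 1 * ω) (by
    rw [abs_mul, abs_of_pos (by positivity)]
    nlinarith [Real.pi_pos])
  unfold symbol
  have e : 2 / Real.pi ^ 2 * (2 * Real.pi * 1 * ω) ^ 2 = 8 * ω ^ 2 := by
    field_simp; ring
  rw [e] at this
  norm_num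
  norm_num at this
  linarith

theorem one_add_pow_mul_exp_le (n : ℕ) {x : ℝ} (hx : 0 ≤ x) :
    (1 + x) ^ n * Real.exp (-(8 * x ^ 2)) ≤ n.factorial * Real.exp 2 := by
  have h1 := Real.pow_div_factorial_le_exp (1 + x) (by linarith) n
  rw [div_le_iff₀ (by positivity)] at h1
  calc _ ≤ (Real.exp (1 + x) * n.factorial) * Real.exp (-(8 * x ^ 2)) := by gcongr
    _ = n.factorial * Real.exp (1 + x + -(8 * x ^ 2)) := by rw [Real.exp_add (1 + x)]; ring
    _ ≤ _ := by
      gcongr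
      nlinarith [sq_nonneg (x - 1 / 4)]

theorem heatKernel_one (t : ℝ) (k : ℤ) : heatKernel 1 t k =
    ∫ ω in (-(1 / 2 : ℝ))..(1 / 2), Real.exp (-symbol 1 ω * t) * Real.cos (2 * Real.pi * ω * k) := by
  unfold heatKernel; simp

theorem bd_pow_heatKernel (m : ℕ) (t : ℝ) (k : ℤ) : (bd ^ m) (heatKernel 1 t) k =
    ∫ ω in (-(1 / 2 : ℝ))..(1 / 2), Real.exp (-symbol 1 ω * t) *
      (bd ^ m) (fun l => Real.cos (2 * Real.pi * ω * l)) k := by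
  have hcs := continuous_symbol 1
  have h := (bd_pow_integral (a := -(1 / 2 : ℝ)) (b := 1 / 2)
    (f := fun ω l => Real.exp (-symbol 1 ω * t) * Real.cos (2 * Real.pi * ω * l)) (by
      intro k; apply Continuous.intervalIntegrable; fun_prop) m k).2
  have e : heatKernel 1 t = fun l : ℤ => ∫ ω in (-(1 / 2 : ℝ))..(1 / 2),
      Real.exp (-symbol 1 ω * t) * Real.cos (2 * Real.pi * ω * l) := by
    ext l; exact heatKernel_one t l
  rw [e, h]
  apply intervalIntegral.integral_congr
  intro ω _
  have := congrFun ((bd ^ m).map_smul (Real.exp (-symbol 1 ω * t))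
    (fun l : ℤ => Real.cos (2 * Real.pi * ω * l))) k
  exact this

/-- The integrand is Gaussian in √t ω. With R = 1 + √t in place of √t, which covers small times
because |ω| ≤ 1/2, it is dominated by R^(-m) times the Cauchy profile 1 / (1 + (Rω)²). The integral
of that profile is at most π / R, which gives the last power. -/
theorem heatKernel_decay_time (m : ℕ) : ∃ C : ℝ, ∀ t : ℝ, 0 ≤ t → ∀ k : ℤ,
    |(bd ^ m) (heatKernel 1 t) k| * (1 + √t) ^ (m + 1) ≤ C := by
  set K : ℝ := (m + 2).factorial * Real.exp 2 with hK
  have hK0 : 0 ≤ K := by positivity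
  refine ⟨(2 * Real.pi) ^ m * (2 * K) * Real.pi, fun t ht k => ?_⟩
  set R := 1 + √t with hR
  have hR1 : 1 ≤ R := by have := Real.sqrt_nonneg t; linarith
  have hR0 : 0 < R := by linarith
  have hcs := continuous_symbol 1
  have hpt : ∀ ω ∈ Icc (-(1 / 2 : ℝ)) (1 / 2), ‖Real.exp (-symbol 1 ω * t) *
      (bd ^ m) (fun l : ℤ => Real.cos (2 * Real.pi * ω * l)) k‖ * R ^ m ≤
      (2 * Real.pi) ^ m * (2 * K) * (1 + (R * ω) ^ 2)⁻¹ := by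
    intro ω hω
    have hω' : |ω| ≤ 1 / 2 := abs_le.2 hω
    rw [Real.norm_eq_abs, abs_mul, Real.abs_exp]
    have h1 : Real.exp (-symbol 1 ω * t) ≤ Real.exp (-(8 * (√t * |ω|) ^ 2)) := by
      apply Real.exp_le_exp.2
      have := symbol_one_ge hω'
      rw [mul_pow, Real.sq_sqrt ht, sq_abs]
      nlinarith
    have h2 := abs_bd_pow_cos_le m (2 * Real.pi * ω) k
    set x := √t * |ω| with hx
    have hx0 : 0 ≤ x := by positivity
    have h3 := one_add_pow_mul_exp_le (m + 2) hx0
    have h4 : R * |ω| ≤ 1 + x := by rw [hR, hx]; nlinarith [abs_nonneg ω]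
    have h5 : (1 + (R * ω) ^ 2) / 2 ≤ (1 + x) ^ 2 := by
      have : (R * ω) ^ 2 = (R * |ω|) ^ 2 := by rw [mul_pow, mul_pow, sq_abs]
      rw [this]
      have : (R * |ω|) ^ 2 ≤ (1 + x) ^ 2 := by gcongr
      nlinarith
    calc _ ≤ Real.exp (-(8 * x ^ 2)) * |2 * Real.pi * ω| ^ m * R ^ m := by gcongr
      _ = (2 * Real.pi) ^ m * ((R * |ω|) ^ m * Real.exp (-(8 * x ^ 2))) := by
        rw [abs_mul, abs_of_pos (by positivity : 0 < 2 * Real.pi), mul_pow, mul_pow R]; ring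
      _ ≤ (2 * Real.pi) ^ m * ((1 + x) ^ m * Real.exp (-(8 * x ^ 2))) := by gcongr
      _ ≤ (2 * Real.pi) ^ m * (2 * K * (1 + (R * ω) ^ 2)⁻¹) := by
        refine mul_le_mul_of_nonneg_left ?_ (by positivity)
        rw [← div_eq_mul_inv, le_div_iff₀ (by positivity)]
        calc _ ≤ (1 + x) ^ m * Real.exp (-(8 * x ^ 2)) * (2 * (1 + x) ^ 2) := by
              gcongr; linarith
          _ = 2 * ((1 + x) ^ (m + 2) * Real.exp (-(8 * x ^ 2))) := by rw [pow_add]; ring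
          _ ≤ _ := by gcongr
      _ = _ := by ring
  rw [bd_pow_heatKernel, pow_succ, ← mul_assoc, ← Real.norm_eq_abs]
  have hle : (-(1 / 2 : ℝ)) ≤ 1 / 2 := by norm_num
  have h6 : ‖∫ ω in (-(1 / 2 : ℝ))..(1 / 2), Real.exp (-symbol 1 ω * t) *
      (bd ^ m) (fun l : ℤ => Real.cos (2 * Real.pi * ω * l)) k‖ * R ^ m ≤
      ∫ ω in (-(1 / 2 : ℝ))..(1 / 2), (2 * Real.pi) ^ m * (2 * K) * (1 + (R * ω) ^ 2)⁻¹ := by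
    have h7 := intervalIntegral.norm_integral_le_of_norm_le (μ := volume) (a := -(1 / 2 : ℝ))
      (b := 1 / 2) (f := fun ω => (Real.exp (-symbol 1 ω * t) *
      (bd ^ m) (fun l : ℤ => Real.cos (2 * Real.pi * ω * l)) k) * R ^ m)
      (g := fun ω => (2 * Real.pi) ^ m * (2 * K) * (1 + (R * ω) ^ 2)⁻¹) hle
      (Filter.Eventually.of_forall fun ω hω => by
        rw [norm_mul, Real.norm_of_nonneg (by positivity : 0 ≤ R ^ m)]
        exact hpt ω (Ioc_subset_Icc_self hω)) (by
        apply Continuous.intervalIntegrable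
        have : ∀ ω : ℝ, 1 + (R * ω) ^ 2 ≠ 0 := fun ω => by positivity
        fun_prop (disch := assumption))
    rwa [intervalIntegral.integral_mul_const, norm_mul,
      Real.norm_of_nonneg (by positivity : 0 ≤ R ^ m)] at h7
  calc _ ≤ (∫ ω in (-(1 / 2 : ℝ))..(1 / 2), (2 * Real.pi) ^ m * (2 * K) *
        (1 + (R * ω) ^ 2)⁻¹) * R := by gcongr
    _ = (2 * Real.pi) ^ m * (2 * K) * (Real.arctan (R * (1 / 2)) -
        Real.arctan (R * (-(1 / 2)))) := by
      rw [intervalIntegral.integral_const_mul,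
        intervalIntegral.integral_comp_mul_left (fun x => (1 + x ^ 2)⁻¹) hR0.ne',
        integral_inv_one_add_sq]
      simp only [smul_eq_mul]
      field_simp
    _ ≤ (2 * Real.pi) ^ m * (2 * K) * Real.pi := by
      gcongr
      have := Real.arctan_lt_pi_div_two (R * (1 / 2))
      have := Real.neg_pi_div_two_lt_arctan (R * (-(1 / 2)))
      linarith

/-- Integration by parts in ω: 2πk cos(2πωk) is the derivative of sin(2πωk), which vanishes at ω =
±1/2. The derivative of the symbol is 2π sin(2πω), and its product with sin(2πωk) is a difference of
neighbouring cosines. -/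
theorem mul_heatKernel (t : ℝ) (k : ℤ) :
    (k : ℝ) * heatKernel 1 t k = t / 2 * (heatKernel 1 t (k - 1) - heatKernel 1 t (k + 1)) := by
  have hcs := continuous_symbol 1
  have hd : ∀ ω : ℝ, HasDerivAt (fun ω => Real.exp (-symbol 1 ω * t) *
      Real.sin (2 * Real.pi * ω * k)) (Real.exp (-symbol 1 ω * t) *
        (-(2 * Real.pi * Real.sin (2 * Real.pi * ω)) * t) * Real.sin (2 * Real.pi * ω * k) +
        Real.exp (-symbol 1 ω * t) * (Real.cos (2 * Real.pi * ω * k) * (2 * Real.pi * k))) ω := by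
    intro ω
    have h1 : HasDerivAt (fun ω : ℝ => 2 * Real.pi * ω) (2 * Real.pi) ω := by
      simpa using (hasDerivAt_id ω).const_mul (2 * Real.pi)
    have h2 : HasDerivAt (symbol 1) (2 * Real.pi * Real.sin (2 * Real.pi * ω)) ω := by
      have := (h1.cos.const_sub 1)
      have e1 : symbol 1 = fun x => 1 - Real.cos (2 * Real.pi * x) := by
        ext x; simp [symbol]
      rw [e1]
      exact this.congr_deriv (by ring)
    exact ((h2.neg.mul_const t).exp).mul ((h1.mul_const (k : ℝ)).sin)
  have hint : ∀ m : ℤ, IntervalIntegrable (fun ω => Real.exp (-symbol 1 ω * t) *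
      Real.cos (2 * Real.pi * ω * m)) volume (-(1 / 2)) (1 / 2) := by
    intro m
    apply Continuous.intervalIntegrable
    fun_prop
  have h3 := intervalIntegral.integral_eq_sub_of_hasDerivAt (a := -(1 / 2 : ℝ)) (b := 1 / 2)
    (fun ω _ => hd ω) (by apply Continuous.intervalIntegrable; fun_prop)
  have s1 : Real.sin (2 * Real.pi * (1 / 2) * k) = 0 := by
    rw [show 2 * Real.pi * (1 / 2) * (k : ℝ) = k * Real.pi by ring, Real.sin_int_mul_pi]
  have s2 : Real.sin (2 * Real.pi * (-(1 / 2)) * k) = 0 := by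
    rw [show 2 * Real.pi * (-(1 / 2)) * (k : ℝ) = -(k * Real.pi) by ring, Real.sin_neg,
      Real.sin_int_mul_pi, neg_zero]
  rw [s1, s2] at h3
  simp only [heatKernel_one]
  rw [← intervalIntegral.integral_sub (hint _) (hint _), ← intervalIntegral.integral_const_mul,
    ← intervalIntegral.integral_const_mul, ← sub_eq_zero,
    ← intervalIntegral.integral_sub ((hint _).const_mul _)
      (((hint _).sub (hint _)).const_mul _)]
  have h4 : (2 * Real.pi) * (∫ ω in (-(1 / 2 : ℝ))..(1 / 2),
      (k * (Real.exp (-symbol 1 ω * t) * Real.cos (2 * Real.pi * ω * k)) -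
      t / 2 * (Real.exp (-symbol 1 ω * t) * Real.cos (2 * Real.pi * ω * ((k - 1 : ℤ) : ℝ)) -
        Real.exp (-symbol 1 ω * t) * Real.cos (2 * Real.pi * ω * ((k + 1 : ℤ) : ℝ))))) = 0 := by
    rw [← intervalIntegral.integral_const_mul]
    rw [mul_zero, mul_zero, sub_zero] at h3
    rw [← h3]
    apply intervalIntegral.integral_congr
    intro ω _
    have a1 : Real.cos (2 * Real.pi * ω * ((k + 1 : ℤ) : ℝ)) =
        Real.cos (2 * Real.pi * ω * k + 2 * Real.pi * ω) := by
      congr 1; push_cast; ring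
    have a2 : Real.cos (2 * Real.pi * ω * ((k - 1 : ℤ) : ℝ)) =
        Real.cos (2 * Real.pi * ω * k - 2 * Real.pi * ω) := by
      congr 1; push_cast; ring
    simp only [a1, a2, Real.cos_add, Real.cos_sub]
    ring
  exact (mul_eq_zero.1 h4).resolve_left (by positivity)

/-- By `mul_heatKernel`, multiplication by k produces t times a kernel with one more difference, and
a commutator with one difference fewer. Since t ≤ (1 + √t)², both cost one power of 1 + √t, so
powers of |k| are exchanged for powers of 1 + √t. -/
theorem heatKernel_decay (N m : ℕ) : ∃ C : ℝ, 0 ≤ C ∧ ∀ t : ℝ, 0 ≤ t → ∀ k : ℤ,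
    |(bd ^ m) (heatKernel 1 t) k| * (1 + |(k : ℝ)|) ^ N * (1 + √t) ^ (m + 1)
      ≤ C * (1 + √t) ^ N := by
  induction N generalizing m with
  | zero =>
    obtain ⟨C, hC⟩ := heatKernel_decay_time m
    exact ⟨max C 0, le_max_right _ _, fun t ht k => by
      simpa using (hC t ht k).trans (le_max_left C 0)⟩
  | succ N ih =>
    have hshift : ∀ (k a : ℤ), |a| ≤ 1 → (1 + |(k : ℝ)|) ^ N ≤
        2 ^ N * (1 + |((k + a : ℤ) : ℝ)|) ^ N := by
      intro k a ha
      rw [← mul_pow]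
      gcongr
      have h1 : |(k : ℝ)| ≤ |((k + a : ℤ) : ℝ)| + |(a : ℝ)| := by
        have := abs_sub ((k + a : ℤ) : ℝ) (a : ℝ)
        simpa using this
      have h2 : |(a : ℝ)| ≤ 1 := by exact_mod_cast ha
      have := abs_nonneg ((k + a : ℤ) : ℝ)
      linarith
    obtain ⟨C₀, h0, hC₀⟩ := ih m
    obtain ⟨C₁, h1, hC₁⟩ := ih (m + 1)
    -- For m = 0 the truncated index is harmless, since the commutator term carries the coefficient
    -- m.
    obtain ⟨C₂, h2, hC₂⟩ := ih (m - 1)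
    refine ⟨C₀ + (1 / 2 * (C₁ + 2 ^ N * C₁) + m * (2 ^ N * C₂)), by positivity,
      fun t ht k => ?_⟩
    set R := 1 + √t with hR
    have hR1 : 1 ≤ R := by have := Real.sqrt_nonneg t; linarith
    have hR0 : 0 < R := by linarith
    have htR : t ≤ R ^ 2 := by nlinarith [Real.sq_sqrt ht, Real.sqrt_nonneg t]
    have key : |(k : ℝ)| * |(bd ^ m) (heatKernel 1 t) k| ≤
        R ^ 2 / 2 * (|(bd ^ (m + 1)) (heatKernel 1 t) k| +
          |(bd ^ (m + 1)) (heatKernel 1 t) (k + 1)|) +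
        m * |(bd ^ (m - 1)) (heatKernel 1 t) (k - 1)| := by
      have e1 : (bd ^ m) (fun l => (l : ℝ) * heatKernel 1 t l) k =
          -(t / 2) * ((bd ^ (m + 1)) (heatKernel 1 t) k +
            (bd ^ (m + 1)) (heatKernel 1 t) (k + 1)) := by
        have : (fun l : ℤ => (l : ℝ) * heatKernel 1 t l) = (-(t / 2)) • (bd (heatKernel 1 t) +
            fun l => bd (heatKernel 1 t) (l + 1)) := by
          ext l
          rw [mul_heatKernel]
          simp [bd_apply]
          ring
        rw [this, map_smul, map_add, bd_pow_succ]
        simp [bd_pow_shift]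
      have e2 : (k : ℝ) * (bd ^ m) (heatKernel 1 t) k = (bd ^ m) (fun l => (l : ℝ) *
          heatKernel 1 t l) k - m * (bd ^ (m - 1)) (heatKernel 1 t) (k - 1) := by
        rcases m with _ | m
        · simp
        · rw [bd_pow_mul_id]; simp
      rw [← abs_mul, e2, e1]
      refine (abs_sub _ _).trans ?_
      rw [abs_mul, abs_mul, Nat.abs_cast, abs_neg, abs_of_nonneg (by positivity : 0 ≤ t / 2)]
      gcongr
      exact abs_add_le _ _
    have g0 := hC₀ t ht k
    have g1 := hC₁ t ht k
    have g1' : |(bd ^ (m + 1)) (heatKernel 1 t) (k + 1)| * (1 + |(k : ℝ)|) ^ N * R ^ (m + 2) ≤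
        2 ^ N * C₁ * R ^ N := by
      calc _ ≤ |(bd ^ (m + 1)) (heatKernel 1 t) (k + 1)| *
            (2 ^ N * (1 + |((k + 1 : ℤ) : ℝ)|) ^ N) * R ^ (m + 2) := by
              gcongr; exact hshift k 1 (by simp)
        _ = 2 ^ N * (|(bd ^ (m + 1)) (heatKernel 1 t) (k + 1)| *
            (1 + |((k + 1 : ℤ) : ℝ)|) ^ N * R ^ (m + 1 + 1)) := by ring
        _ ≤ 2 ^ N * (C₁ * R ^ N) :=
          mul_le_mul_of_nonneg_left (hC₁ t ht (k + 1)) (by positivity)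
        _ = _ := by ring
    have g2 : m * |(bd ^ (m - 1)) (heatKernel 1 t) (k - 1)| * (1 + |(k : ℝ)|) ^ N * R ^ m ≤
        m * (2 ^ N * C₂) * R ^ N := by
      rcases m with _ | m
      · simp
      · simp only [Nat.add_sub_cancel] at hC₂ ⊢
        calc _ ≤ ((m + 1 : ℕ) : ℝ) * |(bd ^ m) (heatKernel 1 t) (k - 1)| *
            (2 ^ N * (1 + |((k + -1 : ℤ) : ℝ)|) ^ N) * R ^ (m + 1) := by
              gcongr; exact hshift k (-1) (by simp)
          _ = ((m + 1 : ℕ) : ℝ) * (2 ^ N * (|(bd ^ m) (heatKernel 1 t) (k - 1)| *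
            (1 + |((k - 1 : ℤ) : ℝ)|) ^ N * R ^ (m + 1))) := by
              rw [← sub_eq_add_neg]; ring
          _ ≤ ((m + 1 : ℕ) : ℝ) * (2 ^ N * (C₂ * R ^ N)) :=
              mul_le_mul_of_nonneg_left (mul_le_mul_of_nonneg_left (hC₂ t ht (k - 1))
                (by positivity)) (by positivity)
          _ = _ := by ring
    have hw : 0 ≤ (1 + |(k : ℝ)|) ^ N := by positivity
    calc _ = |(bd ^ m) (heatKernel 1 t) k| * (1 + |(k : ℝ)|) ^ N * R ^ (m + 1) +
          (|(k : ℝ)| * |(bd ^ m) (heatKernel 1 t) k|) * (1 + |(k : ℝ)|) ^ N * R ^ (m + 1) := by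
            ring
      _ ≤ C₀ * R ^ N + (R ^ 2 / 2 * (|(bd ^ (m + 1)) (heatKernel 1 t) k| +
          |(bd ^ (m + 1)) (heatKernel 1 t) (k + 1)|) +
        m * |(bd ^ (m - 1)) (heatKernel 1 t) (k - 1)|) * (1 + |(k : ℝ)|) ^ N * R ^ (m + 1) := by
          gcongr
      _ = C₀ * R ^ N + (1 / 2 * (|(bd ^ (m + 1)) (heatKernel 1 t) k| * (1 + |(k : ℝ)|) ^ N *
          R ^ (m + 1 + 1) + |(bd ^ (m + 1)) (heatKernel 1 t) (k + 1)| * (1 + |(k : ℝ)|) ^ N *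
          R ^ (m + 2)) + m * |(bd ^ (m - 1)) (heatKernel 1 t) (k - 1)| * (1 + |(k : ℝ)|) ^ N *
          R ^ m) * R := by ring
      _ ≤ C₀ * R ^ N * R + (1 / 2 * (C₁ * R ^ N + 2 ^ N * C₁ * R ^ N) +
          m * (2 ^ N * C₂) * R ^ N) * R := by
            refine add_le_add (le_mul_of_one_le_right (by positivity) hR1)
              (mul_le_mul_of_nonneg_right ?_ hR0.le)
            linarith
      _ = _ := by ring

end SemiDiscrete

end

/-! ### Sequences of time derivatives and parabolic decay. -/

noncomputable section

namespace SemiDiscrete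

/-- `F (n + 1)` is the time derivative of `F n` on `[0, ∞)`. -/
def Tower (F : ℕ → ℝ → ℤ → ℝ) : Prop :=
  ∀ n k t, 0 ≤ t → HasDerivWithinAt (fun s => F n s k) (F (n + 1) t k) (Ici 0) t

/-- The parabolic weight `1 + √t + |k|`. -/
def wt (t : ℝ) (k : ℤ) : ℝ := 1 + √t + |(k : ℝ)|

/-- All mixed derivatives decay parabolically, the function itself with the order `p`. -/
def Dec (p : ℕ) (F : ℕ → ℝ → ℤ → ℝ) : Prop :=
  ∀ n m, ∃ C : ℝ, ∀ t, 0 ≤ t → ∀ k, |(bd ^ m) (F n t) k| * wt t k ^ (p + 2 * n + m) ≤ C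

/-- All time derivatives are finitely supported at the time `0`. -/
def FinJet (F : ℕ → ℝ → ℤ → ℝ) : Prop :=
  ∀ n, ∃ K : ℕ, ∀ k : ℤ, (K : ℤ) < |k| → F n 0 k = 0

/-- The spatial difference of all members. -/
def BD (m : ℕ) (F : ℕ → ℝ → ℤ → ℝ) : ℕ → ℝ → ℤ → ℝ := fun n t => (bd ^ m) (F n t)

theorem one_le_wt (t : ℝ) (k : ℤ) : 1 ≤ wt t k := by
  unfold wt
  have := Real.sqrt_nonneg t
  have := abs_nonneg (k : ℝ)
  linarith

theorem wt_pos (t : ℝ) (k : ℤ) : 0 < wt t k := zero_lt_one.trans_le (one_le_wt t k)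

theorem wt_shift (t : ℝ) (k a : ℤ) : wt t k ≤ (1 + |(a : ℝ)|) * wt t (k + a) := by
  unfold wt
  have h1 := Real.sqrt_nonneg t
  have h2 : |(k : ℝ)| ≤ |((k + a : ℤ) : ℝ)| + |(a : ℝ)| := by
    have := abs_sub ((k + a : ℤ) : ℝ) (a : ℝ)
    simpa using this
  have := abs_nonneg ((k + a : ℤ) : ℝ)
  have := abs_nonneg (a : ℝ)
  nlinarith [mul_nonneg this h1, mul_nonneg (abs_nonneg (a : ℝ)) (abs_nonneg ((k + a : ℤ) : ℝ))]

theorem Tower.continuousOn {F : ℕ → ℝ → ℤ → ℝ} (h : Tower F) (n : ℕ) (k : ℤ) :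
    ContinuousOn (fun t => F n t k) (Ici 0) :=
  fun t ht => (h n k t ht).continuousWithinAt

theorem Tower.BD {F : ℕ → ℝ → ℤ → ℝ} (h : Tower F) (m : ℕ) : Tower (BD m F) :=
  fun n k t ht => hasDerivWithinAt_bd_pow m (fun k => h n k t ht) k

theorem Tower.succ {F : ℕ → ℝ → ℤ → ℝ} (h : Tower F) : Tower (fun n => F (n + 1)) :=
  fun n k t ht => h (n + 1) k t ht

theorem Tower.shift {F : ℕ → ℝ → ℤ → ℝ} (h : Tower F) (a : ℤ) :
    Tower (fun n t k => F n t (k + a)) :=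
  fun n k t ht => h n (k + a) t ht

theorem Tower.add {F G : ℕ → ℝ → ℤ → ℝ} (hF : Tower F) (hG : Tower G) :
    Tower (fun n t k => F n t k + G n t k) :=
  fun n k t ht => (hF n k t ht).add (hG n k t ht)

theorem Tower.const_mul {F : ℕ → ℝ → ℤ → ℝ} (hF : Tower F) (c : ℝ) :
    Tower (fun n t k => c * F n t k) :=
  fun n k t ht => (hF n k t ht).const_mul c

theorem Tower.iteratedDerivWithin_eq {F : ℕ → ℝ → ℤ → ℝ} (h : Tower F) (n : ℕ) (k : ℤ) {t : ℝ}
    (ht : 0 ≤ t) : iteratedDerivWithin n (fun s => F 0 s k) (Ici 0) t = F n t k := by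
  induction n generalizing t with
  | zero => simp
  | succ n ih =>
    rw [iteratedDerivWithin_succ]
    have : derivWithin (iteratedDerivWithin n (fun s => F 0 s k) (Ici 0)) (Ici 0) t =
        derivWithin (fun s => F n s k) (Ici 0) t :=
      derivWithin_congr (fun s hs => ih hs) (ih ht)
    rw [this]
    exact (h n k t ht).derivWithin (uniqueDiffOn_Ici 0 t ht)

theorem Tower.contDiffOn {F : ℕ → ℝ → ℤ → ℝ} (h : Tower F) (k : ℤ) :
    ContDiffOn ℝ ((⊤ : ℕ∞) : WithTop ℕ∞) (fun t => F 0 t k) (Ici 0) := by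
  apply contDiffOn_of_differentiableOn_deriv
  intro m _
  have : DifferentiableOn ℝ (fun t => F m t k) (Ici 0) :=
    fun t ht => (h m k t ht).differentiableWithinAt
  exact this.congr fun t ht => h.iteratedDerivWithin_eq m k ht

/-- Passage from the lattice of spacing ε to ℤ: each time derivative contributes ε⁻² and each
spatial difference ε⁻¹. -/
theorem Tower.mixedDeriv_eq {F : ℕ → ℝ → ℤ → ℝ} (h : Tower F) {ε : ℝ} (hε : 0 < ε) (a : ℝ)
    {f : ℝ → ℤ → ℝ} (hf : ∀ t, 0 ≤ t → ∀ k, f t k = a * F 0 (t / ε ^ 2) k) (j : ℕ × ℕ) {t : ℝ}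
    (ht : 0 ≤ t) (k : ℤ) : mixedDeriv ε j f t k =
      a * (ε⁻¹) ^ (2 * j.1 + j.2) * (bd ^ j.2) (F j.1 (t / ε ^ 2)) k := by
  have hT : Tower (fun n s l => a * (ε⁻¹) ^ (2 * n + j.2) * (bd ^ j.2) (F n (s / ε ^ 2)) l) := by
    intro n l s hs
    have h1 := hasDerivWithinAt_bd_pow j.2
      (fun k => h n k (s / ε ^ 2) (by positivity)) l
    have h2 : HasDerivWithinAt (fun s : ℝ => s / ε ^ 2) (1 / ε ^ 2) (Ici 0) s :=
      (hasDerivWithinAt_id s _).div_const _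
    have h3 := h1.scomp s h2 (fun x (hx : 0 ≤ x) => show (0 : ℝ) ≤ x / ε ^ 2 by positivity)
    refine (h3.const_mul (a * (ε⁻¹) ^ (2 * n + j.2))).congr_deriv ?_
    simp only [smul_eq_mul, one_div]
    ring
  rw [mixedDeriv, ← hT.iteratedDerivWithin_eq j.1 k ht]
  apply iteratedDerivWithin_congr _ ht
  intro s hs
  simp only [gradMinus_iterate, mul_zero, zero_add]
  have : f s = a • F 0 (s / ε ^ 2) := by
    ext l; exact hf s hs l
  rw [this, map_smul]
  simp only [Pi.smul_apply, smul_eq_mul]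
  ring

theorem Dec.nonneg_bound {p : ℕ} {F : ℕ → ℝ → ℤ → ℝ} (h : Dec p F) (n m : ℕ) :
    ∃ C : ℝ, 0 ≤ C ∧ ∀ t, 0 ≤ t → ∀ k, |(bd ^ m) (F n t) k| * wt t k ^ (p + 2 * n + m) ≤ C := by
  obtain ⟨C, hC⟩ := h n m
  refine ⟨C, le_trans ?_ (hC 0 le_rfl 0), hC⟩
  have := wt_pos 0 0
  positivity

theorem Dec.BD {p : ℕ} {F : ℕ → ℝ → ℤ → ℝ} (h : Dec p F) (j : ℕ) : Dec (p + j) (BD j F) := by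
  intro n m
  obtain ⟨C, hC⟩ := h n (m + j)
  refine ⟨C, fun t ht k => ?_⟩
  have := hC t ht k
  rw [bd_pow_add] at this
  rwa [show p + j + 2 * n + m = p + 2 * n + (m + j) by ring]

theorem Dec.succ {p : ℕ} {F : ℕ → ℝ → ℤ → ℝ} (h : Dec p F) : Dec (p + 2) (fun n => F (n + 1)) := by
  intro n m
  obtain ⟨C, hC⟩ := h (n + 1) m
  refine ⟨C, fun t ht k => ?_⟩
  have := hC t ht k
  rwa [show p + 2 + 2 * n + m = p + 2 * (n + 1) + m by ring]

theorem Dec.shift {p : ℕ} {F : ℕ → ℝ → ℤ → ℝ} (h : Dec p F) (a : ℤ) :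
    Dec p (fun n t k => F n t (k + a)) := by
  intro n m
  obtain ⟨C, hC⟩ := h n m
  refine ⟨(1 + |(a : ℝ)|) ^ (p + 2 * n + m) * C, fun t ht k => ?_⟩
  rw [bd_pow_shift]
  calc _ ≤ |(bd ^ m) (F n t) (k + a)| * ((1 + |(a : ℝ)|) * wt t (k + a)) ^ (p + 2 * n + m) := by
        have := wt_pos t k
        gcongr
        exact wt_shift t k a
    _ = (1 + |(a : ℝ)|) ^ (p + 2 * n + m) * (|(bd ^ m) (F n t) (k + a)| *
        wt t (k + a) ^ (p + 2 * n + m)) := by rw [mul_pow]; ring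
    _ ≤ _ := mul_le_mul_of_nonneg_left (hC t ht _) (by positivity)

theorem FinJet.BD {F : ℕ → ℝ → ℤ → ℝ} (h : FinJet F) (m : ℕ) : FinJet (BD m F) := by
  intro n
  obtain ⟨K, hK⟩ := h n
  refine ⟨K + m, fun k hk => bd_pow_eq_zero fun l h1 h2 => hK l ?_⟩
  push_cast at hk
  rcases lt_abs.1 hk with h | h
  · exact lt_abs.2 (Or.inl (by linarith))
  · exact lt_abs.2 (Or.inr (by linarith))

theorem FinJet.succ {F : ℕ → ℝ → ℤ → ℝ} (h : FinJet F) : FinJet (fun n => F (n + 1)) :=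
  fun n => h (n + 1)

/-! ### Products -/

/-- The time derivatives of a pointwise product. -/
def mulT : ℕ → (ℕ → ℝ → ℤ → ℝ) → (ℕ → ℝ → ℤ → ℝ) → ℝ → ℤ → ℝ
  | 0, F, G => fun t k => F 0 t k * G 0 t k
  | n + 1, F, G => fun t k => mulT n (fun i => F (i + 1)) G t k + mulT n F (fun i => G (i + 1)) t k

theorem Tower.mulT {F G : ℕ → ℝ → ℤ → ℝ} (hF : Tower F) (hG : Tower G) :
    Tower (fun n => mulT n F G) := by
  intro n
  induction n generalizing F G with
  | zero =>
    intro k t ht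
    exact (hF 0 k t ht).mul (hG 0 k t ht)
  | succ n ih =>
    intro k t ht
    exact (ih hF.succ hG k t ht).add (ih hF hG.succ k t ht)

theorem FinJet.mulT {F G : ℕ → ℝ → ℤ → ℝ} (hF : FinJet F) :
    FinJet (fun n => mulT n F G) := by
  intro n
  induction n generalizing F G with
  | zero =>
    obtain ⟨K, hK⟩ := hF 0
    exact ⟨K, fun k hk => by simp [SemiDiscrete.mulT, hK k hk]⟩
  | succ n ih =>
    obtain ⟨K, hK⟩ := ih (G := G) hF.succ
    obtain ⟨K', hK'⟩ := ih (G := fun i => G (i + 1)) hF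
    refine ⟨max K K', fun k hk => ?_⟩
    have h1 := hK k (lt_of_le_of_lt (by simp) hk)
    have h2 := hK' k (lt_of_le_of_lt (by simp) hk)
    simp only [SemiDiscrete.mulT] at h1 h2 ⊢
    rw [h1, h2, add_zero]

/-- The Leibniz rule as a bound. -/
theorem bd_pow_mul_bound (m p p' : ℕ) {A B : ℝ} (hA : 0 ≤ A) (hB : 0 ≤ B) : ∃ C : ℝ,
    ∀ (t : ℝ) (f g : ℤ → ℝ), (∀ i ≤ m, ∀ k, |(bd ^ i) f k| * wt t k ^ (p + i) ≤ A) →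
    (∀ i ≤ m, ∀ k, |(bd ^ i) g k| * wt t k ^ (p' + i) ≤ B) →
    ∀ k, |(bd ^ m) (f * g) k| * wt t k ^ (p + p' + m) ≤ C := by
  induction m generalizing p p' A B with
  | zero =>
    refine ⟨A * B, fun t f g hf hg k => ?_⟩
    have h1 := hf 0 le_rfl k
    have h2 := hg 0 le_rfl k
    simp only [pow_zero, Module.End.one_apply, add_zero, Pi.mul_apply, abs_mul] at *
    have := wt_pos t k
    calc _ = (|f k| * wt t k ^ p) * (|g k| * wt t k ^ p') := by rw [pow_add]; ring
      _ ≤ _ := by gcongr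
  | succ m ih =>
    obtain ⟨C₁, h1⟩ := ih (p + 1) p' hA hB
    obtain ⟨C₂, h2⟩ := ih p (p' + 1) (A := 2 ^ (p + m) * A) (by positivity) hB
    refine ⟨C₁ + C₂, fun t f g hf hg k => ?_⟩
    -- The discrete Leibniz rule shifts the undifferentiated factor by one site. Weights at
    -- neighbouring sites differ by a factor at most 2, whence the enlarged constant 2 ^ (p + m) *
    -- A.
    have e : bd (f * g) = bd f * g + (fun k => f (k + -1)) * bd g := by
      ext k; simp only [bd_apply, Pi.add_apply, Pi.mul_apply, ← sub_eq_add_neg]; ring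
    rw [bd_pow_succ, e, map_add]
    have hw := wt_pos t k
    have a1 := h1 t (bd f) g (fun i hi k => by
      have := hf (i + 1) (by omega) k
      rwa [bd_pow_succ, show p + (i + 1) = p + 1 + i by ring] at this)
      (fun i hi k => hg i (by omega) k) k
    have a2 := h2 t (fun k => f (k + -1)) (bd g) (fun i hi k => by
      have hs := wt_shift t k (-1)
      norm_num at hs
      have hw := wt_pos t k
      have hw' := wt_pos t (k + -1)
      rw [bd_pow_shift]
      calc _ ≤ |(bd ^ i) f (k + -1)| * (2 * wt t (k + -1)) ^ (p + i) := by gcongr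
        _ = 2 ^ (p + i) * (|(bd ^ i) f (k + -1)| * wt t (k + -1) ^ (p + i)) := by
          rw [mul_pow]; ring
        _ ≤ 2 ^ (p + i) * A := mul_le_mul_of_nonneg_left (hf i (by omega) _) (by positivity)
        _ ≤ 2 ^ (p + m) * A := by gcongr; norm_num) (fun i hi k => by
      have := hg (i + 1) (by omega) k
      rwa [bd_pow_succ, show p' + (i + 1) = p' + 1 + i by ring] at this) k
    calc _ ≤ (|(bd ^ m) (bd f * g) k| + |(bd ^ m) ((fun k => f (k + -1)) * bd g) k|) *
          wt t k ^ (p + p' + (m + 1)) := by gcongr; exact abs_add_le _ _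
      _ ≤ _ := by
        rw [add_mul]
        refine add_le_add ?_ ?_
        · rwa [show p + p' + (m + 1) = p + 1 + p' + m by ring]
        · rwa [show p + p' + (m + 1) = p + (p' + 1) + m by ring]

theorem exists_uniform_bound {α : Type*} (m : ℕ) (φ : ℕ → α → ℝ)
    (h : ∀ i ≤ m, ∃ C : ℝ, 0 ≤ C ∧ ∀ x, φ i x ≤ C) :
    ∃ C : ℝ, 0 ≤ C ∧ ∀ i ≤ m, ∀ x, φ i x ≤ C := by
  induction m with
  | zero =>
    obtain ⟨C, h0, hC⟩ := h 0 le_rfl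
    exact ⟨C, h0, fun i hi x => by rw [Nat.le_zero.1 hi]; exact hC x⟩
  | succ m ih =>
    obtain ⟨C, h0, hC⟩ := ih fun i hi => h i (by omega)
    obtain ⟨D, d0, hD⟩ := h (m + 1) le_rfl
    refine ⟨max C D, le_max_of_le_left h0, fun i hi x => ?_⟩
    rcases Nat.le_succ_iff.1 hi with h | h
    · exact (hC i h x).trans (le_max_left _ _)
    · rw [h]; exact (hD x).trans (le_max_right _ _)

theorem Dec.mulT {p p' : ℕ} {F G : ℕ → ℝ → ℤ → ℝ} (hF : Dec p F) (hG : Dec p' G) :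
    Dec (p + p') (fun n => mulT n F G) := by
  intro n
  induction n generalizing F G p p' with
  | zero =>
    intro m
    obtain ⟨A, hA0, hA⟩ := exists_uniform_bound m (α := {t : ℝ // 0 ≤ t} × ℤ)
      (fun i x => |(bd ^ i) (F 0 x.1) x.2| * wt x.1 x.2 ^ (p + i)) (fun i _ => by
        obtain ⟨C, h0, hC⟩ := hF.nonneg_bound 0 i
        exact ⟨C, h0, fun x => hC x.1 x.1.2 x.2⟩)
    obtain ⟨B, hB0, hB⟩ := exists_uniform_bound m (α := {t : ℝ // 0 ≤ t} × ℤ)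
      (fun i x => |(bd ^ i) (G 0 x.1) x.2| * wt x.1 x.2 ^ (p' + i)) (fun i _ => by
        obtain ⟨C, h0, hC⟩ := hG.nonneg_bound 0 i
        exact ⟨C, h0, fun x => hC x.1 x.1.2 x.2⟩)
    obtain ⟨C, hC⟩ := bd_pow_mul_bound m p p' hA0 hB0
    exact ⟨C, fun t ht k => hC t (F 0 t) (G 0 t) (fun i hi k => hA i hi (⟨t, ht⟩, k))
      (fun i hi k => hB i hi (⟨t, ht⟩, k)) k⟩
  | succ n ih =>
    intro m
    obtain ⟨C, hC⟩ := ih hF.succ hG m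
    obtain ⟨D, hD⟩ := ih hF hG.succ m
    refine ⟨C + D, fun t ht k => ?_⟩
    have e : SemiDiscrete.mulT (n + 1) F G t = SemiDiscrete.mulT n (fun i => F (i + 1)) G t +
        SemiDiscrete.mulT n F (fun i => G (i + 1)) t := rfl
    have hw := wt_pos t k
    simp only [e, map_add]
    calc _ ≤ (|(bd ^ m) (SemiDiscrete.mulT n (fun i => F (i + 1)) G t) k| +
          |(bd ^ m) (SemiDiscrete.mulT n F (fun i => G (i + 1)) t) k|) *
          wt t k ^ (p + p' + 2 * (n + 1) + m) := by gcongr; exact abs_add_le _ _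
      _ ≤ _ := by
        rw [add_mul]
        refine add_le_add ?_ ?_
        · have := hC t ht k
          rwa [show p + 2 + p' + 2 * n + m = p + p' + 2 * (n + 1) + m by ring] at this
        · have := hD t ht k
          rwa [show p + (p' + 2) + 2 * n + m = p + p' + 2 * (n + 1) + m by ring] at this

theorem mulT_reflect {F G : ℕ → ℝ → ℤ → ℝ} (h : ∀ n t k, F n t (-k) = -G n t k)
    (n : ℕ) (t : ℝ) (k : ℤ) : mulT n F G t (-k) = mulT n F G t k := by
  -- Reflection exchanges the two factors. The induction differentiates them separately and breaks
  -- the symmetry, so four independent sequences are needed.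
  have key : ∀ (n : ℕ) (F G F' G' : ℕ → ℝ → ℤ → ℝ), (∀ n t k, F n t (-k) = -G' n t k) →
      (∀ n t k, G n t (-k) = -F' n t k) → mulT n F G t (-k) = mulT n F' G' t k := by
    intro n
    induction n with
    | zero => intro F G F' G' h1 h2; simp [mulT, h1, h2, mul_comm]
    | succ n ih =>
      intro F G F' G' h1 h2
      simp only [mulT]
      rw [ih _ _ F' (fun i => G' (i + 1)) (fun n => h1 (n + 1)) h2,
        ih _ _ (fun i => F' (i + 1)) G' h1 (fun n => h2 (n + 1)), add_comm]
  refine key n F G F G h fun n t k => ?_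
  have := h n t (-k)
  rw [neg_neg] at this
  rw [this, neg_neg]

/-! ### The heat kernel and its products -/

/-- The time derivatives of the heat kernel. -/
def pT (n : ℕ) (t : ℝ) (k : ℤ) : ℝ := (1 / 2) ^ n * (bd ^ (2 * n)) (heatKernel 1 t) (k + n)

theorem pT_zero (t : ℝ) : pT 0 t = heatKernel 1 t := by ext k; simp [pT]

theorem hasDerivAt_heatKernel_one (t : ℝ) (k : ℤ) : HasDerivAt (fun s => heatKernel 1 s k)
    (1 / 2 * (bd ^ 2) (heatKernel 1 t) (k + 1)) t := by
  refine (hasDerivAt_heatKernel one_pos t k).congr_deriv ?_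
  simp only [discLaplace, bd_pow_succ', pow_zero, Module.End.one_apply, bd_apply]
  norm_num
  ring_nf

/-- The generator ½Δ is half the second backward difference read one site to the right; n
applications give 2n backward differences centred by the shift n in `pT`. -/
theorem tower_pT : Tower pT := by
  intro n k t _
  have h := hasDerivWithinAt_bd_pow (s := Ici 0) (2 * n)
    (fun k => (hasDerivAt_heatKernel_one t k).hasDerivWithinAt) (k + n)
  refine (h.const_mul ((1 / 2 : ℝ) ^ n)).congr_deriv ?_
  have e : (fun l => 1 / 2 * (bd ^ 2) (heatKernel 1 t) (l + 1)) =
      (1 / 2 : ℝ) • fun l => (bd ^ 2) (heatKernel 1 t) (l + 1) := rfl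
  rw [e, map_smul, Pi.smul_apply, bd_pow_shift, ← bd_pow_add, pT,
    show 2 * (n + 1) = 2 * n + 2 by ring, pow_succ]
  simp only [smul_eq_mul]
  push_cast
  rw [add_assoc k]
  ring

/-- `heatKernel_decay` is used at its two extremes: with no spatial weight it gives decay in time,
with the full spatial weight the powers of 1 + √t cancel and it gives decay in space. The parabolic
weight is at most twice the larger of the two. -/
theorem dec_pT : Dec 1 pT := by
  intro n m
  obtain ⟨A, hA0, hA⟩ := heatKernel_decay 0 (2 * n + m)
  obtain ⟨B, hB0, hB⟩ := heatKernel_decay (2 * n + m + 1) (2 * n + m)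
  have key : ∀ t, 0 ≤ t → ∀ k, |(bd ^ (2 * n + m)) (heatKernel 1 t) k| *
      wt t k ^ (2 * n + m + 1) ≤ 2 ^ (2 * n + m + 1) * (A + B) := by
    intro t ht k
    set M := 2 * n + m
    have h1 := hA t ht k
    have h2 := hB t ht k
    have hR : 0 < 1 + √t := by positivity
    simp only [pow_zero, mul_one] at h1
    have h3 : |(bd ^ M) (heatKernel 1 t) k| * (1 + |(k : ℝ)|) ^ (M + 1) ≤ B := by
      refine le_of_mul_le_mul_right h2 (by positivity)
    have h4 : wt t k ^ (M + 1) ≤ 2 ^ (M + 1) * ((1 + √t) ^ (M + 1) + (1 + |(k : ℝ)|) ^ (M + 1)) := by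
      have hk := abs_nonneg (k : ℝ)
      have hs := Real.sqrt_nonneg t
      rcases le_total (√t) |(k : ℝ)| with h | h
      · calc _ ≤ (2 * (1 + |(k : ℝ)|)) ^ (M + 1) := by
              have := wt_pos t k
              gcongr
              unfold wt; linarith
          _ ≤ _ := by
              rw [mul_pow]
              have : 0 ≤ (1 + √t) ^ (M + 1) := by positivity
              gcongr
              linarith
      · calc _ ≤ (2 * (1 + √t)) ^ (M + 1) := by
              have := wt_pos t k
              gcongr
              unfold wt; linarith
          _ ≤ _ := by
              rw [mul_pow]
              have : 0 ≤ (1 + |(k : ℝ)|) ^ (M + 1) := by positivity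
              gcongr
              linarith
    calc _ ≤ |(bd ^ M) (heatKernel 1 t) k| * (2 ^ (M + 1) * ((1 + √t) ^ (M + 1) +
          (1 + |(k : ℝ)|) ^ (M + 1))) := by gcongr
      _ = 2 ^ (M + 1) * (|(bd ^ M) (heatKernel 1 t) k| * (1 + √t) ^ (M + 1) +
          |(bd ^ M) (heatKernel 1 t) k| * (1 + |(k : ℝ)|) ^ (M + 1)) := by ring
      _ ≤ _ := by gcongr
  refine ⟨(1 + |((n : ℤ) : ℝ)|) ^ (2 * n + m + 1) * (2 ^ (2 * n + m + 1) * (A + B)),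
    fun t ht k => ?_⟩
  have e : pT n t = ((1 / 2 : ℝ) ^ n) • fun l => (bd ^ (2 * n)) (heatKernel 1 t) (l + n) := rfl
  rw [e, map_smul, Pi.smul_apply, smul_eq_mul, bd_pow_shift, ← bd_pow_add, abs_mul, add_comm m]
  have h1 : |(1 / 2 : ℝ) ^ n| ≤ 1 := by
    rw [abs_of_pos (by positivity)]
    exact pow_le_one₀ (by norm_num) (by norm_num)
  have hw := wt_pos t k
  have hw' := wt_pos t (k + n)
  calc _ ≤ 1 * |(bd ^ (2 * n + m)) (heatKernel 1 t) (k + n)| *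
        ((1 + |((n : ℤ) : ℝ)|) * wt t (k + n)) ^ (1 + 2 * n + m) := by
        gcongr
        exact wt_shift t k n
    _ = (1 + |((n : ℤ) : ℝ)|) ^ (2 * n + m + 1) * (|(bd ^ (2 * n + m)) (heatKernel 1 t) (k + n)| *
        wt t (k + n) ^ (2 * n + m + 1)) := by
        rw [mul_pow, show 1 + 2 * n + m = 2 * n + m + 1 by ring]; ring
    _ ≤ _ := mul_le_mul_of_nonneg_left (key t ht _) (by positivity)

theorem heatKernel_one_zero (k : ℤ) : heatKernel 1 0 k = if k = 0 then 1 else 0 := by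
  simpa using heatKernel_zero one_pos k

theorem finJet_pT : FinJet pT := by
  intro n
  refine ⟨n, fun k hk => ?_⟩
  rw [pT, bd_pow_eq_zero, mul_zero]
  intro l h1 h2
  rw [heatKernel_one_zero, if_neg]
  rintro rfl
  push_cast at h1
  have : |k| ≤ n := abs_le.2 ⟨by linarith, by linarith⟩
  linarith

theorem heatKernel_neg (t : ℝ) (k : ℤ) : heatKernel 1 t (-k) = heatKernel 1 t k := by
  simp only [heatKernel_one]
  congr 1
  ext ω
  push_cast
  rw [mul_neg, Real.cos_neg]

theorem pT_neg (n : ℕ) (t : ℝ) (k : ℤ) : pT n t (-k) = pT n t k := by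
  simp only [pT]
  have h := bd_pow_reflect (2 * n) (heatKernel 1 t) (k - n)
  simp only [heatKernel_neg, Even.neg_one_pow (even_two_mul n), one_mul] at h
  have e : k - n + ((2 * n : ℕ) : ℤ) = k + n := by push_cast; ring
  rw [show -k + (n : ℤ) = -(k - n) by ring, h, e]

/-- The time derivatives of `q = ∇⁻p ∇⁺p`. -/
def qT (n : ℕ) : ℝ → ℤ → ℝ := mulT n (BD 1 pT) (fun n t k => BD 1 pT n t (k + 1))

/-- The time derivatives of the product of neighbouring values of the heat kernel. -/
def nbT (n : ℕ) : ℝ → ℤ → ℝ := mulT n pT (fun n t k => pT n t (k + 1))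

theorem tower_qT : Tower qT := (tower_pT.BD 1).mulT ((tower_pT.BD 1).shift 1)
theorem tower_nbT : Tower nbT := tower_pT.mulT (tower_pT.shift 1)
theorem dec_qT : Dec 4 qT := (dec_pT.BD 1).mulT ((dec_pT.BD 1).shift 1)
theorem dec_nbT : Dec 2 nbT := dec_pT.mulT (dec_pT.shift 1)
theorem finJet_qT : FinJet qT := (finJet_pT.BD 1).mulT

theorem qT_zero (t : ℝ) (k : ℤ) : qT 0 t k = qKernel 1 t k := by
  simp [qT, mulT, BD, pT_zero, qKernel, gradMinus, gradPlus, bd_apply]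

theorem qT_neg (n : ℕ) (t : ℝ) (k : ℤ) : qT n t (-k) = qT n t k := by
  refine mulT_reflect (fun n t k => ?_) n t k
  simp only [BD, pow_one, bd_apply, add_sub_cancel_right]
  rw [← neg_add', pT_neg, pT_neg]
  ring

/-- The discrete heat equation for the product of neighbouring values of the heat kernel. -/
theorem nbT_one (t : ℝ) (k : ℤ) : nbT 1 t k =
    1 / 2 * (nbT 0 t (k + 1) - 2 * nbT 0 t k + nbT 0 t (k - 1))
      - 1 / 2 * (qT 0 t k + qT 0 t (k + 1)) := by
  have h1 : ∀ k, pT 1 t k = 1 / 2 * (pT 0 t (k + 1) - 2 * pT 0 t k + pT 0 t (k - 1)) := by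
    intro k
    simp only [pT, bd_pow_succ', bd_apply, pow_zero, Module.End.one_apply, mul_one,
      Nat.cast_one, Nat.cast_zero, add_zero, mul_zero]
    ring_nf
  simp only [nbT, qT, mulT, BD, pow_one, bd_apply, zero_add, h1, add_sub_cancel_right,
    sub_add_cancel]
  ring

theorem nbT_zero_zero (k : ℤ) : nbT 0 0 k = 0 := by
  simp only [nbT, mulT, pT_zero, heatKernel_one_zero]
  split_ifs <;> first | omega | simp

end SemiDiscrete

end

noncomputable section

namespace SemiDiscrete

/-! ### Calculus on `[0, ∞)` -/

theorem continuous_clip {f : ℝ → ℝ} (h : ContinuousOn f (Ici 0)) :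
    Continuous fun x => f (max 0 x) :=
  h.comp_continuous (by fun_prop) fun x => le_max_left 0 x

/-- A `C¹` function on `[0, ∞)` extends to a `C¹` function on `ℝ`. -/
theorem exists_extension {a a' : ℝ → ℝ} (hd : ∀ t, 0 ≤ t → HasDerivWithinAt a (a' t) (Ici 0) t)
    (hc : ContinuousOn a' (Ici 0)) : ∃ A : ℝ → ℝ, (∀ t, HasDerivAt A (a' (max 0 t)) t) ∧
      ∀ t, 0 ≤ t → A t = a t := by
  have hcc := continuous_clip hc
  refine ⟨fun x => a 0 + ∫ y in (0 : ℝ)..x, a' (max 0 y), fun t => ?_, fun t ht => ?_⟩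
  · exact (intervalIntegral.integral_hasDerivAt_right (hcc.intervalIntegrable _ _)
      (hcc.stronglyMeasurableAtFilter _ _) hcc.continuousAt).const_add _
  · have h1 : ∫ y in (0 : ℝ)..t, a' (max 0 y) = a t - a 0 := by
      apply intervalIntegral.integral_eq_sub_of_hasDeriv_right_of_le ht
      · exact fun x hx => ((hd x hx.1).continuousWithinAt).mono Icc_subset_Ici_self
      · intro x hx
        rw [max_eq_right hx.1.le]
        exact (hd x hx.1.le).mono fun y hy => hx.1.le.trans (le_of_lt hy)
      · exact hcc.intervalIntegrable _ _
    beta_reduce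
    rw [h1]; ring

/-- The scalar convolution on `[0, ∞)`. -/
def cI (a b : ℝ → ℝ) (t : ℝ) : ℝ := ∫ r in (0 : ℝ)..t, a r * b (t - r)

theorem cI_congr {a b a' b' : ℝ → ℝ} (ha : ∀ t, 0 ≤ t → a t = a' t) (hb : ∀ t, 0 ≤ t → b t = b' t)
    {t : ℝ} (ht : 0 ≤ t) : cI a b t = cI a' b' t := by
  apply intervalIntegral.integral_congr
  intro r hr
  rw [uIcc_of_le ht] at hr
  simp only
  rw [ha r hr.1, hb (t - r) (by linarith [hr.2])]

theorem cI_eq_flip (a b : ℝ → ℝ) (t : ℝ) : cI a b t = ∫ r in (0 : ℝ)..t, a (t - r) * b r := by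
  have := intervalIntegral.integral_comp_sub_left (a := 0) (b := t)
    (fun r => a r * b (t - r)) t
  simp only [sub_sub_cancel, sub_self, sub_zero] at this
  rw [this, cI]

theorem cI_continuousOn {a b : ℝ → ℝ} (ha : ContinuousOn a (Ici 0)) (hb : ContinuousOn b (Ici 0)) :
    ContinuousOn (cI a b) (Ici 0) := by
  have h1 := continuous_clip ha
  have h2 := continuous_clip hb
  have h3 : Continuous (cI (fun x => a (max 0 x)) (fun x => b (max 0 x))) := by
    unfold cI
    apply intervalIntegral.continuous_parametric_intervalIntegral_of_continuous _ continuous_id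
    have : Continuous fun p : ℝ × ℝ => a (max 0 p.2) * b (max 0 (p.1 - p.2)) :=
      (h1.comp continuous_snd).mul (h2.comp (continuous_fst.sub continuous_snd))
    exact this
  refine h3.continuousOn.congr fun t ht => cI_congr ?_ ?_ ht <;>
  · intro x hx; rw [max_eq_right hx]

theorem cI_integrand_intervalIntegrable {a b : ℝ → ℝ} (ha : ContinuousOn a (Ici 0))
    (hb : ContinuousOn b (Ici 0)) {x y t : ℝ} (hx : 0 ≤ x) (hxy : x ≤ y) (hy : y ≤ t) :
    IntervalIntegrable (fun r => a r * b (t - r)) volume x y := by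
  apply ContinuousOn.intervalIntegrable
  rw [uIcc_of_le hxy]
  refine (ha.mono fun r hr => hx.trans hr.1).mul (hb.comp (by fun_prop) fun r hr => ?_)
  have := hr.2
  simp only [mem_Ici]; linarith

theorem abs_integral_mul_le {a b : ℝ → ℝ} {A B x y t : ℝ} (hA : 0 ≤ A)
    (ha : ∀ r, x ≤ r → r ≤ y → |a r| ≤ A)
    (hb : ∀ r, x ≤ r → r ≤ y → |b (t - r)| ≤ B) (hxy : x ≤ y) :
    |∫ r in x..y, a r * b (t - r)| ≤ A * B * (y - x) := by
  have := intervalIntegral.norm_integral_le_of_norm_le_const (a := x) (b := y) (C := A * B)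
    (f := fun r => a r * b (t - r)) (fun r hr => by
      rw [uIoc_of_le hxy] at hr
      rw [norm_mul]
      exact mul_le_mul (ha r hr.1.le hr.2) (hb r hr.1.le hr.2) (abs_nonneg _) hA)
  rwa [abs_of_nonneg (sub_nonneg.2 hxy)] at this

theorem abs_cI_le {a b : ℝ → ℝ} {A B t : ℝ} (hA : 0 ≤ A) (ha : ∀ r, 0 ≤ r → |a r| ≤ A)
    (hb : ∀ r, 0 ≤ r → |b r| ≤ B) (ht : 0 ≤ t) : |cI a b t| ≤ A * B * t := by
  have := abs_integral_mul_le (x := 0) (y := t) (t := t) hA (fun r hr _ => ha r hr)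
    (fun r _ hr => hb (t - r) (by linarith)) ht
  rwa [sub_zero] at this

/-- The derivative of a convolution, taken on the first factor. -/
theorem hasDerivWithinAt_cI {a a' b : ℝ → ℝ}
    (hd : ∀ t, 0 ≤ t → HasDerivWithinAt a (a' t) (Ici 0) t) (hc : ContinuousOn a' (Ici 0))
    (hb : ContinuousOn b (Ici 0)) {t : ℝ} (ht : 0 ≤ t) :
    HasDerivWithinAt (cI a b) (a 0 * b t + cI a' b t) (Ici 0) t := by
  obtain ⟨A, hA, hAa⟩ := exists_extension hd hc
  have hcA' := continuous_clip hc
  have hcB := continuous_clip hb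
  set A' := fun x => a' (max 0 x) with hA'
  set B := fun x => b (max 0 x) with hB
  have hcA : Continuous A := continuous_iff_continuousAt.2 fun x => (hA x).continuousAt
  have hc1 : Continuous fun p : ℝ × ℝ => ∫ r in (0 : ℝ)..p.1, A' (p.2 - r) * B r := by
    apply intervalIntegral.continuous_parametric_intervalIntegral_of_continuous _ continuous_fst
    have : Continuous fun p : (ℝ × ℝ) × ℝ => A' (p.1.2 - p.2) * B p.2 := by fun_prop
    exact this
  -- The upper limit and the parameter in the integrand are treated as independent variables. Both
  -- partial derivatives are continuous, so the function of two variables is differentiable and can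
  -- be restricted to the diagonal.
  have key := hasStrictFDerivAt_uncurry_coprod (𝕜 := ℝ) (u := (t, t))
    (f := fun x y => ∫ r in (0 : ℝ)..x, A (y - r) * B r)
    (f₁ := fun x y => ContinuousLinearMap.toSpanSingleton ℝ (A (y - x) * B x))
    (f₂ := fun x y => ContinuousLinearMap.toSpanSingleton ℝ (∫ r in (0 : ℝ)..x, A' (y - r) * B r))
    (Filter.Eventually.of_forall fun v => by
      have hcont : Continuous fun r => A (v.2 - r) * B r := by fun_prop
      exact (intervalIntegral.integral_hasDerivAt_right (hcont.intervalIntegrable _ _)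
        (hcont.stronglyMeasurableAtFilter _ _) hcont.continuousAt).hasFDerivAt)
    (Filter.Eventually.of_forall fun v => by
      obtain ⟨x, y⟩ := v
      have hK : IsCompact ((Metric.closedBall y 1) ×ˢ (uIcc 0 x)) :=
        (isCompact_closedBall y 1).prod isCompact_uIcc
      obtain ⟨C, hC⟩ := hK.exists_bound_of_continuousOn (f := fun p : ℝ × ℝ => A' (p.1 - p.2) * B p.2)
        (by fun_prop)
      exact (intervalIntegral.hasDerivAt_integral_of_dominated_loc_of_deriv_le
        (F := fun y r => A (y - r) * B r) (F' := fun y r => A' (y - r) * B r)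
        (bound := fun _ => C) (Metric.ball_mem_nhds y one_pos)
        (Filter.Eventually.of_forall fun z => by
          apply Continuous.aestronglyMeasurable; fun_prop)
        (by apply Continuous.intervalIntegrable; fun_prop)
        (by apply Continuous.aestronglyMeasurable; fun_prop)
        (Filter.Eventually.of_forall fun r hr z hz => hC (z, r)
          ⟨Metric.ball_subset_closedBall hz, uIoc_subset_uIcc hr⟩)
        intervalIntegrable_const
        (Filter.Eventually.of_forall fun r hr z hz => by
          have := (hA (z - r)).comp z ((hasDerivAt_id z).sub_const r)
          simp only [mul_one] at this
          exact this.mul_const (B r))).2.hasFDerivAt)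
    (by
      apply Continuous.continuousAt
      have : Continuous fun p : ℝ × ℝ =>
          ContinuousLinearMap.toSpanSingleton ℝ (A (p.2 - p.1) * B p.1) := by
        apply (ContinuousLinearMap.toSpanSingletonCLE (𝕜 := ℝ) (E := ℝ)).continuous.comp
        fun_prop
      exact this)
    (by
      apply Continuous.continuousAt
      have : Continuous fun p : ℝ × ℝ =>
          ContinuousLinearMap.toSpanSingleton ℝ (∫ r in (0 : ℝ)..p.1, A' (p.2 - r) * B r) :=
        (ContinuousLinearMap.toSpanSingletonCLE (𝕜 := ℝ) (E := ℝ)).continuous.comp hc1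
      exact this)
  have hdiag : HasDerivAt (fun s : ℝ => (s, s)) ((1 : ℝ), (1 : ℝ)) t :=
    (hasDerivAt_id t).prodMk (hasDerivAt_id t)
  have h1 := HasFDerivAt.comp_hasDerivAt (f := fun s : ℝ => (s, s)) t key.hasFDerivAt hdiag
  have h2 : HasDerivAt (fun s => ∫ r in (0 : ℝ)..s, A (s - r) * B r)
      (A 0 * B t + ∫ r in (0 : ℝ)..t, A' (t - r) * B r) t := by
    refine h1.congr_deriv ?_
    simp [Function.HasUncurry.uncurry]
  have e : ∀ x : ℝ, 0 ≤ x → max 0 x = x := fun x hx => max_eq_right hx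
  have h3 : cI a' b t = ∫ r in (0 : ℝ)..t, A' (t - r) * B r := by
    rw [← cI_eq_flip]
    exact cI_congr (fun x hx => by simp [hA', e x hx]) (fun x hx => by simp [hB, e x hx]) ht
  have h4 : ∀ s, 0 ≤ s → cI a b s = ∫ r in (0 : ℝ)..s, A (s - r) * B r := by
    intro s hs
    rw [← cI_eq_flip]
    exact cI_congr (fun x hx => (hAa x hx).symm) (fun x hx => by simp [hB, e x hx]) hs
  have h5 : a 0 * b t = A 0 * B t := by simp [hAa 0 le_rfl, hB, e t ht]
  rw [h3, h5]
  exact h2.hasDerivWithinAt.congr (fun s hs => h4 s hs) (h4 t ht)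

/-- Termwise differentiation on `[0, ∞)`. -/
theorem hasDerivWithinAt_tsum_Ici {ι : Type*} {f f' : ι → ℝ → ℝ}
    (hd : ∀ i t, 0 ≤ t → HasDerivWithinAt (f i) (f' i t) (Ici 0) t)
    (hc : ∀ i, ContinuousOn (f' i) (Ici 0))
    (hb : ∀ T : ℝ, ∃ u : ι → ℝ, Summable u ∧ ∀ i t, 0 ≤ t → t ≤ T → |f' i t| ≤ u i)
    (hs : ∀ t, 0 ≤ t → Summable fun i => f i t) {t : ℝ} (ht : 0 ≤ t) :
    HasDerivWithinAt (fun s => ∑' i, f i s) (∑' i, f' i t) (Ici 0) t := by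
  choose A hA hAf using fun i => exists_extension (hd i) (hc i)
  obtain ⟨u, hu, hub⟩ := hb (t + 1)
  have key := hasDerivAt_tsum_of_isPreconnected (g := A) (g' := fun i x => f' i (max 0 x)) hu
    (t := Iio (t + 1)) isOpen_Iio isPreconnected_Iio (fun i y _ => hA i y)
    (fun i y hy => hub i _ (le_max_left _ _) (max_le (by linarith) (le_of_lt hy)))
    (y₀ := t) (by simp) (by simpa only [hAf _ t ht] using hs t ht) (y := t) (by simp)
  rw [max_eq_right ht] at key
  refine key.hasDerivWithinAt.congr (fun s hs => ?_) ?_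
  · exact tsum_congr fun i => (hAf i s hs).symm
  · exact tsum_congr fun i => (hAf i t ht).symm

/-- The `n`-th derivative of the convolution of `a 0` and `b 0`, where the convolution is cut at
the time `τ` and the derivatives are moved to the factor with the large time argument. -/
def jetE (a b : ℕ → ℝ → ℝ) (n : ℕ) (τ t : ℝ) : ℝ :=
  (∫ r in (0 : ℝ)..τ, a 0 r * b n (t - r)) + (∫ r in τ..t, a n r * b 0 (t - r)) +
    ∑ i ∈ Finset.range n, a i τ * b (n - 1 - i) (t - τ)

/-- The expression does not depend on the cutting time. Differentiation in τ gives a₀bₙ - aₙb₀ from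
the limits of the two integrals, and the boundary sum telescopes to aₙb₀ - a₀bₙ. -/
theorem jetE_eq {a b : ℕ → ℝ → ℝ}
    (ha : ∀ n t, 0 ≤ t → HasDerivWithinAt (a n) (a (n + 1) t) (Ici 0) t)
    (hb : ∀ n t, 0 ≤ t → HasDerivWithinAt (b n) (b (n + 1) t) (Ici 0) t) (n : ℕ) {τ t : ℝ}
    (hτ : 0 ≤ τ) (hτt : τ ≤ t) : jetE a b n τ t = jetE a b n 0 t := by
  have ca : ∀ n, Continuous fun x => a n (max 0 x) := fun n =>
    continuous_clip fun x hx => (ha n x hx).continuousWithinAt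
  have cb : ∀ n, Continuous fun x => b n (max 0 x) := fun n =>
    continuous_clip fun x hx => (hb n x hx).continuousWithinAt
  set φ : ℝ → ℝ := fun r => a 0 (max 0 r) * b n (max 0 (t - r)) with hφ
  set ψ : ℝ → ℝ := fun r => a n (max 0 r) * b 0 (max 0 (t - r)) with hψ
  have cφ : Continuous φ := (ca 0).mul ((cb n).comp (continuous_const.sub continuous_id))
  have cψ : Continuous ψ := (ca n).mul ((cb 0).comp (continuous_const.sub continuous_id))
  have hE : ∀ x ∈ Icc 0 t, jetE a b n x t = (∫ r in (0 : ℝ)..x, φ r) + (∫ r in x..t, ψ r) +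
      ∑ i ∈ Finset.range n, a i x * b (n - 1 - i) (t - x) := by
    intro x hx
    unfold jetE
    congr 2
    · apply intervalIntegral.integral_congr
      intro r hr
      rw [uIcc_of_le hx.1] at hr
      simp only [hφ]
      rw [max_eq_right hr.1, max_eq_right (by linarith [hr.2, hx.2] : 0 ≤ t - r)]
    · apply intervalIntegral.integral_congr
      intro r hr
      rw [uIcc_of_le hx.2] at hr
      simp only [hψ]
      rw [max_eq_right (hx.1.trans hr.1), max_eq_right (by linarith [hr.2] : 0 ≤ t - r)]
  have hconst := constant_of_has_deriv_right_zero (a := 0) (b := t) (f := fun x =>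
      (∫ r in (0 : ℝ)..x, φ r) + (∫ r in x..t, ψ r) +
      ∑ i ∈ Finset.range n, a i x * b (n - 1 - i) (t - x)) (by
    refine ContinuousOn.add (ContinuousOn.add ?_ ?_) ?_
    · exact (intervalIntegral.continuous_primitive
        (fun _ _ => cφ.intervalIntegrable _ _) 0).continuousOn
    · have : Continuous fun x => ∫ r in x..t, ψ r := by
        simp_rw [intervalIntegral.integral_symm t]
        exact (intervalIntegral.continuous_primitive
          (fun _ _ => cψ.intervalIntegrable _ _) t).neg
      exact this.continuousOn
    · refine continuousOn_finsetSum _ fun i _ => ContinuousOn.mul ?_ ?_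
      · exact fun x hx => (ha i x hx.1).continuousWithinAt.mono Icc_subset_Ici_self
      · refine ContinuousOn.comp (t := Ici 0)
          (fun x hx => (hb _ x hx).continuousWithinAt) (by fun_prop) fun x hx => ?_
        simpa using hx.2) (by
    intro x hx
    have h1 := intervalIntegral.integral_hasDerivAt_right (cφ.intervalIntegrable 0 x)
        (cφ.stronglyMeasurableAtFilter _ _) cφ.continuousAt
    have h2 := intervalIntegral.integral_hasDerivAt_left (cψ.intervalIntegrable x t)
        (cψ.stronglyMeasurableAtFilter _ _) cψ.continuousAt
    have h3 : ∀ i ∈ Finset.range n, HasDerivWithinAt (fun x => a i x * b (n - 1 - i) (t - x))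
        (a (i + 1) x * b (n - (i + 1)) (t - x) - a i x * b (n - i) (t - x)) (Ici x) x := by
      intro i hi
      have hin := Finset.mem_range.1 hi
      have h4 : HasDerivWithinAt (a i) (a (i + 1) x) (Ici x) x :=
        (ha i x hx.1).mono (Ici_subset_Ici.2 hx.1)
      have hpos : 0 < t - x := by linarith [hx.2]
      have h5 : HasDerivAt (b (n - 1 - i)) (b (n - 1 - i + 1) (t - x)) (t - x) :=
        (hb _ (t - x) hpos.le).hasDerivAt (Ici_mem_nhds hpos)
      have h6 := h5.comp x ((hasDerivAt_id x).const_sub t)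
      refine (h4.mul h6.hasDerivWithinAt).congr_deriv ?_
      rw [show n - 1 - i + 1 = n - i by omega, show n - (i + 1) = n - 1 - i by omega]
      simp only [Function.comp_apply]
      ring
    have h7 := ((h1.hasDerivWithinAt (s := Ici x)).add (h2.hasDerivWithinAt (s := Ici x))).add
      (HasDerivWithinAt.fun_sum h3)
    refine h7.congr_deriv ?_
    rw [Finset.sum_range_sub (fun i => a i x * b (n - i) (t - x))]
    have hx' : 0 ≤ t - x := by linarith [hx.2]
    simp only [hφ, hψ, max_eq_right hx.1, max_eq_right hx', Nat.sub_self, Nat.sub_zero]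
    ring)
  rw [hE τ ⟨hτ, hτt⟩, hE 0 ⟨le_rfl, hτ.trans hτt⟩]
  exact hconst τ ⟨hτ, hτt⟩

end SemiDiscrete

end

noncomputable section

namespace SemiDiscrete

/-! ### Space-time convolutions -/

/-- Every time slice is bounded by one summable function. -/
def SumBd (f : ℝ → ℤ → ℝ) : Prop :=
  ∃ B : ℤ → ℝ, Summable B ∧ ∀ t, 0 ≤ t → ∀ l, |f t l| ≤ B l

/-- Boundedness for nonnegative times. -/
def SupBd (f : ℝ → ℤ → ℝ) : Prop := ∃ M : ℝ, ∀ t, 0 ≤ t → ∀ k, |f t k| ≤ M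

/-- Continuity in time. -/
def SCont (f : ℝ → ℤ → ℝ) : Prop := ∀ k, ContinuousOn (fun t => f t k) (Ici 0)

/-- A bound on the `L¹` norm. -/
def L1Bd (f : ℝ → ℤ → ℝ) (C : ℝ) : Prop :=
  ∀ T, 0 ≤ T → ∀ s : Finset ℤ, ∑ l ∈ s, ∫ r in (0 : ℝ)..T, |f r l| ≤ C

/-- The convolution, with the sum outside of the integral. -/
def cv (f u : ℝ → ℤ → ℝ) (t : ℝ) (k : ℤ) : ℝ :=
  ∑' l, cI (fun r => f r l) (fun r => u r (k - l)) t

theorem SupBd.bd_pow {f : ℝ → ℤ → ℝ} (h : SupBd f) (m : ℕ) : SupBd (fun t => (bd ^ m) (f t)) := by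
  obtain ⟨M, hM⟩ := h
  exact ⟨2 ^ m * M, fun t ht k => abs_bd_pow_le fun l _ _ => hM t ht l⟩

theorem SumBd.supBd {f : ℝ → ℤ → ℝ} (h : SumBd f) : SupBd f := by
  obtain ⟨B, hB, hfB⟩ := h
  have h0 : ∀ l, 0 ≤ B l := fun l => (abs_nonneg _).trans (hfB 0 le_rfl l)
  exact ⟨∑' l, B l, fun t ht k => (hfB t ht k).trans (hB.le_tsum k fun l _ => h0 l)⟩

theorem Tower.sCont {F : ℕ → ℝ → ℤ → ℝ} (h : Tower F) (n : ℕ) : SCont (F n) :=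
  fun k => h.continuousOn n k

theorem summable_inv_sq : Summable fun l : ℤ => ((1 + |(l : ℝ)|) ^ 2)⁻¹ := by
  have h : Summable fun n : ℕ => ((1 + (n : ℝ)) ^ 2)⁻¹ := by
    have := (summable_nat_add_iff 1).2 (Real.summable_nat_pow_inv.2 one_lt_two)
    refine this.congr fun n => ?_
    push_cast
    rw [add_comm]
  refine Summable.of_nat_of_neg ?_ ?_ <;> simpa using h

theorem one_add_abs_le_wt {t : ℝ} {k : ℤ} : 1 + |(k : ℝ)| ≤ wt t k := by
  unfold wt; linarith [Real.sqrt_nonneg t]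

theorem one_add_sqrt_le_wt {t : ℝ} {k : ℤ} : 1 + √t ≤ wt t k := by
  unfold wt; linarith [abs_nonneg (k : ℝ)]

theorem Dec.sumBd {p : ℕ} (hp : 2 ≤ p) {F : ℕ → ℝ → ℤ → ℝ} (h : Dec p F) (n : ℕ) : SumBd (F n) := by
  obtain ⟨C, h0, hC⟩ := h.nonneg_bound n 0
  refine ⟨fun l => C * ((1 + |(l : ℝ)|) ^ 2)⁻¹, summable_inv_sq.mul_left C, fun t ht l => ?_⟩
  have := hC t ht l
  beta_reduce
  rw [← div_eq_mul_inv, le_div_iff₀ (by positivity)]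
  refine le_trans ?_ this
  simp only [pow_zero, Module.End.one_apply]
  gcongr
  calc (1 + |(l : ℝ)|) ^ 2 ≤ wt t l ^ 2 := by gcongr; exact one_add_abs_le_wt
    _ ≤ _ := pow_le_pow_right₀ (one_le_wt t l) (by omega)

theorem integral_inv_sq_le {a T : ℝ} (ha : 0 < a) (hT : 0 ≤ T) :
    ∫ r in (0 : ℝ)..T, ((a + r) ^ 2)⁻¹ ≤ a⁻¹ := by
  have h : ∫ r in (0 : ℝ)..T, ((a + r) ^ 2)⁻¹ = -(a + T)⁻¹ - -(a + 0)⁻¹ := by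
    apply intervalIntegral.integral_eq_sub_of_hasDerivAt (f := fun r => -(a + r)⁻¹)
    · intro x hx
      rw [uIcc_of_le hT] at hx
      have hx' : a + x ≠ 0 := by have := hx.1; positivity
      have := (((hasDerivAt_id x).const_add a).inv hx').neg
      refine this.congr_deriv ?_
      simp only [id_eq]
      rw [neg_div, neg_neg, one_div]
    · apply ContinuousOn.intervalIntegrable
      rw [uIcc_of_le hT]
      have : ∀ x ∈ Icc 0 T, (a + x) ^ 2 ≠ 0 := fun x hx => by have := hx.1; positivity
      fun_prop (disch := assumption)
  rw [h, add_zero]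
  have : 0 ≤ (a + T)⁻¹ := by positivity
  linarith

/-- Decay of order 4 becomes integrable in time at a fixed site: the inverse of (x² + t)² has time
integral at most x⁻². -/
theorem sq_add_sq_le_wt_pow {t : ℝ} (ht : 0 ≤ t) {k : ℤ} {x : ℝ} (hx : 0 ≤ x)
    (hxk : x ≤ 1 + |(k : ℝ)|) : (x ^ 2 + t) ^ 2 ≤ wt t k ^ 4 := by
  have h : x ^ 2 + t ≤ wt t k ^ 2 := by
    have h1 : x + √t ≤ wt t k := by unfold wt; linarith
    have h2 : (x + √t) ^ 2 ≤ wt t k ^ 2 := by gcongr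
    nlinarith [Real.sq_sqrt ht, mul_nonneg hx (Real.sqrt_nonneg t)]
  calc _ ≤ (wt t k ^ 2) ^ 2 := by gcongr
    _ = _ := by ring

/-- The time integral of a function of order 4 at the site l is of size (1 + |l|)⁻², which is
summable. -/
theorem Dec.l1Bd {F : ℕ → ℝ → ℤ → ℝ} (h : Dec 4 F) (hT : Tower F) (n : ℕ) :
    ∃ C, L1Bd (F n) C := by
  obtain ⟨C, h0, hC⟩ := h.nonneg_bound n 0
  refine ⟨C * ∑' l : ℤ, ((1 + |(l : ℝ)|) ^ 2)⁻¹, fun T hT0 s => ?_⟩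
  calc _ ≤ ∑ l ∈ s, C * ((1 + |(l : ℝ)|) ^ 2)⁻¹ := by
        refine Finset.sum_le_sum fun l _ => ?_
        have h1 : ∀ r ∈ Icc 0 T, |F n r l| ≤ C * (((1 + |(l : ℝ)|) ^ 2 + r) ^ 2)⁻¹ := by
          intro r hr
          have hr0 := hr.1
          rw [← div_eq_mul_inv, le_div_iff₀ (by positivity)]
          refine le_trans ?_ (hC r hr.1 l)
          simp only [pow_zero, Module.End.one_apply]
          gcongr
          calc _ ≤ wt r l ^ 4 := sq_add_sq_le_wt_pow hr.1 (by positivity) le_rfl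
            _ ≤ _ := pow_le_pow_right₀ (one_le_wt r l) (by omega)
        calc _ ≤ ∫ r in (0 : ℝ)..T, C * (((1 + |(l : ℝ)|) ^ 2 + r) ^ 2)⁻¹ := by
              apply intervalIntegral.integral_mono_on hT0 _ _ h1
              · apply ContinuousOn.intervalIntegrable
                rw [uIcc_of_le hT0]
                exact ((hT.continuousOn n l).mono Icc_subset_Ici_self).abs
              · apply ContinuousOn.intervalIntegrable
                rw [uIcc_of_le hT0]
                have : ∀ x ∈ Icc 0 T, ((1 + |(l : ℝ)|) ^ 2 + x) ^ 2 ≠ 0 :=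
                  fun x hx => by have := hx.1; positivity
                fun_prop (disch := assumption)
          _ ≤ _ := by
            rw [intervalIntegral.integral_const_mul]
            gcongr
            exact integral_inv_sq_le (by positivity) hT0
    _ = C * ∑ l ∈ s, ((1 + |(l : ℝ)|) ^ 2)⁻¹ := by rw [Finset.mul_sum]
    _ ≤ _ := by
      gcongr
      exact summable_inv_sq.sum_le_tsum s fun l _ => by positivity

theorem L1Bd.nonneg {f : ℝ → ℤ → ℝ} {C : ℝ} (h : L1Bd f C) : 0 ≤ C := by
  simpa using h 0 le_rfl ∅

theorem summable_mul_of_sumBd {f : ℝ → ℤ → ℝ} (hf : SumBd f) {u : ℝ → ℤ → ℝ} (hu : SupBd u)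
    {t t' : ℝ} (ht : 0 ≤ t) (ht' : 0 ≤ t') (k : ℤ) :
    Summable fun l => f t l * u t' (k - l) := by
  obtain ⟨B, hB, hfB⟩ := hf
  obtain ⟨M, hM⟩ := hu
  refine Summable.of_norm_bounded (hB.mul_right M) fun l => ?_
  rw [norm_mul]
  exact mul_le_mul (hfB t ht l) (hM t' ht' _) (abs_nonneg _) ((abs_nonneg _).trans (hfB t ht l))

theorem summable_cI {f : ℝ → ℤ → ℝ} (hf : SumBd f) {u : ℝ → ℤ → ℝ} (hu : SupBd u)
    {t : ℝ} (ht : 0 ≤ t) (k : ℤ) :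
    Summable fun l => cI (fun r => f r l) (fun r => u r (k - l)) t := by
  obtain ⟨B, hB, hfB⟩ := hf
  obtain ⟨M, hM⟩ := hu
  refine Summable.of_norm_bounded ((hB.mul_right M).mul_right t) fun l => ?_
  exact abs_cI_le ((abs_nonneg _).trans (hfB 0 le_rfl l)) (fun r hr => hfB r hr l)
    (fun r hr => hM r hr _) ht

/-- Bound of a sum of integrals by the `L¹` norm of the kernel. -/
theorem abs_tsum_integral_le {f : ℝ → ℤ → ℝ} (hc : SCont f) {C : ℝ} (hf : L1Bd f C)
    {w : ℤ → ℝ → ℝ} {X τ : ℝ} (hτ : 0 ≤ τ) (hw : ∀ l r, 0 ≤ r → r ≤ τ → |w l r| ≤ X) :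
    |∑' l, ∫ r in (0 : ℝ)..τ, f r l * w l r| ≤ C * X := by
  have hX : 0 ≤ X := (abs_nonneg _).trans (hw 0 0 le_rfl hτ)
  have h1 : ∀ l, ‖∫ r in (0 : ℝ)..τ, f r l * w l r‖ ≤ (∫ r in (0 : ℝ)..τ, |f r l|) * X := by
    intro l
    rw [← intervalIntegral.integral_mul_const]
    apply intervalIntegral.norm_integral_le_of_norm_le hτ
    · refine Filter.Eventually.of_forall fun r hr => ?_
      rw [norm_mul]
      exact mul_le_mul_of_nonneg_left (hw l r hr.1.le hr.2) (abs_nonneg _)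
    · apply ContinuousOn.intervalIntegrable
      rw [uIcc_of_le hτ]
      exact (((hc l).mono Icc_subset_Ici_self).abs).mul continuousOn_const
  have h2 : ∀ s : Finset ℤ, ∑ l ∈ s, ‖∫ r in (0 : ℝ)..τ, f r l * w l r‖ ≤ C * X := fun s => by
    calc _ ≤ ∑ l ∈ s, (∫ r in (0 : ℝ)..τ, |f r l|) * X := Finset.sum_le_sum fun l _ => h1 l
      _ ≤ _ := by rw [← Finset.sum_mul]; gcongr; exact hf τ hτ s
  have h3 : Summable fun l => ‖∫ r in (0 : ℝ)..τ, f r l * w l r‖ :=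
    summable_of_sum_le (fun _ => norm_nonneg _) h2
  exact (norm_tsum_le_tsum_norm h3).trans (h3.tsum_le_of_sum_le h2)

/-- Bound of a sum of integrals, with the sum in space taken over the second factor. -/
theorem abs_tsum_integral_le' {u : ℝ → ℤ → ℝ} (hc : SCont u) {H : ℝ}
    (hH : ∀ t, 0 ≤ t → ∀ s : Finset ℤ, ∑ l ∈ s, |u t l| ≤ H)
    {w : ℤ → ℝ → ℝ} {φ : ℝ → ℝ} {x y t : ℝ} (k : ℤ) (hxy : x ≤ y) (hyt : y ≤ t)
    (hφ : ContinuousOn φ (Icc x y)) (hw : ∀ l r, x ≤ r → r ≤ y → |w l r| ≤ φ r) :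
    |∑' l, ∫ r in x..y, w l r * u (t - r) (k - l)| ≤ H * ∫ r in x..y, φ r := by
  have hφ0 : ∀ r, x ≤ r → r ≤ y → 0 ≤ φ r := fun r h1 h2 => (abs_nonneg _).trans (hw 0 r h1 h2)
  have hcont : ∀ l, ContinuousOn (fun r => φ r * |u (t - r) (k - l)|) (Icc x y) := fun l =>
    hφ.mul ((hc (k - l)).comp (by fun_prop) fun r hr => by
      have := hr.2
      simp only [mem_Ici]; linarith).abs
  have hint : ∀ l, IntervalIntegrable (fun r => φ r * |u (t - r) (k - l)|) volume x y := fun l => by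
    apply ContinuousOn.intervalIntegrable
    rw [uIcc_of_le hxy]
    exact hcont l
  have h1 : ∀ l, ‖∫ r in x..y, w l r * u (t - r) (k - l)‖ ≤
      ∫ r in x..y, φ r * |u (t - r) (k - l)| := by
    intro l
    apply intervalIntegral.norm_integral_le_of_norm_le hxy _ (hint l)
    refine Filter.Eventually.of_forall fun r hr => ?_
    rw [norm_mul]
    exact mul_le_mul_of_nonneg_right (hw l r hr.1.le hr.2) (abs_nonneg _)
  have h2 : ∀ s : Finset ℤ, ∑ l ∈ s, ‖∫ r in x..y, w l r * u (t - r) (k - l)‖ ≤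
      H * ∫ r in x..y, φ r := fun s => by
    calc _ ≤ ∑ l ∈ s, ∫ r in x..y, φ r * |u (t - r) (k - l)| := Finset.sum_le_sum fun l _ => h1 l
      _ = ∫ r in x..y, ∑ l ∈ s, φ r * |u (t - r) (k - l)| :=
        (intervalIntegral.integral_finsetSum fun l _ => hint l).symm
      _ ≤ ∫ r in x..y, H * φ r := by
        apply intervalIntegral.integral_mono_on hxy
        · apply ContinuousOn.intervalIntegrable
          rw [uIcc_of_le hxy]
          exact continuousOn_finsetSum s fun l _ => hcont l
        · apply ContinuousOn.intervalIntegrable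
          rw [uIcc_of_le hxy]
          exact continuousOn_const.mul hφ
        · intro r hr
          rw [← Finset.mul_sum, mul_comm H]
          refine mul_le_mul_of_nonneg_left ?_ (hφ0 r hr.1 hr.2)
          have := hH (t - r) (by linarith [hr.2]) (s.map (Equiv.subLeft k).toEmbedding)
          simpa using this
      _ = _ := intervalIntegral.integral_const_mul _ _
  have h3 : Summable fun l => ‖∫ r in x..y, w l r * u (t - r) (k - l)‖ :=
    summable_of_sum_le (fun _ => norm_nonneg _) h2
  exact (norm_tsum_le_tsum_norm h3).trans (h3.tsum_le_of_sum_le h2)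

theorem abs_cv_le {f u : ℝ → ℤ → ℝ} (hc : SCont f) {C M : ℝ} (hf : L1Bd f C)
    (hu : ∀ t, 0 ≤ t → ∀ k, |u t k| ≤ M) {t : ℝ} (ht : 0 ≤ t) (k : ℤ) : |cv f u t k| ≤ C * M :=
  abs_tsum_integral_le hc hf (w := fun l r => u (t - r) (k - l)) ht
    fun l r _ hr => hu (t - r) (by linarith) (k - l)

/-- After reflecting both variables, sum and integral are exchanged by dominated convergence. With
the sum outside, each site can be treated by scalar calculus and with its own cutting time. -/
theorem conv_eq_cv {f u : ℝ → ℤ → ℝ} (hf : SumBd f) (hfc : SCont f) (hu : SupBd u) (huc : SCont u)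
    {t : ℝ} (ht : 0 ≤ t) (k : ℤ) : conv 1 f u t k = cv f u t k := by
  have hf' := hf
  have hu' := hu
  obtain ⟨B, hB, hfB⟩ := hf
  obtain ⟨M, hM⟩ := hu
  have h1 : ∀ s, ∑' l : ℤ, f (t - s) (k - l) * u s l =
      ∑' l : ℤ, f (t - s) l * u s (k - l) := by
    intro s
    rw [← (Equiv.subLeft k).tsum_eq]
    simp
  have h2 := intervalIntegral.integral_comp_sub_left (a := 0) (b := t)
    (fun r => ∑' l : ℤ, f r l * u (t - r) (k - l)) t
  simp only [sub_sub_cancel, sub_self, sub_zero] at h2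
  unfold conv
  simp only [one_mul, h1]
  rw [h2]
  have h3 := intervalIntegral.hasSum_integral_of_dominated_convergence (μ := volume)
    (F := fun l r => f r l * u (t - r) (k - l)) (a := 0) (b := t)
    (f := fun r => ∑' l : ℤ, f r l * u (t - r) (k - l)) (fun l _ => B l * M)
    (fun l => by
      apply ContinuousOn.aestronglyMeasurable _ measurableSet_uIoc
      rw [uIoc_of_le ht]
      refine ((hfc l).mono fun r hr => hr.1.le).mul ((huc (k - l)).comp (by fun_prop) fun r hr => ?_)
      have := hr.2
      simp only [mem_Ici]; linarith)
    (fun l => Filter.Eventually.of_forall fun r hr => by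
      rw [uIoc_of_le ht] at hr
      rw [norm_mul]
      exact mul_le_mul (hfB r hr.1.le l) (hM _ (by linarith [hr.2]) _) (abs_nonneg _)
        ((abs_nonneg _).trans (hfB 0 le_rfl l)))
    (Filter.Eventually.of_forall fun r hr => hB.mul_right M)
    intervalIntegrable_const
    (Filter.Eventually.of_forall fun r hr => by
      rw [uIoc_of_le ht] at hr
      exact (summable_mul_of_sumBd hf' hu' hr.1.le (by linarith [hr.2]) k).hasSum)
  exact h3.tsum_eq.symm

theorem hasDerivWithinAt_cv {f f' u : ℝ → ℤ → ℝ} (hf : SumBd f) (hf' : SumBd f') (hfc' : SCont f')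
    (hd : ∀ k t, 0 ≤ t → HasDerivWithinAt (fun s => f s k) (f' t k) (Ici 0) t)
    (hu : SupBd u) (huc : SCont u) {t : ℝ} (ht : 0 ≤ t) (k : ℤ) :
    HasDerivWithinAt (fun s => cv f u s k) ((∑' l, f 0 l * u t (k - l)) + cv f' u t k) (Ici 0) t := by
  have hs1 := summable_mul_of_sumBd hf hu le_rfl ht k
  have hs2 := summable_cI hf' hu ht k
  rw [cv, ← hs1.tsum_add hs2]
  refine hasDerivWithinAt_tsum_Ici (f := fun l => cI (fun r => f r l) (fun r => u r (k - l)))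
    (f' := fun l t => f 0 l * u t (k - l) + cI (fun r => f' r l) (fun r => u r (k - l)) t)
    (fun l t ht => hasDerivWithinAt_cI (hd l) (hfc' l) (huc _) ht)
    (fun l => (continuousOn_const.mul (huc _)).add (cI_continuousOn (hfc' l) (huc _))) ?_
    (fun t ht => summable_cI hf hu ht k) ht
  intro T
  obtain ⟨B, hB, hfB⟩ := hf
  obtain ⟨B', hB', hfB'⟩ := hf'
  obtain ⟨M, hM⟩ := hu
  refine ⟨fun l => B l * M + B' l * M * |T|, (hB.mul_right M).add ((hB'.mul_right M).mul_right _),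
    fun l t ht htT => (abs_add_le _ _).trans (add_le_add ?_ ?_)⟩
  · rw [abs_mul]
    exact mul_le_mul (hfB 0 le_rfl l) (hM t ht _) (abs_nonneg _)
      ((abs_nonneg _).trans (hfB 0 le_rfl l))
  · have h0 : 0 ≤ B' l := (abs_nonneg _).trans (hfB' 0 le_rfl l)
    have hM0 : 0 ≤ M := (abs_nonneg _).trans (hM 0 le_rfl 0)
    refine (abs_cI_le h0 (fun r hr => hfB' r hr l) (fun r hr => hM r hr _) ht).trans ?_
    gcongr
    exact htT.trans (le_abs_self T)

theorem hasDerivWithinAt_tsum_mul {f u u' : ℝ → ℤ → ℝ} (hf : SumBd f) (hu : SupBd u)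
    (hu' : SupBd u') (huc' : SCont u')
    (hd : ∀ k t, 0 ≤ t → HasDerivWithinAt (fun s => u s k) (u' t k) (Ici 0) t)
    {t : ℝ} (ht : 0 ≤ t) (k : ℤ) :
    HasDerivWithinAt (fun s => ∑' l, f 0 l * u s (k - l)) (∑' l, f 0 l * u' t (k - l)) (Ici 0) t := by
  refine hasDerivWithinAt_tsum_Ici (f := fun l s => f 0 l * u s (k - l))
    (f' := fun l s => f 0 l * u' s (k - l)) (fun l t ht => (hd _ t ht).const_mul _)
    (fun l => continuousOn_const.mul (huc' _)) ?_
    (fun t ht => summable_mul_of_sumBd hf hu le_rfl ht k) ht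
  intro T
  obtain ⟨B, hB, hfB⟩ := hf
  obtain ⟨M, hM⟩ := hu'
  refine ⟨fun l => B l * M, hB.mul_right M, fun l t ht _ => ?_⟩
  rw [abs_mul]
  exact mul_le_mul (hfB 0 le_rfl l) (hM t ht _) (abs_nonneg _)
    ((abs_nonneg _).trans (hfB 0 le_rfl l))

/-- The time derivatives of the convolution of `F 0` and `U 0`. -/
def convT (F U : ℕ → ℝ → ℤ → ℝ) (n : ℕ) (t : ℝ) (k : ℤ) : ℝ :=
  cv (F n) (U 0) t k + ∑ i ∈ Finset.range n, ∑' l, F i 0 l * U (n - 1 - i) t (k - l)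

/-- The integral part differentiates F alone and the boundary terms of `convT F U n` contain only
derivatives of U below n. The hypotheses on U are therefore restricted to orders at most n, which
lets the regularity of a solution of a fixed-point equation be bootstrapped. -/
theorem hasDerivWithinAt_convT {F U : ℕ → ℝ → ℤ → ℝ} (hF : Tower F) (hFs : ∀ n, SumBd (F n)) {n : ℕ}
    (hU : ∀ j < n, ∀ k t, 0 ≤ t → HasDerivWithinAt (fun s => U j s k) (U (j + 1) t k) (Ici 0) t)
    (hUb : ∀ j ≤ n, SupBd (U j)) (hUc : ∀ j ≤ n, SCont (U j)) {t : ℝ} (ht : 0 ≤ t) (k : ℤ) :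
    HasDerivWithinAt (fun s => convT F U n s k) (convT F U (n + 1) t k) (Ici 0) t := by
  have h1 := hasDerivWithinAt_cv (hFs n) (hFs (n + 1)) (hF.sCont _) (fun k t ht => hF n k t ht)
    (hUb 0 (Nat.zero_le n)) (hUc 0 (Nat.zero_le n)) ht k
  have h2 : ∀ i ∈ Finset.range n, HasDerivWithinAt
      (fun s => ∑' l, F i 0 l * U (n - 1 - i) s (k - l))
      (∑' l, F i 0 l * U (n + 1 - 1 - i) t (k - l)) (Ici 0) t := by
    intro i hi
    have hin := Finset.mem_range.1 hi
    have := hasDerivWithinAt_tsum_mul (hFs i) (hUb (n - 1 - i) (by omega))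
      (hUb (n - 1 - i + 1) (by omega)) (hUc _ (by omega))
      (fun k t ht => hU (n - 1 - i) (by omega) k t ht) ht k
    rwa [show n - 1 - i + 1 = n + 1 - 1 - i by omega] at this
  refine (h1.add (HasDerivWithinAt.fun_sum h2)).congr_deriv ?_
  rw [convT, Finset.sum_range_succ, show n + 1 - 1 - n = 0 by omega]
  ring

theorem tower_convT {F U : ℕ → ℝ → ℤ → ℝ} (hF : Tower F) (hFs : ∀ n, SumBd (F n)) (hU : Tower U)
    (hUb : ∀ n, SupBd (U n)) : Tower (convT F U) :=
  fun _ k _ ht => hasDerivWithinAt_convT hF hFs (fun j _ => hU j) (fun j _ => hUb j)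
    (fun j _ => hU.sCont j) ht k

theorem sCont_tsum_mul {f u : ℝ → ℤ → ℝ} (hf : SumBd f) (hu : SupBd u) (huc : SCont u) :
    SCont (fun t k => ∑' l, f 0 l * u t (k - l)) := by
  obtain ⟨B, hB, hfB⟩ := hf
  obtain ⟨M, hM⟩ := hu
  intro k
  refine continuousOn_tsum (fun l => continuousOn_const.mul (huc (k - l))) (hB.mul_right M)
    fun l t ht => ?_
  rw [norm_mul]
  exact mul_le_mul (hfB 0 le_rfl l) (hM t ht _) (abs_nonneg _)
    ((abs_nonneg _).trans (hfB 0 le_rfl l))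

theorem sCont_cv {f f' u : ℝ → ℤ → ℝ} (hf : SumBd f) (hf' : SumBd f') (hfc' : SCont f')
    (hd : ∀ k t, 0 ≤ t → HasDerivWithinAt (fun s => f s k) (f' t k) (Ici 0) t)
    (hu : SupBd u) (huc : SCont u) : SCont (cv f u) :=
  fun k _ ht => (hasDerivWithinAt_cv hf hf' hfc' hd hu huc ht k).continuousWithinAt

theorem sCont_convT {F U : ℕ → ℝ → ℤ → ℝ} (hF : Tower F) (hFs : ∀ n, SumBd (F n)) {n : ℕ}
    (hUb : ∀ j ≤ n - 1, SupBd (U j)) (hUc : ∀ j ≤ n - 1, SCont (U j)) : SCont (convT F U n) := by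
  intro k
  refine (sCont_cv (hFs n) (hFs (n + 1)) (hF.sCont _) (fun k t ht => hF n k t ht)
    (hUb 0 (Nat.zero_le _)) (hUc 0 (Nat.zero_le _)) k).add ?_
  exact continuousOn_finsetSum _ fun i _ =>
    sCont_tsum_mul (hFs i) (hUb _ (Nat.sub_le _ _)) (hUc _ (Nat.sub_le _ _)) k

/-- The contribution of the lattice point `l` to `convT`. -/
def jt (F U : ℕ → ℝ → ℤ → ℝ) (n : ℕ) (t : ℝ) (l k : ℤ) : ℝ :=
  jetE (fun i r => F i r l) (fun i r => U i r k) n 0 t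

theorem jt_eq_cI (F U : ℕ → ℝ → ℤ → ℝ) (n : ℕ) (t : ℝ) (l k : ℤ) : jt F U n t l k =
    cI (fun r => F n r l) (fun r => U 0 r k) t +
      ∑ i ∈ Finset.range n, F i 0 l * U (n - 1 - i) t k := by
  simp [jt, jetE, cI]

/-- The cutting time is free at each site: τ = t leaves all time derivatives on U, τ = 0 puts them
on F, and τ = t / N gives each derivative to the factor with the large time argument. -/
theorem jt_eq_of_cut {F U : ℕ → ℝ → ℤ → ℝ} (hF : Tower F) (hU : Tower U) (n : ℕ) {τ t : ℝ}
    (hτ : 0 ≤ τ) (hτt : τ ≤ t) (l k : ℤ) : jt F U n t l k =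
    (∫ r in (0 : ℝ)..τ, F 0 r l * U n (t - r) k) + (∫ r in τ..t, F n r l * U 0 (t - r) k) +
      ∑ i ∈ Finset.range n, F i τ l * U (n - 1 - i) (t - τ) k :=
  (jetE_eq (a := fun i r => F i r l) (b := fun i r => U i r k) (fun n t ht => hF n l t ht)
    (fun n t ht => hU n k t ht) n hτ hτt).symm

theorem summable_jt {F U : ℕ → ℝ → ℤ → ℝ} (hFs : ∀ n, SumBd (F n)) (hUb : ∀ n, SupBd (U n))
    (n : ℕ) {t : ℝ} (ht : 0 ≤ t) (k : ℤ) : Summable fun l => jt F U n t l (k - l) := by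
  simp only [jt_eq_cI]
  exact (summable_cI (hFs n) (hUb 0) ht k).add
    (summable_sum fun i _ => summable_mul_of_sumBd (hFs i) (hUb _) le_rfl ht k)

theorem convT_eq_tsum_jt {F U : ℕ → ℝ → ℤ → ℝ} (hFs : ∀ n, SumBd (F n)) (hUb : ∀ n, SupBd (U n))
    (n : ℕ) {t : ℝ} (ht : 0 ≤ t) (k : ℤ) : convT F U n t k = ∑' l, jt F U n t l (k - l) := by
  simp only [jt_eq_cI]
  rw [Summable.tsum_add (summable_cI (hFs n) (hUb 0) ht k)
    (summable_sum fun i _ => summable_mul_of_sumBd (hFs i) (hUb _) le_rfl ht k),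
    Summable.tsum_finsetSum fun i _ => summable_mul_of_sumBd (hFs i) (hUb _) le_rfl ht k]
  rfl

theorem jt_BD_left {F U : ℕ → ℝ → ℤ → ℝ} (hF : Tower F) (hU : Tower U) (n : ℕ) {t : ℝ}
    (ht : 0 ≤ t) (l k : ℤ) : jt (BD 1 F) U n t l k = jt F U n t l k - jt F U n t (l - 1) k := by
  simp only [jt_eq_cI, BD, pow_one, bd_apply, cI, sub_mul, Finset.sum_sub_distrib]
  rw [intervalIntegral.integral_sub]
  · ring
  all_goals
    exact cI_integrand_intervalIntegrable (hF.continuousOn _ _) (hU.continuousOn _ _)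
      le_rfl ht le_rfl

theorem jt_BD_right {F U : ℕ → ℝ → ℤ → ℝ} (hF : Tower F) (hU : Tower U) (n : ℕ) {t : ℝ}
    (ht : 0 ≤ t) (l k : ℤ) : jt F (BD 1 U) n t l k = jt F U n t l k - jt F U n t l (k - 1) := by
  simp only [jt_eq_cI, BD, pow_one, bd_apply, cI, mul_sub, Finset.sum_sub_distrib]
  rw [intervalIntegral.integral_sub]
  · ring
  all_goals
    exact cI_integrand_intervalIntegrable (hF.continuousOn _ _) (hU.continuousOn _ _)
      le_rfl ht le_rfl

theorem BD_BD (m j : ℕ) (F : ℕ → ℝ → ℤ → ℝ) : BD m (BD j F) = BD (m + j) F := by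
  ext n t k
  simp [BD, bd_pow_add]

theorem SupBd.BD {U : ℕ → ℝ → ℤ → ℝ} (h : ∀ n, SupBd (U n)) (m n : ℕ) : SupBd (BD m U n) :=
  (h n).bd_pow m

theorem bd_pow_convT {F U : ℕ → ℝ → ℤ → ℝ} (hF : Tower F) (hFs : ∀ n, SumBd (F n)) (hU : Tower U)
    (hUb : ∀ n, SupBd (U n)) (m n : ℕ) {t : ℝ} (ht : 0 ≤ t) (k : ℤ) :
    (bd ^ m) (convT F U n t) k = convT F (BD m U) n t k := by
  induction m generalizing U with
  | zero =>
    have : BD 0 U = U := by ext n t k; simp [BD]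
    simp [this]
  | succ m ih =>
    have h1 : bd (convT F U n t) = convT F (BD 1 U) n t := by
      ext k
      rw [bd_apply, convT_eq_tsum_jt hFs hUb n ht, convT_eq_tsum_jt hFs hUb n ht,
        convT_eq_tsum_jt hFs (SupBd.BD hUb 1) n ht,
        ← Summable.tsum_sub (summable_jt hFs hUb n ht k) (summable_jt hFs hUb n ht (k - 1))]
      refine tsum_congr fun l => ?_
      rw [jt_BD_right hF hU n ht, sub_right_comm]
    rw [bd_pow_succ, h1, ih (hU.BD 1) (SupBd.BD hUb 1), BD_BD]

theorem convT_even {F U : ℕ → ℝ → ℤ → ℝ} (hF : ∀ n t k, F n t (-k) = F n t k)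
    (hU : ∀ n t k, U n t (-k) = U n t k) (n : ℕ) (t : ℝ) (k : ℤ) :
    convT F U n t (-k) = convT F U n t k := by
  have h : ∀ φ : ℤ → ℤ → ℝ, (∀ l k, φ (-l) (-k) = φ l k) →
      ∑' l, φ l (-k - l) = ∑' l, φ l (k - l) := by
    intro φ hφ
    rw [← (Equiv.neg ℤ).tsum_eq]
    refine tsum_congr fun l => ?_
    rw [Equiv.neg_apply, show -k - -l = -(k - l) by ring, hφ]
  unfold convT cv
  rw [h (fun l k => cI (fun r => F n r l) (fun r => U 0 r k) t) (by simp [hF, hU])]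
  congr 1
  refine Finset.sum_congr rfl fun i _ => ?_
  exact h (fun l k => F i 0 l * U (n - 1 - i) t k) (by simp [hF, hU])

end SemiDiscrete

end

noncomputable section

namespace SemiDiscrete

/-! ### Summation by parts -/

section Abel

variable {X : ℕ → ℕ → ℤ → ℤ → ℝ}

/-- `X i j l k` stands for a bilinear expression in the i-th difference of one factor at l and the
j-th difference of the other at k. Translation of the summation index moves a difference between the
factors without boundary term. -/
theorem tsum_abel_step (h1 : ∀ i j l k, X (i + 1) j l k = X i j l k - X i j (l - 1) k)
    (h2 : ∀ i j l k, X i (j + 1) l k = X i j l k - X i j l (k - 1))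
    (hs : ∀ i j k, Summable fun l => X i j l (k - l)) (i j : ℕ) (k : ℤ) :
    ∑' l, X i (j + 1) l (k - l) = ∑' l, X (i + 1) j l (k - l) := by
  have hs1 : Summable fun l => X i j (l - 1) (k - l) := by
    have := (Equiv.subRight (1 : ℤ)).summable_iff.2 (hs i j (k - 1))
    refine this.congr fun l => ?_
    simp only [Function.comp_apply, Equiv.subRight_apply]
    congr 1; ring
  have e : ∑' l, X i j (l - 1) (k - l) = ∑' l, X i j l (k - 1 - l) := by
    rw [← (Equiv.subRight (1 : ℤ)).tsum_eq (fun l => X i j l (k - 1 - l))]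
    refine tsum_congr fun l => ?_
    simp only [Equiv.subRight_apply]
    congr 1; ring
  simp only [h1, h2]
  rw [(hs i j k).tsum_sub hs1, e, ← (hs i j k).tsum_sub (hs i j (k - 1))]
  refine tsum_congr fun l => ?_
  rw [sub_right_comm]

theorem tsum_abel (h1 : ∀ i j l k, X (i + 1) j l k = X i j l k - X i j (l - 1) k)
    (h2 : ∀ i j l k, X i (j + 1) l k = X i j l k - X i j l (k - 1))
    (hs : ∀ i j k, Summable fun l => X i j l (k - l)) (m i : ℕ) (k : ℤ) :
    ∑' l, X i m l (k - l) = ∑' l, X (i + m) 0 l (k - l) := by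
  induction m generalizing i with
  | zero => simp
  | succ m ih =>
    rw [tsum_abel_step h1 h2 hs, ih, show i + 1 + m = i + (m + 1) by ring]

/-- On the half-line l > M the translated sum starts one site earlier, and this single site l = M is
the boundary term. -/
theorem tsum_abel_cut_step (h1 : ∀ i j l k, X (i + 1) j l k = X i j l k - X i j (l - 1) k)
    (h2 : ∀ i j l k, X i (j + 1) l k = X i j l k - X i j l (k - 1))
    (hs : ∀ i j k, Summable fun l => X i j l (k - l)) (i j : ℕ) (k M : ℤ) :
    ∑' l, (if M < l then X i (j + 1) l (k - l) else 0) =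
      (∑' l, if M < l then X (i + 1) j l (k - l) else 0) + X i j M (k - M - 1) := by
  have hind : ∀ (Y : ℤ → ℝ) (c : ℤ), Summable Y → Summable fun l => if c < l then Y l else 0 := by
    intro Y c hY
    refine (hY.indicator {l | c < l}).congr fun l => ?_
    simp [indicator_apply]
  have hψ : Summable fun l => X i j l (k - 1 - l) := hs i j (k - 1)
  have hψ1 : Summable fun l => if M < l + 1 then X i j l (k - 1 - l) else 0 := by
    have := hind _ (M - 1) hψ
    refine this.congr fun l => ?_
    congr 1
    exact propext ⟨fun h => by linarith, fun h => by linarith⟩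
  have e1 : ∑' l, (if M < l + 1 then X i j l (k - 1 - l) else 0) =
      ∑' l, if M < l then X i j (l - 1) (k - l) else 0 := by
    rw [← (Equiv.subRight (1 : ℤ)).tsum_eq]
    refine tsum_congr fun l => ?_
    simp only [Equiv.subRight_apply, sub_add_cancel]
    rw [show k - 1 - (l - 1) = k - l by ring]
  have hψ2 : Summable fun l => if M < l then X i j (l - 1) (k - l) else 0 := by
    have := (Equiv.subRight (1 : ℤ)).summable_iff.2 hψ1
    refine this.congr fun l => ?_
    simp only [Function.comp_apply, Equiv.subRight_apply, sub_add_cancel]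
    rw [show k - 1 - (l - 1) = k - l by ring]
  have e2 : ∑' l, (if M < l + 1 then X i j l (k - 1 - l) else 0) =
      (∑' l, if M < l then X i j l (k - 1 - l) else 0) + X i j M (k - M - 1) := by
    rw [← sub_eq_iff_eq_add', ← hψ1.tsum_sub (hind _ M hψ), tsum_eq_single M]
    · simp [sub_right_comm]
    · intro l hl
      by_cases h : M < l
      · simp [h, h.trans (lt_add_one l)]
      · have : ¬ M < l + 1 := by
          intro h'
          exact hl (le_antisymm (not_lt.1 h) (Int.lt_add_one_iff.1 h'))
        simp [h, this]
  have e3 : ∑' l, (if M < l then X i (j + 1) l (k - l) else 0) =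
      (∑' l, if M < l then X i j l (k - l) else 0) -
        ∑' l, if M < l then X i j l (k - 1 - l) else 0 := by
    rw [← (hind _ M (hs i j k)).tsum_sub (hind _ M hψ)]
    refine tsum_congr fun l => ?_
    split_ifs
    · rw [h2, sub_right_comm]
    · simp
  have e4 : ∑' l, (if M < l then X (i + 1) j l (k - l) else 0) =
      (∑' l, if M < l then X i j l (k - l) else 0) -
        ∑' l, if M < l then X i j (l - 1) (k - l) else 0 := by
    rw [← (hind _ M (hs i j k)).tsum_sub hψ2]
    refine tsum_congr fun l => ?_
    split_ifs
    · rw [h1]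
    · simp
  rw [e3, e4, ← e1, e2]
  ring

theorem tsum_abel_cut (h1 : ∀ i j l k, X (i + 1) j l k = X i j l k - X i j (l - 1) k)
    (h2 : ∀ i j l k, X i (j + 1) l k = X i j l k - X i j l (k - 1))
    (hs : ∀ i j k, Summable fun l => X i j l (k - l)) (m i : ℕ) (k M : ℤ) :
    ∑' l, (if M < l then X i m l (k - l) else 0) =
      (∑' l, if M < l then X (i + m) 0 l (k - l) else 0) +
        ∑ a ∈ Finset.range m, X (i + a) (m - 1 - a) M (k - M - 1) := by
  induction m generalizing i with
  | zero => simp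
  | succ m ih =>
    rw [tsum_abel_cut_step h1 h2 hs, ih, Finset.sum_range_succ', show i + 1 + m = i + (m + 1) by ring,
      add_assoc]
    congr 2
    refine Finset.sum_congr rfl fun a _ => ?_
    rw [show i + 1 + a = i + (a + 1) by ring, show m + 1 - 1 - (a + 1) = m - 1 - a by omega]

end Abel

theorem summable_integral {f : ℝ → ℤ → ℝ} (hf : SumBd f) {u : ℝ → ℤ → ℝ} (hu : SupBd u)
    {x y t : ℝ} (hx : 0 ≤ x) (hxy : x ≤ y) (hy : y ≤ t) (k : ℤ) :
    Summable fun l => ∫ r in x..y, f r l * u (t - r) (k - l) := by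
  obtain ⟨B, hB, hfB⟩ := hf
  obtain ⟨M, hM⟩ := hu
  refine Summable.of_norm_bounded ((hB.mul_right M).mul_right (y - x)) fun l => ?_
  exact abs_integral_mul_le (b := fun r => u r (k - l)) ((abs_nonneg _).trans (hfB 0 le_rfl l))
    (fun r hr _ => hfB r (hx.trans hr) l) (fun r _ hr => hM _ (by linarith) _) hxy

/-! ### Uniformly regular families -/

/-- A family of towers that are bounded, of bounded mass in space and with finitely supported
initial jets, all uniformly over the family. -/
structure Reg {ι : Type*} (U : ι → ℕ → ℝ → ℤ → ℝ) : Prop where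
  tower : ∀ i, Tower (U i)
  bdd : ∀ n, ∃ M : ℝ, ∀ i t, 0 ≤ t → ∀ k, |U i n t k| ≤ M
  mass : ∃ H : ℝ, ∀ i t, 0 ≤ t → ∀ s : Finset ℤ, ∑ k ∈ s, |U i 0 t k| ≤ H
  jet : ∀ n, ∃ K : ℕ, ∀ i, ∀ k : ℤ, (K : ℤ) < |k| → U i n 0 k = 0

theorem Reg.supBd {ι : Type*} {U : ι → ℕ → ℝ → ℤ → ℝ} (h : Reg U) (i : ι) (n : ℕ) :
    SupBd (U i n) := by
  obtain ⟨M, hM⟩ := h.bdd n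
  exact ⟨M, hM i⟩

/-- The properties of the kernel that enter the estimates. -/
structure Ker (q : ℕ → ℝ → ℤ → ℝ) (Θ : ℝ) : Prop where
  tower : Tower q
  dec : Dec 4 q
  jet : FinJet q
  l1 : L1Bd (q 0) Θ

theorem Ker.sumBd_BD {q : ℕ → ℝ → ℤ → ℝ} {Θ : ℝ} (h : Ker q Θ) (m n : ℕ) : SumBd (BD m q n) :=
  (h.dec.BD m).sumBd (by omega) n

theorem Ker.sumBd {q : ℕ → ℝ → ℤ → ℝ} {Θ : ℝ} (h : Ker q Θ) (n : ℕ) : SumBd (q n) :=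
  h.dec.sumBd (by omega) n

theorem Ker.l1Bd {q : ℕ → ℝ → ℤ → ℝ} {Θ : ℝ} (h : Ker q Θ) (n : ℕ) : ∃ C, L1Bd (q n) C :=
  h.dec.l1Bd h.tower n

variable {ι : Type*} {U : ι → ℕ → ℝ → ℤ → ℝ} {q : ℕ → ℝ → ℤ → ℝ} {Θ : ℝ}

/-- Only derivatives of the second factor of order at most n - 1 enter. For n = 0 the truncated
subtraction keeps order 0, which the integral needs. -/
theorem convT_bdd (hq : Ker q Θ) (n : ℕ)
    (hU : ∀ j ≤ n - 1, ∃ M : ℝ, ∀ i t, 0 ≤ t → ∀ k, |U i j t k| ≤ M) :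
    ∃ C : ℝ, ∀ i t, 0 ≤ t → ∀ k, |convT q (U i) n t k| ≤ C := by
  choose! M hM using hU
  choose B hB hqB using fun n => hq.sumBd n
  obtain ⟨C, hC⟩ := hq.l1Bd n
  refine ⟨C * M 0 + ∑ j ∈ Finset.range n, ∑' l, B j l * M (n - 1 - j), fun i t ht k => ?_⟩
  refine (abs_add_le _ _).trans (add_le_add ?_ ?_)
  · exact abs_cv_le (hq.tower.sCont n) hC (hM 0 (Nat.zero_le _) i) ht k
  · refine (Finset.abs_sum_le_sum_abs _ _).trans (Finset.sum_le_sum fun j _ => ?_)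
    refine tsum_of_norm_bounded (f := fun l => q j 0 l * U i (n - 1 - j) t (k - l))
      ((hB j).mul_right _).hasSum fun l => ?_
    rw [norm_mul]
    exact mul_le_mul (hqB j 0 le_rfl l) (hM _ (Nat.sub_le _ _) i t ht _) (abs_nonneg _)
      ((abs_nonneg _).trans (hqB j 0 le_rfl l))

/-! ### The cut estimate in space. -/

/-- Decay in space, at nonnegative lattice points. -/
def SpaceDec (U : ι → ℕ → ℝ → ℤ → ℝ) (n m : ℕ) : Prop :=
  ∃ C : ℝ, 0 ≤ C ∧ ∀ i t, 0 ≤ t → ∀ k : ℤ, 0 ≤ k →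
    |(bd ^ m) (U i n t) k| ≤ C / (1 + (k : ℝ)) ^ (2 + 2 * n + m)

/-- Decay in time. -/
def TimeDec (U : ι → ℕ → ℝ → ℤ → ℝ) (n m : ℕ) : Prop :=
  ∃ C : ℝ, 0 ≤ C ∧ ∀ i t, 0 ≤ t → ∀ k : ℤ,
    |(bd ^ m) (U i n t) k| ≤ C / (1 + √t) ^ (2 + 2 * n + m)

/-- The kernel and its derivatives away from the spatial origin. -/
theorem Ker.space_bound (hq : Ker q Θ) (n m : ℕ) : ∃ C : ℝ, 0 ≤ C ∧ ∀ (M : ℕ) (r : ℝ), 0 ≤ r →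
    ∀ l : ℤ, (M : ℤ) ≤ l → |(bd ^ m) (q n r) l| ≤
      C / (1 + (M : ℝ)) ^ (2 * n + m) * (((1 + (M : ℝ)) ^ 2 + r) ^ 2)⁻¹ := by
  obtain ⟨C, h0, hC⟩ := hq.dec.nonneg_bound n m
  refine ⟨C, h0, fun M r hr l hl => ?_⟩
  rw [← div_eq_mul_inv, div_div, le_div_iff₀ (by positivity)]
  refine le_trans (mul_le_mul_of_nonneg_left ?_ (abs_nonneg _)) (hC r hr l)
  have hM : (1 + (M : ℝ)) ≤ 1 + |(l : ℝ)| := by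
    have h1 : (M : ℝ) ≤ (l : ℝ) := by exact_mod_cast hl
    have := le_abs_self (l : ℝ)
    linarith
  have hw := wt_pos r l
  calc _ ≤ wt r l ^ (2 * n + m) * wt r l ^ 4 := by
        gcongr
        · exact hM.trans one_add_abs_le_wt
        · exact sq_add_sq_le_wt_pow hr (by positivity) hM
    _ = _ := by rw [← pow_add]; congr 1; ring

theorem integral_space_bound_le {C : ℝ} (hC : 0 ≤ C) (M j : ℕ) {t : ℝ} (ht : 0 ≤ t) :
    ∫ r in (0 : ℝ)..t, C / (1 + (M : ℝ)) ^ j * (((1 + (M : ℝ)) ^ 2 + r) ^ 2)⁻¹ ≤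
      C / (1 + (M : ℝ)) ^ (2 + j) := by
  rw [intervalIntegral.integral_const_mul]
  calc _ ≤ C / (1 + (M : ℝ)) ^ j * ((1 + (M : ℝ)) ^ 2)⁻¹ := by
        gcongr
        exact integral_inv_sq_le (by positivity) ht
    _ = _ := by rw [pow_add]; field_simp

theorem continuousOn_space_bound (C : ℝ) (M j : ℕ) (t : ℝ) :
    ContinuousOn (fun r => C / (1 + (M : ℝ)) ^ j * (((1 + (M : ℝ)) ^ 2 + r) ^ 2)⁻¹) (Icc 0 t) := by
  have : ∀ x ∈ Icc 0 t, ((1 + (M : ℝ)) ^ 2 + x) ^ 2 ≠ 0 := fun x hx => by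
    have := hx.1; positivity
  fun_prop (disch := assumption)

/-- The basic estimate in space: up to a remainder of the right order, the convolution with `q` at
`k` is controlled by the values of the second factor at the points `k' ≥ (1 - 1 / N) k`. -/
theorem space_estimate (hq : Ker q Θ) (hU : Reg U) (n m : ℕ) (hlow : ∀ i < m, SpaceDec U n i)
    {N : ℕ} (hN : 2 ≤ N) : ∃ C : ℝ, 0 ≤ C ∧ ∀ i t, 0 ≤ t → ∀ (k : ℕ) (X : ℝ),
      (∀ t', 0 ≤ t' → ∀ k' : ℤ, (k : ℤ) - (k / N : ℕ) ≤ k' → |(bd ^ m) (U i n t') k'| ≤ X) →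
      |(bd ^ m) (convT q (U i) n t) k| ≤ C / (1 + (k : ℝ)) ^ (2 + 2 * n + m) + Θ * X := by
  have hN0 : 0 < N := by omega
  have hNr : (0 : ℝ) < N := by exact_mod_cast hN0
  obtain ⟨D, hD⟩ := convT_bdd hq n fun j _ => hU.bdd j
  obtain ⟨H, hH⟩ := hU.mass
  choose KU hKU using hU.jet
  choose Kq hKq using hq.jet
  -- At distance more than K from the origin the initial jets of order below n of both factors
  -- vanish. For k ≥ k₀ this removes every boundary term at time zero.
  set K : ℕ := ∑ j ∈ Finset.range n, (KU j + Kq j) with hK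
  have hKle : ∀ j < n, KU j ≤ K ∧ Kq j ≤ K := by
    intro j hj
    have : KU j + Kq j ≤ K :=
      Finset.single_le_sum (f := fun j => KU j + Kq j) (fun _ _ => Nat.zero_le _)
        (Finset.mem_range.2 hj)
    omega
  -- for small `k` the crude bound is enough
  set k₀ : ℕ := 2 * N * (K + m + 2) with hk₀
  obtain ⟨Cf, hCf0, hCf⟩ := hq.space_bound n m
  -- These are the boundary terms of the summation by parts at the site M = k / N. Both factors are
  -- evaluated at distance comparable to k, and the second one carries fewer than m differences, so
  -- its decay is known from `hlow`.
  have hbdry : ∀ a, ∃ C : ℝ, 0 ≤ C ∧ (a < m → ∀ i t, 0 ≤ t → ∀ k : ℕ, k₀ ≤ k →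
      |jt (BD a q) (BD (m - 1 - a) (U i)) n t ((k / N : ℕ) : ℤ) (k - (k / N : ℕ) - 1)| ≤
        C / (1 + (k : ℝ)) ^ (2 + 2 * n + m)) := by
    intro a
    by_cases ha : a < m
    swap
    · exact ⟨0, le_rfl, fun h => absurd h ha⟩
    obtain ⟨Ca, hCa0, hCa⟩ := hq.space_bound 0 a
    obtain ⟨S, hS0, hS⟩ := hlow (m - 1 - a) (by omega)
    refine ⟨Ca * S * (4 * N) ^ (3 + 2 * n + m), by positivity, fun _ i t ht k hk => ?_⟩
    set M : ℕ := k / N with hM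
    have hMk : 2 * M ≤ k := by
      have : M * N ≤ k := Nat.div_mul_le_self k N
      nlinarith
    have hkN : k + 1 ≤ N * (M + 1) := Nat.lt_mul_div_succ k hN0
    have hk2 : 2 * (K + m + 2) ≤ k := by
      refine le_trans ?_ hk
      rw [hk₀]
      nlinarith
    -- Cutting at τ = t leaves all time derivatives on U. The boundary terms then contain jets of U
    -- at time zero near k - M - 1, where they vanish.
    rw [jt_eq_of_cut (hq.tower.BD a) ((hU.tower i).BD _) n ht le_rfl, intervalIntegral.integral_same,
      Finset.sum_eq_zero, add_zero, add_zero]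
    swap
    · intro j hj
      have hjn := Finset.mem_range.1 hj
      have h0 : BD (m - 1 - a) (U i) (n - 1 - j) (t - t) ((k : ℤ) - M - 1) = 0 := by
        rw [sub_self]
        refine bd_pow_eq_zero fun l h1 _ => hKU _ i l ?_
        have h2 := (hKle (n - 1 - j) (by omega)).1
        have h3 : (KU (n - 1 - j) : ℤ) < l := by
          have : ((m - 1 - a : ℕ) : ℤ) ≤ m := by omega
          omega
        exact h3.trans_le (le_abs_self l)
      rw [h0, mul_zero]
    set Y : ℝ := S / (1 + (((k : ℤ) - M - 1 : ℤ) : ℝ)) ^ (2 + 2 * n + (m - 1 - a)) with hY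
    have hkM : (1 + (((k : ℤ) - M - 1 : ℤ) : ℝ)) = (k : ℝ) - M := by push_cast; ring
    have hkM' : (1 + (k : ℝ)) / (4 * N) ≤ (k : ℝ) - M := by
      have h1 : (2 * M : ℝ) ≤ k := by exact_mod_cast hMk
      have h2 : (1 : ℝ) ≤ k := by
        have : 1 ≤ k := by omega
        exact_mod_cast this
      have h3 : (2 : ℝ) ≤ N := by exact_mod_cast hN
      rw [div_le_iff₀ (by positivity)]
      nlinarith
    have hM' : (1 + (k : ℝ)) / (4 * N) ≤ 1 + M := by
      have h1 : (k : ℝ) + 1 ≤ N * (M + 1) := by exact_mod_cast hkN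
      rw [div_le_iff₀ (by positivity)]
      have : (0 : ℝ) ≤ M := Nat.cast_nonneg M
      nlinarith
    have hkpos : 0 < (1 + (k : ℝ)) / (4 * N) := by positivity
    have hY0 : 0 ≤ Y := by
      rw [hY, hkM]
      have := hkpos.trans_le hkM'
      positivity
    have h1 : |∫ r in (0 : ℝ)..t, BD a q 0 r M * BD (m - 1 - a) (U i) n (t - r) ((k : ℤ) - M - 1)| ≤
        ∫ r in (0 : ℝ)..t, (Ca / (1 + (M : ℝ)) ^ a * (((1 + (M : ℝ)) ^ 2 + r) ^ 2)⁻¹) * Y := by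
      rw [← Real.norm_eq_abs]
      apply intervalIntegral.norm_integral_le_of_norm_le ht
      · refine Filter.Eventually.of_forall fun r hr => ?_
        rw [norm_mul]
        have e1 := hCa M r hr.1.le M le_rfl
        rw [mul_zero, zero_add] at e1
        have e2 := hS i (t - r) (by linarith [hr.2]) ((k : ℤ) - M - 1) (by omega)
        exact mul_le_mul e1 e2 (abs_nonneg _) (by have := hr.1.le; positivity)
      · apply ContinuousOn.intervalIntegrable
        rw [uIcc_of_le ht]
        exact (continuousOn_space_bound Ca M a t).mul continuousOn_const
    refine h1.trans ?_
    have hkM0 : 0 < (k : ℝ) - M := hkpos.trans_le hkM'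
    rw [intervalIntegral.integral_mul_const]
    calc _ ≤ Ca / (1 + (M : ℝ)) ^ (2 + a) * Y := by
          gcongr
          exact integral_space_bound_le hCa0 M a ht
      _ ≤ Ca / ((1 + (k : ℝ)) / (4 * N)) ^ (2 + a) *
          (S / ((1 + (k : ℝ)) / (4 * N)) ^ (2 + 2 * n + (m - 1 - a))) := by
          rw [hY, hkM]
          have : 0 ≤ S / ((k : ℝ) - M) ^ (2 + 2 * n + (m - 1 - a)) := by positivity
          gcongr
      _ = Ca * S * (4 * N) ^ (3 + 2 * n + m) / (1 + (k : ℝ)) ^ (3 + 2 * n + m) := by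
          rw [div_mul_div_comm, ← pow_add, show 2 + a + (2 + 2 * n + (m - 1 - a)) =
            3 + 2 * n + m by omega, div_pow]
          field_simp
      -- The boundary terms decay with one power more than required.
      _ ≤ _ := by
          gcongr
          · have : (0 : ℝ) ≤ k := Nat.cast_nonneg k
            linarith
          · omega
  choose Cb hCb0 hCb using hbdry
  refine ⟨2 ^ m * |D| * (1 + k₀) ^ (2 + 2 * n + m) + (|H| * (Cf * N ^ (2 + 2 * n + m)) +
    ∑ a ∈ Finset.range m, Cb a), by
      have := Finset.sum_nonneg (s := Finset.range m) fun a _ => hCb0 a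
      positivity, fun i t ht k X hX => ?_⟩
  have hΘ := hq.l1.nonneg
  have hX0 : 0 ≤ X := (abs_nonneg _).trans (hX 0 le_rfl k (sub_le_self _ (Int.natCast_nonneg _)))
  have hpk : (0 : ℝ) < (1 + (k : ℝ)) ^ (2 + 2 * n + m) := by positivity
  rcases lt_or_ge k k₀ with hk | hk
  · have h1 : |(bd ^ m) (convT q (U i) n t) k| ≤ 2 ^ m * |D| :=
      abs_bd_pow_le fun l _ _ => (hD i t ht l).trans (le_abs_self D)
    have h2 : 2 ^ m * |D| ≤ 2 ^ m * |D| * (1 + k₀) ^ (2 + 2 * n + m) /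
        (1 + (k : ℝ)) ^ (2 + 2 * n + m) := by
      rw [le_div_iff₀ hpk]
      have : (k : ℝ) ≤ k₀ := by exact_mod_cast hk.le
      gcongr
    refine h1.trans (h2.trans ?_)
    have h3 : 0 ≤ Θ * X := mul_nonneg hΘ hX0
    have h4 : 2 ^ m * |D| * (1 + k₀) ^ (2 + 2 * n + m) / (1 + (k : ℝ)) ^ (2 + 2 * n + m) ≤
        (2 ^ m * |D| * (1 + k₀) ^ (2 + 2 * n + m) + (|H| * (Cf * N ^ (2 + 2 * n + m)) +
          ∑ a ∈ Finset.range m, Cb a)) / (1 + (k : ℝ)) ^ (2 + 2 * n + m) := by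
      gcongr
      have : 0 ≤ ∑ a ∈ Finset.range m, Cb a := Finset.sum_nonneg fun a _ => hCb0 a
      have : 0 ≤ |H| * (Cf * N ^ (2 + 2 * n + m)) := by positivity
      linarith
    linarith
  set M : ℕ := k / N with hM
  have hMk : 2 * M ≤ k := by
    have : M * N ≤ k := Nat.div_mul_le_self k N
    nlinarith
  have hkN : k + 1 ≤ N * (M + 1) := Nat.lt_mul_div_succ k hN0
  have hk2 : 2 * (K + m + 2) ≤ k := by
    refine le_trans ?_ hk
    rw [hk₀]
    nlinarith
  have hMK : K + m < M := by
    rw [hM, Nat.lt_iff_add_one_le, Nat.le_div_iff_mul_le hN0]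
    refine le_trans ?_ hk
    rw [hk₀]
    nlinarith
  have hUt := hU.tower i
  have hUb := fun n => hU.supBd i n
  rw [bd_pow_convT hq.tower hq.sumBd hUt hUb m n ht,
    convT_eq_tsum_jt hq.sumBd (SupBd.BD hUb m) n ht]
  have hsum := summable_jt hq.sumBd (SupBd.BD hUb m) n ht k
  have hsplit : ∑' l, jt q (BD m (U i)) n t l (k - l) =
      (∑' l, if (M : ℤ) < l then jt q (BD m (U i)) n t l (k - l) else 0) +
      ∑' l, if (M : ℤ) < l then 0 else jt q (BD m (U i)) n t l (k - l) := by
    rw [← Summable.tsum_add]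
    · refine tsum_congr fun l => ?_
      split_ifs <;> simp
    · refine (hsum.indicator {l | (M : ℤ) < l}).congr fun l => ?_
      simp [indicator_apply]
    · refine (hsum.indicator {l | (M : ℤ) < l}ᶜ).congr fun l => ?_
      by_cases h : (M : ℤ) < l <;> simp [h]
  -- For l ≤ M all derivatives stay on U, whose argument k - l is at least k - k / N. The
  -- undifferentiated q contributes exactly its L¹ bound Θ.
  have hnear : |∑' l, if (M : ℤ) < l then 0 else jt q (BD m (U i)) n t l (k - l)| ≤ Θ * X := by
    have e : ∀ l : ℤ, (if (M : ℤ) < l then 0 else jt q (BD m (U i)) n t l (k - l)) =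
        ∫ r in (0 : ℝ)..t, q 0 r l *
          (if (M : ℤ) < l then 0 else (bd ^ m) (U i n (t - r)) (k - l)) := by
      intro l
      split_ifs with h
      · simp
      · rw [jt_eq_of_cut hq.tower (hUt.BD m) n ht le_rfl, intervalIntegral.integral_same,
          Finset.sum_eq_zero, add_zero, add_zero]
        · rfl
        · intro j hj
          have hjn := Finset.mem_range.1 hj
          have h0 : BD m (U i) (n - 1 - j) (t - t) ((k : ℤ) - l) = 0 := by
            rw [sub_self]
            refine bd_pow_eq_zero fun l' h1 _ => hKU _ i l' ?_
            have h2 := (hKle (n - 1 - j) (by omega)).1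
            have h3 : (KU (n - 1 - j) : ℤ) < l' := by omega
            exact h3.trans_le (le_abs_self l')
          rw [h0, mul_zero]
    simp only [e]
    refine abs_tsum_integral_le (hq.tower.sCont 0) hq.l1 ht fun l r hr hrt => ?_
    split_ifs with h
    · simpa using hX0
    · exact hX (t - r) (by linarith) _ (by omega)
  -- For l > M all differences and, by the cut τ = 0, all time derivatives are moved to q, which is
  -- small there. Only the spatial mass of U enters, and no decay of U.
  have hfar : |∑' l, if (M : ℤ) < l then jt q (BD m (U i)) n t l (k - l) else 0| ≤
      (|H| * (Cf * N ^ (2 + 2 * n + m)) + ∑ a ∈ Finset.range m, Cb a) /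
        (1 + (k : ℝ)) ^ (2 + 2 * n + m) := by
    have habel := tsum_abel_cut (X := fun a b l k => jt (BD a q) (BD b (U i)) n t l k)
      (fun a b l k => by
        rw [← jt_BD_left (hq.tower.BD a) (hUt.BD b) n ht, BD_BD, add_comm 1 a])
      (fun a b l k => by
        rw [← jt_BD_right (hq.tower.BD a) (hUt.BD b) n ht, BD_BD, add_comm 1 b])
      (fun a b k => summable_jt (fun n => hq.sumBd_BD a n) (SupBd.BD hUb b) n ht k) m 0 k M
    have hBD0 : ∀ F : ℕ → ℝ → ℤ → ℝ, BD 0 F = F := fun F => by ext n t k; simp [BD]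
    simp only [zero_add, hBD0] at habel
    rw [habel]
    refine (abs_add_le _ _).trans ?_
    rw [add_div]
    refine add_le_add ?_ ?_
    · have e : ∀ l : ℤ, (if (M : ℤ) < l then jt (BD m q) (U i) n t l (k - l) else 0) =
          ∫ r in (0 : ℝ)..t, (if (M : ℤ) < l then (bd ^ m) (q n r) l else 0) *
            U i 0 (t - r) (k - l) := by
        intro l
        split_ifs with h
        · rw [jt_eq_cI, Finset.sum_eq_zero, add_zero]
          · rfl
          · intro j hj
            have hjn := Finset.mem_range.1 hj
            have h0 : BD m q j 0 l = 0 := by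
              refine bd_pow_eq_zero fun l' h1 _ => hKq _ l' ?_
              have h2 := (hKle j hjn).2
              have h3 : (Kq j : ℤ) < l' := by omega
              exact h3.trans_le (le_abs_self l')
            rw [h0, zero_mul]
        · simp
      simp only [e]
      have h1 := abs_tsum_integral_le' (hUt.sCont 0) (H := |H|) (fun t ht s =>
          (hH i t ht s).trans (le_abs_self H)) (x := 0) (y := t) (t := t)
          (w := fun l r => if (M : ℤ) < l then (bd ^ m) (q n r) l else 0) k ht le_rfl
          (continuousOn_space_bound Cf M (2 * n + m) t) (fun l r hr hrt => by
            split_ifs with h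
            · exact hCf M r hr l h.le
            · rw [abs_zero]; positivity)
      refine h1.trans ?_
      rw [mul_div_assoc]
      gcongr
      refine (integral_space_bound_le hCf0 M (2 * n + m) ht).trans ?_
      rw [show 2 + (2 * n + m) = 2 + 2 * n + m by ring,
        div_le_div_iff₀ (by positivity) hpk, mul_assoc, ← mul_pow]
      gcongr
      have : (k : ℝ) + 1 ≤ N * (M + 1) := by exact_mod_cast hkN
      linarith
    · rw [Finset.sum_div]
      refine (Finset.abs_sum_le_sum_abs _ _).trans (Finset.sum_le_sum fun a ha => ?_)
      exact hCb a (Finset.mem_range.1 ha) i t ht k hk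
  rw [hsplit]
  refine (abs_add_le _ _).trans (add_le_add (hfar.trans ?_) hnear)
  refine div_le_div_of_nonneg_right ?_ hpk.le
  have : 0 ≤ 2 ^ m * |D| * (1 + (k₀ : ℝ)) ^ (2 + 2 * n + m) := by positivity
  linarith

end SemiDiscrete

end

/-! ### The cut estimate in time, and decay from contraction. -/

noncomputable section

namespace SemiDiscrete

variable {ι : Type*} {U : ι → ℕ → ℝ → ℤ → ℝ} {q : ℕ → ℝ → ℤ → ℝ} {Θ : ℝ}

theorem one_add_sqrt_le_mul {N : ℕ} (hN : 1 ≤ N) (t : ℝ) :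
    1 + √t ≤ N * (1 + √(t / N)) := by
  have hNr : (1 : ℝ) ≤ N := by exact_mod_cast hN
  have h1 : √t = √N * √(t / N) := by
    rw [← Real.sqrt_mul (by positivity)]
    congr 1
    field_simp
  have h2 : √(N : ℝ) ≤ N := by
    rw [Real.sqrt_le_left (by positivity)]
    nlinarith
  rw [h1, mul_add, mul_one]
  gcongr

/-- The basic estimate in time: up to a remainder of the right order, the convolution with `q` at
the time `t` is controlled by the values of the second factor at the times `t' ≥ (1 - 1 / N) t`. -/
theorem time_estimate (hq : Ker q Θ) (hU : Reg U) (n m : ℕ) (hlow : ∀ i < n, TimeDec U i 0)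
    {N : ℕ} (hN : 2 ≤ N) : ∃ C : ℝ, 0 ≤ C ∧ ∀ i (t : ℝ), 0 ≤ t → ∀ X : ℝ,
      (∀ t', t - t / N ≤ t' → ∀ k' : ℤ, |(bd ^ m) (U i n t') k'| ≤ X) → ∀ k : ℤ,
      |(bd ^ m) (convT q (U i) n t) k| ≤ C / (1 + √t) ^ (2 + 2 * n + m) + Θ * X := by
  have hNr : (2 : ℝ) ≤ N := by exact_mod_cast hN
  obtain ⟨H, hH⟩ := hU.mass
  have hBD0 : ∀ F : ℕ → ℝ → ℤ → ℝ, BD 0 F = F := fun F => by ext n t k; simp [BD]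
  have hτ : ∀ t : ℝ, 0 ≤ t → 0 ≤ t / N ∧ t / N ≤ t - t / N := by
    intro t ht
    refine ⟨by positivity, ?_⟩
    have : t / N ≤ t / 2 := by gcongr
    linarith
  -- These are the boundary terms at the cutting time t / N, at which both time arguments are
  -- comparable to t. All spatial differences are moved to q, so that `hlow` is needed without
  -- spatial differences.
  have hjump : ∀ j, ∃ C : ℝ, 0 ≤ C ∧ (j < n → ∀ i (t : ℝ), 0 ≤ t → ∀ k : ℤ,
      |∑' l, q j (t / N) l * BD m (U i) (n - 1 - j) (t - t / N) (k - l)| ≤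
        C / (1 + √t) ^ (2 + 2 * n + m)) := by
    intro j
    by_cases hj : j < n
    swap
    · exact ⟨0, le_rfl, fun h => absurd h hj⟩
    obtain ⟨A, hA0, hA⟩ := hq.dec.nonneg_bound j m
    obtain ⟨D, hD0, hD⟩ := hlow (n - 1 - j) (by omega)
    set σ : ℝ := ∑' l : ℤ, ((1 + |(l : ℝ)|) ^ 2)⁻¹ with hσ
    have hσ0 : 0 ≤ σ := tsum_nonneg fun l => by positivity
    refine ⟨A * D * N ^ (2 + 2 * n + m) * σ, by positivity, fun _ i t ht k => ?_⟩
    obtain ⟨hτ0, hτ1⟩ := hτ t ht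
    have habel := tsum_abel (X := fun a b l k => BD a q j (t / N) l *
        BD b (U i) (n - 1 - j) (t - t / N) k)
      (fun a b l k => by simp only [BD, bd_pow_succ', bd_apply]; ring)
      (fun a b l k => by simp only [BD, bd_pow_succ', bd_apply]; ring)
      (fun a b k => summable_mul_of_sumBd (hq.sumBd_BD a j)
        (SupBd.BD (fun n => hU.supBd i n) b _) hτ0 (hτ0.trans hτ1) k) m 0 k
    simp only [zero_add, hBD0] at habel
    rw [habel]
    have hS := (summable_inv_sq.mul_left (A * D * N ^ (2 + 2 * n + m) / (1 + √t) ^ (2 + 2 * n + m)))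
    refine (tsum_of_norm_bounded (f := fun l => BD m q j (t / N) l *
      U i (n - 1 - j) (t - t / N) (k - l)) hS.hasSum fun l => ?_).trans (le_of_eq ?_)
    · rw [norm_mul]
      set y := 1 + √(t / N) with hy
      have hy0 : 0 < y := by positivity
      have h1 : |BD m q j (t / N) l| ≤ A / (y ^ (2 + 2 * j + m) * (1 + |(l : ℝ)|) ^ 2) := by
        rw [le_div_iff₀ (by positivity)]
        refine le_trans (mul_le_mul_of_nonneg_left ?_ (abs_nonneg _)) (hA _ hτ0 l)
        have hw := wt_pos (t / N) l
        calc _ ≤ wt (t / N) l ^ (2 + 2 * j + m) * wt (t / N) l ^ 2 := by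
              gcongr
              · exact one_add_sqrt_le_wt
              · exact one_add_abs_le_wt
          _ = _ := by rw [← pow_add]; congr 1; ring
      have h2 : |U i (n - 1 - j) (t - t / N) (k - l)| ≤ D / y ^ (2 + 2 * (n - 1 - j)) := by
        have := hD i (t - t / N) (hτ0.trans hτ1) (k - l)
        simp only [pow_zero, Module.End.one_apply, add_zero] at this
        refine this.trans ?_
        gcongr
        rw [hy]
        gcongr
      refine (mul_le_mul h1 h2 (abs_nonneg _) (by positivity)).trans ?_
      have h3 : (1 + √t) ^ (2 + 2 * n + m) ≤ (N * y) ^ (2 + 2 * n + m) := by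
        gcongr
        exact one_add_sqrt_le_mul (by omega) t
      calc _ = A * D / (y ^ (2 + 2 * n + m)) * ((1 + |(l : ℝ)|) ^ 2)⁻¹ := by
            rw [div_mul_div_comm, mul_right_comm, ← pow_add,
              show 2 + 2 * j + m + (2 + 2 * (n - 1 - j)) = 2 + 2 * n + m by omega]
            field_simp
        _ ≤ _ := by
            refine mul_le_mul_of_nonneg_right ?_ (by positivity)
            rw [div_le_div_iff₀ (by positivity) (by positivity), mul_assoc (A * D), ← mul_pow]
            gcongr
    · rw [tsum_mul_left]
      ring
  choose Cj hCj0 hCj using hjump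
  obtain ⟨A, hA0, hA⟩ := hq.dec.nonneg_bound n m
  have hsum0 := Finset.sum_nonneg (s := Finset.range n) fun j _ => hCj0 j
  refine ⟨|H| * (A * N ^ (4 + 2 * n + m)) + ∑ j ∈ Finset.range n, Cj j, by positivity,
    fun i t ht X hX k => ?_⟩
  obtain ⟨hτ0, hτ1⟩ := hτ t ht
  have hτt : t / N ≤ t := by linarith
  have hUt := hU.tower i
  have hUb := fun n => hU.supBd i n
  have hUbm : ∀ n, SupBd (BD m (U i) n) := SupBd.BD hUb m
  rw [bd_pow_convT hq.tower hq.sumBd hUt hUb m n ht, convT_eq_tsum_jt hq.sumBd hUbm n ht]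
  simp only [jt_eq_of_cut hq.tower (hUt.BD m) n hτ0 hτt]
  have s1 := summable_integral (hq.sumBd 0) (hUbm n) le_rfl hτ0 hτt k
  have s2 := summable_integral (hq.sumBd n) (hUbm 0) hτ0 hτt le_rfl k
  have s3 : ∀ j ∈ Finset.range n, Summable fun l =>
      q j (t / N) l * BD m (U i) (n - 1 - j) (t - t / N) (k - l) := fun j _ =>
    summable_mul_of_sumBd (hq.sumBd j) (hUbm _) hτ0 (hτ0.trans hτ1) k
  rw [(s1.add s2).tsum_add (summable_sum s3), s1.tsum_add s2, Summable.tsum_finsetSum s3]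
  have e1 : |∑' l, ∫ r in (0 : ℝ)..t / N, q 0 r l * BD m (U i) n (t - r) (k - l)| ≤ Θ * X :=
    abs_tsum_integral_le (hq.tower.sCont 0) hq.l1 hτ0
      (w := fun l r => BD m (U i) n (t - r) (k - l)) fun l r _ hr => hX (t - r) (by linarith) _
  -- After the spatial differences are moved to q, the supremum of q over times at least t / N is
  -- multiplied by the mass of U. Integration over an interval of length at most (1 + √t)² uses up
  -- two of the four powers in the decay of q.
  have e2 : |∑' l, ∫ r in t / N..t, q n r l * BD m (U i) 0 (t - r) (k - l)| ≤
      |H| * (A * N ^ (4 + 2 * n + m)) / (1 + √t) ^ (2 + 2 * n + m) := by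
    have habel := tsum_abel (X := fun a b l k => ∫ r in t / N..t, BD a q n r l *
        BD b (U i) 0 (t - r) k)
      (fun a b l k => by
        simp only [BD, bd_pow_succ', bd_apply, sub_mul]
        rw [intervalIntegral.integral_sub] <;>
        exact cI_integrand_intervalIntegrable ((hq.tower.BD a).continuousOn n _)
          ((hUt.BD b).continuousOn 0 _) hτ0 hτt le_rfl)
      (fun a b l k => by
        simp only [BD, bd_pow_succ', bd_apply, mul_sub]
        rw [intervalIntegral.integral_sub] <;>
        exact cI_integrand_intervalIntegrable ((hq.tower.BD a).continuousOn n _)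
          ((hUt.BD b).continuousOn 0 _) hτ0 hτt le_rfl)
      (fun a b k => summable_integral (hq.sumBd_BD a n) (SupBd.BD hUb b 0) hτ0 hτt le_rfl k) m 0 k
    simp only [zero_add, hBD0] at habel
    rw [habel]
    have h1 := abs_tsum_integral_le' (hUt.sCont 0) (H := |H|) (fun t ht s =>
      (hH i t ht s).trans (le_abs_self H)) (x := t / N) (y := t) (t := t)
      (w := fun l r => BD m q n r l)
      (φ := fun _ => A * N ^ (4 + 2 * n + m) / (1 + √t) ^ (4 + 2 * n + m)) k hτt le_rfl
      continuousOn_const (fun l r hr _ => by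
        have h := hA r (hτ0.trans hr) l
        rw [le_div_iff₀ (by positivity)]
        have hw := wt_pos r l
        calc _ ≤ |(bd ^ m) (q n r) l| * (N * wt r l) ^ (4 + 2 * n + m) := by
              refine mul_le_mul_of_nonneg_left ?_ (abs_nonneg _)
              gcongr
              refine (one_add_sqrt_le_mul (N := N) (by omega) t).trans ?_
              gcongr
              refine le_trans ?_ (one_add_sqrt_le_wt (k := l))
              gcongr
          _ = |(bd ^ m) (q n r) l| * wt r l ^ (4 + 2 * n + m) * N ^ (4 + 2 * n + m) := by
              rw [mul_pow]; ring
          _ ≤ _ := by gcongr)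
    refine h1.trans ?_
    rw [intervalIntegral.integral_const, smul_eq_mul]
    have h2 : t - t / N ≤ (1 + √t) ^ 2 := by
      nlinarith [Real.sq_sqrt ht, Real.sqrt_nonneg t]
    calc _ ≤ |H| * ((1 + √t) ^ 2 * (A * N ^ (4 + 2 * n + m) / (1 + √t) ^ (4 + 2 * n + m))) := by gcongr
      _ = _ := by
        rw [show 4 + 2 * n + m = 2 + (2 + 2 * n + m) by ring, pow_add (1 + √t)]
        field_simp
  have e3 : |∑ j ∈ Finset.range n,
      ∑' l, q j (t / N) l * BD m (U i) (n - 1 - j) (t - t / N) (k - l)| ≤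
      (∑ j ∈ Finset.range n, Cj j) / (1 + √t) ^ (2 + 2 * n + m) := by
    rw [Finset.sum_div]
    exact (Finset.abs_sum_le_sum_abs _ _).trans (Finset.sum_le_sum fun j hj =>
      hCj j (Finset.mem_range.1 hj) i t ht k)
  refine (abs_add_le _ _).trans ((add_le_add ((abs_add_le _ _).trans (add_le_add e1 e2)) e3).trans ?_)
  rw [add_div]
  linarith

/-- A bounded function that is controlled by a decaying term and by a small multiple of its values
at points of comparable size decays. -/
theorem decay_of_contraction {α : Type*} {ψ x : α → ℝ} (hx : ∀ a, 1 ≤ x a) (hψ0 : ∀ a, 0 ≤ ψ a)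
    {B : ℝ} (hB : ∀ a, ψ a ≤ B) {ρ : ℝ} (hρ0 : 0 < ρ) (hρ1 : ρ ≤ 1) (p : ℕ) {θ C : ℝ}
    (hC : 0 ≤ C) (hθ : θ < ρ ^ p)
    (h : ∀ a X, (∀ b, ρ * x a ≤ x b → ψ b ≤ X) → ψ a ≤ C / x a ^ p + θ * X) (a : α) :
    ψ a ≤ C / (1 - θ / ρ ^ p) / x a ^ p := by
  have hρp : 0 < ρ ^ p := by positivity
  have hθ' : 0 < 1 - θ / ρ ^ p := by rw [sub_pos, div_lt_one hρp]; exact hθ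
  set L := x a with hL
  have hL1 : 1 ≤ L := hx a
  -- Truncating the weight at L = x a makes the weighted supremum S finite a priori, as ψ is
  -- bounded. The inequality for S then gives a bound that does not depend on L.
  set w : α → ℝ := fun b => min (x b) L ^ p with hw
  have hm : ∀ b, 1 ≤ min (x b) L := fun b => le_min (hx b) hL1
  have hw0 : ∀ b, 0 < w b := fun b => pow_pos (zero_lt_one.trans_le (hm b)) p
  have hB0 : 0 ≤ B := (hψ0 a).trans (hB a)
  have hbdd : BddAbove (range fun b => ψ b * w b) := by
    refine ⟨B * L ^ p, ?_⟩
    rintro _ ⟨b, rfl⟩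
    have : w b ≤ L ^ p := pow_le_pow_left₀ (zero_le_one.trans (hm b)) (min_le_right _ _) p
    exact mul_le_mul (hB b) this (hw0 b).le hB0
  set S := ⨆ b, ψ b * w b with hS
  have hle : ∀ b, ψ b * w b ≤ S := fun b => le_ciSup hbdd b
  have hS0 : 0 ≤ S := (mul_nonneg (hψ0 a) (hw0 a).le).trans (hle a)
  have hstep : ∀ b, ψ b * w b ≤ C + θ / ρ ^ p * S := by
    intro b
    -- Points c with x c ≥ ρ x b have truncated weight at least ρ ^ p times that of b; this is the
    -- loss which the assumption θ < ρ ^ p absorbs.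
    have h1 := h b (S / (ρ ^ p * w b)) fun c hc => by
      have h2 : ρ * min (x b) L ≤ min (x c) L := by
        refine le_min ((mul_le_mul_of_nonneg_left (min_le_left _ _) hρ0.le).trans hc) ?_
        calc ρ * min (x b) L ≤ 1 * L := mul_le_mul hρ1 (min_le_right _ _)
              (zero_le_one.trans (hm b)) zero_le_one
          _ = L := one_mul L
      have h3 : ρ ^ p * w b ≤ w c := by
        rw [hw]
        beta_reduce
        rw [← mul_pow]
        exact pow_le_pow_left₀ (mul_nonneg hρ0.le (zero_le_one.trans (hm b))) h2 p
      rw [le_div_iff₀ (mul_pos hρp (hw0 b))]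
      exact (mul_le_mul_of_nonneg_left h3 (hψ0 c)).trans (hle c)
    have hxb : w b ≤ x b ^ p := pow_le_pow_left₀ (zero_le_one.trans (hm b)) (min_le_left _ _) p
    have hxb0 : 0 < x b ^ p := (hw0 b).trans_le hxb
    calc ψ b * w b ≤ (C / x b ^ p + θ * (S / (ρ ^ p * w b))) * w b :=
          mul_le_mul_of_nonneg_right h1 (hw0 b).le
      _ = C * (w b / x b ^ p) + θ / ρ ^ p * S := by
          have := (hw0 b).ne'
          field_simp
      _ ≤ C * 1 + θ / ρ ^ p * S := by
          gcongr
          exact (div_le_one hxb0).2 hxb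
      _ = _ := by rw [mul_one]
  have hfin : S ≤ C + θ / ρ ^ p * S := by
    have : Nonempty α := ⟨a⟩
    exact ciSup_le hstep
  have hwa : w a = x a ^ p := by simp [hw, hL]
  rw [le_div_iff₀ (hwa ▸ hw0 a), ← hwa, le_div_iff₀ hθ']
  have := mul_le_mul_of_nonneg_right (hle a) hθ'.le
  nlinarith

end SemiDiscrete

end

/-! ### Decay of solutions of the fixed-point equation. -/

noncomputable section

namespace SemiDiscrete

variable {ι : Type*} {U F : ι → ℕ → ℝ → ℤ → ℝ} {q : ℕ → ℝ → ℤ → ℝ} {Θ : ℝ}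

/-- Parabolic decay of order `p`, uniformly over a family. -/
def DecU (p : ℕ) (U : ι → ℕ → ℝ → ℤ → ℝ) : Prop :=
  ∀ n m, ∃ C : ℝ, 0 ≤ C ∧ ∀ i t, 0 ≤ t → ∀ k,
    |(bd ^ m) (U i n t) k| * wt t k ^ (p + 2 * n + m) ≤ C

theorem DecU.spaceDec (h : DecU 2 U) (n m : ℕ) : SpaceDec U n m := by
  obtain ⟨C, h0, hC⟩ := h n m
  refine ⟨C, h0, fun i t ht k hk => ?_⟩
  have hk' : (0 : ℝ) ≤ k := by exact_mod_cast hk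
  rw [le_div_iff₀ (by positivity)]
  refine le_trans ?_ (hC i t ht k)
  gcongr
  rw [← abs_of_nonneg hk']
  simpa using one_add_abs_le_wt (t := t) (k := k)

theorem DecU.timeDec (h : DecU 2 U) (n m : ℕ) : TimeDec U n m := by
  obtain ⟨C, h0, hC⟩ := h n m
  refine ⟨C, h0, fun i t ht k => ?_⟩
  rw [le_div_iff₀ (by positivity)]
  refine le_trans ?_ (hC i t ht k)
  gcongr
  exact one_add_sqrt_le_wt

theorem mul_wt_pow_le {a A B t : ℝ} {k : ℤ} {p : ℕ} (ha : 0 ≤ a) (hA0 : 0 ≤ A) (hB0 : 0 ≤ B)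
    (hA : a * (1 + √t) ^ p ≤ A) (hB : a * (1 + |(k : ℝ)|) ^ p ≤ B) :
    a * wt t k ^ p ≤ 2 ^ p * (A + B) := by
  have hw := (wt_pos t k).le
  have h2 : (0 : ℝ) ≤ 2 ^ p := by positivity
  rcases le_total (√t) |(k : ℝ)| with h | h
  · have h1 : wt t k ≤ 2 * (1 + |(k : ℝ)|) := by unfold wt; linarith
    calc _ ≤ a * (2 * (1 + |(k : ℝ)|)) ^ p := by gcongr
      _ = 2 ^ p * (a * (1 + |(k : ℝ)|) ^ p) := by rw [mul_pow]; ring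
      _ ≤ _ := by gcongr; linarith
  · have h1 : wt t k ≤ 2 * (1 + √t) := by unfold wt; linarith
    calc _ ≤ a * (2 * (1 + √t)) ^ p := by gcongr
      _ = 2 ^ p * (a * (1 + √t) ^ p) := by rw [mul_pow]; ring
      _ ≤ _ := by gcongr; linarith

theorem decU_of_spaceDec_of_timeDec (hs : ∀ n m, SpaceDec U n m) (ht : ∀ n m, TimeDec U n m)
    (heven : ∀ i n t, 0 ≤ t → ∀ k, U i n t (-k) = U i n t k) : DecU 2 U := by
  intro n m
  obtain ⟨A, hA0, hA⟩ := ht n m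
  obtain ⟨B, hB0, hB⟩ := hs n m
  have hpos : ∀ i t, 0 ≤ t → ∀ k : ℤ, 0 ≤ k →
      |(bd ^ m) (U i n t) k| * wt t k ^ (2 + 2 * n + m) ≤ 2 ^ (2 + 2 * n + m) * (A + B) := by
    intro i t ht k hk
    have hk' : (0 : ℝ) ≤ k := by exact_mod_cast hk
    refine mul_wt_pow_le (abs_nonneg _) hA0 hB0 ?_ ?_
    · rw [← le_div_iff₀ (by positivity)]
      exact hA i t ht k
    · rw [abs_of_nonneg hk', ← le_div_iff₀ (by positivity)]
      exact hB i t ht k hk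
  refine ⟨2 ^ (2 + 2 * n + m) * (A + B), by positivity, fun i t ht k => ?_⟩
  rcases le_total 0 k with hk | hk
  · exact hpos i t ht k hk
  -- Evenness carries k ≤ 0 to the nonnegative site -k + m, where the weight is no smaller.
  · have e : (bd ^ m) (U i n t) k = (-1) ^ m * (bd ^ m) (U i n t) (-k + m) := by
      have := bd_pow_reflect m (U i n t) (-k)
      rw [neg_neg] at this
      rw [this, show (fun l => U i n t (-l)) = U i n t from funext fun l => heven i n t ht l]
    rw [e, abs_mul, abs_pow, abs_neg, abs_one, one_pow, one_mul]
    refine le_trans ?_ (hpos i t ht (-k + m) (by omega))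
    have h1 : wt t k ≤ wt t (-k + m) := by
      unfold wt
      gcongr 1 + √t + ?_
      have hk' : (k : ℝ) ≤ 0 := by exact_mod_cast hk
      have hm : (0 : ℝ) ≤ m := Nat.cast_nonneg m
      push_cast
      rw [abs_of_nonpos hk', abs_of_nonneg (by linarith)]
      linarith
    have := wt_pos t k
    gcongr

theorem space_point {N : ℕ} (hN : 2 ≤ N) {k : ℕ} {k' : ℤ} (h : (k : ℤ) - (k / N : ℕ) ≤ k') :
    0 ≤ k' ∧ (1 - 1 / (N : ℝ)) * (1 + k) ≤ 1 + (k' : ℝ) := by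
  have h1 : k / N ≤ k := Nat.div_le_self k N
  have hN0 : (0 : ℝ) < N := by
    have : 0 < N := by omega
    exact_mod_cast this
  refine ⟨by omega, ?_⟩
  have h2 : ((k / N : ℕ) : ℝ) ≤ k / N := Nat.cast_div_le
  have h3 : (k : ℝ) - (k / N : ℕ) ≤ k' := by exact_mod_cast h
  have h4 : (1 - 1 / (N : ℝ)) * (1 + k) = 1 + k - k / N - 1 / N := by field_simp; ring
  have h5 : 0 < 1 / (N : ℝ) := by positivity
  rw [h4]
  linarith

theorem time_point {N : ℕ} (hN : 2 ≤ N) {t t' : ℝ} (ht : 0 ≤ t) (h : t - t / N ≤ t') :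
    0 ≤ t' ∧ (1 - 1 / (N : ℝ)) * (1 + √t) ≤ 1 + √t' := by
  have hN0 : (2 : ℝ) ≤ N := by exact_mod_cast hN
  have h5 : 0 < 1 / (N : ℝ) := by positivity
  have h6 : 1 / (N : ℝ) ≤ 1 := by
    rw [div_le_one (by linarith)]; linarith
  have h1 : t - t / N = (1 - 1 / (N : ℝ)) * t := by field_simp
  have h0 : 0 ≤ (1 - 1 / (N : ℝ)) * t := mul_nonneg (by linarith) ht
  refine ⟨by linarith, ?_⟩
  have h7 : (1 - 1 / (N : ℝ)) * √t ≤ √t' := by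
    refine le_trans ?_ (Real.sqrt_le_sqrt h)
    apply Real.le_sqrt_of_sq_le
    rw [mul_pow, Real.sq_sqrt ht, h1]
    nlinarith
  nlinarith

theorem one_half_le_ratio {N : ℕ} (hN : 2 ≤ N) : 1 / 2 ≤ 1 - 1 / (N : ℝ) := by
  have hN0 : (2 : ℝ) ≤ N := by exact_mod_cast hN
  have : 1 / (N : ℝ) ≤ 1 / 2 := by gcongr
  linarith

/-- When the decay of the second factor is already known no contraction is needed: the cut N = 2
only costs a power of 2 in the constant. -/
theorem spaceDec_convT (hq : Ker q Θ) (hU : Reg U) {n m : ℕ} (h : ∀ i ≤ m, SpaceDec U n i) :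
    SpaceDec (fun i => convT q (U i)) n m := by
  obtain ⟨C, hC0, hC⟩ := space_estimate hq hU n m (fun i hi => h i hi.le) le_rfl
  obtain ⟨D, hD0, hD⟩ := h m le_rfl
  have hΘ := hq.l1.nonneg
  refine ⟨C + Θ * (D * 2 ^ (2 + 2 * n + m)), by positivity, fun i t ht k hk => ?_⟩
  lift k to ℕ using hk
  refine (hC i t ht k (D * 2 ^ (2 + 2 * n + m) / (1 + (k : ℝ)) ^ (2 + 2 * n + m))
    fun t' ht' k' hk' => ?_).trans (le_of_eq ?_)
  · obtain ⟨h1, h2⟩ := space_point le_rfl hk'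
    have h1' : (0 : ℝ) ≤ k' := by exact_mod_cast h1
    refine (hD i t' ht' k' h1).trans ?_
    rw [div_le_div_iff₀ (by positivity) (by positivity), mul_assoc, ← mul_pow]
    gcongr
    norm_num at h2
    linarith
  · push_cast
    ring

theorem timeDec_convT (hq : Ker q Θ) (hU : Reg U) {n m : ℕ} (h0 : ∀ i < n, TimeDec U i 0)
    (h : TimeDec U n m) : TimeDec (fun i => convT q (U i)) n m := by
  obtain ⟨C, hC0, hC⟩ := time_estimate hq hU n m h0 le_rfl
  obtain ⟨D, hD0, hD⟩ := h
  have hΘ := hq.l1.nonneg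
  refine ⟨C + Θ * (D * 2 ^ (2 + 2 * n + m)), by positivity, fun i t ht k => ?_⟩
  refine (hC i t ht (D * 2 ^ (2 + 2 * n + m) / (1 + √t) ^ (2 + 2 * n + m))
    (fun t' ht' k' => ?_) k).trans (le_of_eq ?_)
  · obtain ⟨h1, h2⟩ := time_point le_rfl ht ht'
    refine (hD i t' h1 k').trans ?_
    rw [div_le_div_iff₀ (by positivity) (by positivity), mul_assoc, ← mul_pow]
    gcongr
    norm_num at h2
    linarith
  · ring

/-- The cut is adapted to the order of decay p. This is why the single condition ΛΘ < 1 suffices for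
derivatives of every order. -/
theorem exists_ratio {θ : ℝ} (hθ : θ < 1) (p : ℕ) : ∃ N : ℕ, 2 ≤ N ∧ θ < (1 - 1 / (N : ℝ)) ^ p := by
  have h : Filter.Tendsto (fun N : ℕ => (1 - 1 / (N : ℝ)) ^ p) Filter.atTop (nhds 1) := by
    have := (tendsto_one_div_atTop_nhds_zero_nat (𝕜 := ℝ)).const_sub 1
    simpa using this.pow p
  obtain ⟨N, h1, h2⟩ := ((h.eventually (lt_mem_nhds hθ)).and (Filter.eventually_ge_atTop 2)).exists
  exact ⟨N, h2, h1⟩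

variable {lam : ι → ℝ} {Λ : ℝ}

theorem abs_fixedPoint_le {a b l X : ℝ} (hl0 : 0 ≤ l) (hl : l ≤ Λ) (hb : |b| ≤ X) :
    |a - l * b| ≤ |a| + Λ * X := by
  refine (abs_sub _ _).trans ?_
  rw [abs_mul, abs_of_nonneg hl0]
  have := hl0.trans hl
  gcongr

theorem bd_pow_fixedPoint (hfix : ∀ i n t, 0 ≤ t → ∀ k,
      U i n t k = F i n t k - lam i * convT q (U i) n t k) (m : ℕ) (i : ι) (n : ℕ) {t : ℝ}
    (ht : 0 ≤ t) (k : ℤ) : (bd ^ m) (U i n t) k =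
      (bd ^ m) (F i n t) k - lam i * (bd ^ m) (convT q (U i) n t) k := by
  have : U i n t = F i n t - lam i • convT q (U i) n t := by
    ext k
    simp [hfix i n t ht k]
  rw [this, map_sub, map_smul]
  simp

theorem Reg.bd_pow_bdd (hU : Reg U) (n m : ℕ) :
    ∃ M : ℝ, ∀ i t, 0 ≤ t → ∀ k, |(bd ^ m) (U i n t) k| ≤ M := by
  obtain ⟨M, hM⟩ := hU.bdd n
  exact ⟨2 ^ m * M, fun i t ht k => abs_bd_pow_le fun l _ _ => hM i t ht l⟩

/-- Induction on the number of spatial differences, since the boundary terms of the spatial cut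
involve fewer differences of U at the same time order. -/
theorem spaceDec_of_fixedPoint (hq : Ker q Θ) (hU : Reg U) (hF : ∀ n m, SpaceDec F n m)
    (hl0 : ∀ i, 0 ≤ lam i) (hl : ∀ i, lam i ≤ Λ) (hΛ : Λ * Θ < 1)
    (hfix : ∀ i n t, 0 ≤ t → ∀ k, U i n t k = F i n t k - lam i * convT q (U i) n t k)
    (n m : ℕ) : SpaceDec U n m := by
  rcases isEmpty_or_nonempty ι with hι | ⟨⟨i₀⟩⟩
  · exact ⟨0, le_rfl, fun i => (hι.false i).elim⟩
  have hΛ0 : 0 ≤ Λ := (hl0 i₀).trans (hl i₀)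
  induction m using Nat.strong_induction_on with
  | _ m ih =>
  obtain ⟨N, hN, hNθ⟩ := exists_ratio hΛ (2 + 2 * n + m)
  obtain ⟨C, hC0, hC⟩ := space_estimate hq hU n m ih hN
  obtain ⟨D, hD0, hD⟩ := hF n m
  obtain ⟨M, hM⟩ := hU.bd_pow_bdd n m
  have hρ := one_half_le_ratio hN
  have hρ1 : 1 - 1 / (N : ℝ) ≤ 1 := by
    have : 0 ≤ 1 / (N : ℝ) := by positivity
    linarith
  set ρ := 1 - 1 / (N : ℝ) with hρdef
  have key := decay_of_contraction (α := ι × {t : ℝ // 0 ≤ t} × ℕ)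
    (ψ := fun a => |(bd ^ m) (U a.1 n a.2.1) (a.2.2 : ℤ)|) (x := fun a => 1 + (a.2.2 : ℝ))
    (fun a => le_add_of_nonneg_right (Nat.cast_nonneg _)) (fun a => abs_nonneg _)
    (fun a => hM a.1 a.2.1 a.2.1.2 _) (by linarith) hρ1 (2 + 2 * n + m)
    (C := D + Λ * C) (by positivity) hNθ (fun ⟨i, ⟨t, ht⟩, k⟩ X hX => by
      have h1 := hC i t ht k X fun t' ht' k' hk' => by
        obtain ⟨h1, h2⟩ := space_point hN hk'
        lift k' to ℕ using h1
        exact hX ⟨i, ⟨t', ht'⟩, k'⟩ (by simpa only [Int.cast_natCast] using h2)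
      rw [bd_pow_fixedPoint hfix m i n ht]
      refine (abs_fixedPoint_le (hl0 i) (hl i) h1).trans ?_
      have h2 := hD i t ht k (Int.natCast_nonneg k)
      rw [Int.cast_natCast] at h2
      calc _ ≤ D / (1 + (k : ℝ)) ^ (2 + 2 * n + m) +
            Λ * (C / (1 + (k : ℝ)) ^ (2 + 2 * n + m) + Θ * X) := by gcongr
        _ = _ := by ring)
  have hpos : 0 ≤ (D + Λ * C) / (1 - Λ * Θ / ρ ^ (2 + 2 * n + m)) := by
    have hp : 0 < ρ ^ (2 + 2 * n + m) := by positivity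
    have : 0 < 1 - Λ * Θ / ρ ^ (2 + 2 * n + m) := by rw [sub_pos, div_lt_one hp]; exact hNθ
    positivity
  refine ⟨_, hpos, fun i t ht k hk => ?_⟩
  lift k to ℕ using hk
  exact key ⟨i, ⟨t, ht⟩, k⟩

/-- Induction on the number of time derivatives, since the boundary terms of the cut in time involve
lower time derivatives of U, without differences. -/
theorem timeDec_of_fixedPoint (hq : Ker q Θ) (hU : Reg U) (hF : ∀ n m, TimeDec F n m)
    (hl0 : ∀ i, 0 ≤ lam i) (hl : ∀ i, lam i ≤ Λ) (hΛ : Λ * Θ < 1)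
    (hfix : ∀ i n t, 0 ≤ t → ∀ k, U i n t k = F i n t k - lam i * convT q (U i) n t k)
    (n m : ℕ) : TimeDec U n m := by
  rcases isEmpty_or_nonempty ι with hι | ⟨⟨i₀⟩⟩
  · exact ⟨0, le_rfl, fun i => (hι.false i).elim⟩
  have hΛ0 : 0 ≤ Λ := (hl0 i₀).trans (hl i₀)
  induction n using Nat.strong_induction_on generalizing m with
  | _ n ih =>
  obtain ⟨N, hN, hNθ⟩ := exists_ratio hΛ (2 + 2 * n + m)
  obtain ⟨C, hC0, hC⟩ := time_estimate hq hU n m (fun i hi => ih i hi 0) hN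
  obtain ⟨D, hD0, hD⟩ := hF n m
  obtain ⟨M, hM⟩ := hU.bd_pow_bdd n m
  have hρ := one_half_le_ratio hN
  have hρ1 : 1 - 1 / (N : ℝ) ≤ 1 := by
    have : 0 ≤ 1 / (N : ℝ) := by positivity
    linarith
  set ρ := 1 - 1 / (N : ℝ) with hρdef
  have key := decay_of_contraction (α := ι × {t : ℝ // 0 ≤ t} × ℤ)
    (ψ := fun a => |(bd ^ m) (U a.1 n a.2.1) a.2.2|) (x := fun a => 1 + √(a.2.1 : ℝ))
    (fun a => le_add_of_nonneg_right (Real.sqrt_nonneg _)) (fun a => abs_nonneg _)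
    (fun a => hM a.1 a.2.1 a.2.1.2 _) (by linarith) hρ1 (2 + 2 * n + m)
    (C := D + Λ * C) (by positivity) hNθ (fun ⟨i, ⟨t, ht⟩, k⟩ X hX => by
      have h1 := hC i t ht X (fun t' ht' k' => by
        obtain ⟨h1, h2⟩ := time_point hN ht ht'
        exact hX ⟨i, ⟨t', h1⟩, k'⟩ h2) k
      rw [bd_pow_fixedPoint hfix m i n ht]
      refine (abs_fixedPoint_le (hl0 i) (hl i) h1).trans ?_
      have h2 := hD i t ht k
      calc _ ≤ D / (1 + √t) ^ (2 + 2 * n + m) +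
            Λ * (C / (1 + √t) ^ (2 + 2 * n + m) + Θ * X) := by gcongr
        _ = _ := by ring)
  have hpos : 0 ≤ (D + Λ * C) / (1 - Λ * Θ / ρ ^ (2 + 2 * n + m)) := by
    have hp : 0 < ρ ^ (2 + 2 * n + m) := by positivity
    have : 0 < 1 - Λ * Θ / ρ ^ (2 + 2 * n + m) := by rw [sub_pos, div_lt_one hp]; exact hNθ
    positivity
  exact ⟨_, hpos, fun i t ht k => key ⟨i, ⟨t, ht⟩, k⟩⟩

end SemiDiscrete

end

noncomputable section

namespace SemiDiscrete

/-! ### The `L¹` norm of the kernel -/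

theorem continuous_heatKernel_one (k : ℤ) : Continuous fun t => heatKernel 1 t k :=
  continuous_iff_continuousAt.2 fun t => (hasDerivAt_heatKernel_one t k).continuousAt

/-- The local energy identity 2pΔp = Δ(p²) - |∇⁻p|² - |∇⁺p|². -/
theorem hasDerivAt_heatKernel_sq (t : ℝ) (k : ℤ) :
    HasDerivAt (fun s => heatKernel 1 s k ^ 2)
      (1 / 2 * (heatKernel 1 t (k + 1) ^ 2 - 2 * heatKernel 1 t k ^ 2 + heatKernel 1 t (k - 1) ^ 2) -
        1 / 2 * (bd (heatKernel 1 t) k ^ 2 + bd (heatKernel 1 t) (k + 1) ^ 2)) t := by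
  refine ((hasDerivAt_heatKernel_one t k).pow 2).congr_deriv ?_
  simp only [bd_pow_succ', bd_apply, pow_zero, Module.End.one_apply, add_sub_cancel_right]
  norm_num
  ring

theorem summable_heatKernel_sq_bound : ∃ B : ℤ → ℝ, Summable B ∧
    ∀ t, 0 ≤ t → ∀ l, heatKernel 1 t l ^ 2 ≤ B l := by
  obtain ⟨C, h0, hC⟩ := dec_pT.nonneg_bound 0 0
  refine ⟨fun l => C ^ 2 * ((1 + |(l : ℝ)|) ^ 2)⁻¹, summable_inv_sq.mul_left _, fun t ht l => ?_⟩
  have h := hC t ht l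
  simp only [pow_zero, Module.End.one_apply, pT_zero, mul_zero, add_zero, pow_one] at h
  beta_reduce
  rw [← div_eq_mul_inv, le_div_iff₀ (by positivity), ← sq_abs, ← mul_pow]
  gcongr
  refine le_trans ?_ h
  gcongr
  exact one_add_abs_le_wt

theorem hasSum_shift {f : ℤ → ℝ} {a : ℝ} (h : HasSum f a) (c : ℤ) : HasSum (fun l => f (l + c)) a :=
  (Equiv.addRight c).hasSum_iff.2 h

/-- Integration of the local energy identity over [0, T] and summation over ℤ: the Laplacian of the
time-integrated squares sums to zero by translation invariance, so the dissipation is the initial ℓ²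
mass 1 minus the final one. -/
theorem sum_energy_le_of_hasDerivAt {u : ℝ → ℤ → ℝ} (hc : ∀ k, Continuous fun t => u t k)
    (hd : ∀ t k, HasDerivAt (fun s => u s k ^ 2)
      (1 / 2 * (u t (k + 1) ^ 2 - 2 * u t k ^ 2 + u t (k - 1) ^ 2) -
        1 / 2 * (bd (u t) k ^ 2 + bd (u t) (k + 1) ^ 2)) t)
    (h0 : ∀ k, u 0 k = if k = 0 then 1 else 0)
    {B : ℤ → ℝ} (hB : Summable B) (hpB : ∀ t, 0 ≤ t → ∀ l, u t l ^ 2 ≤ B l) {T : ℝ} (hT : 0 ≤ T) (s : Finset ℤ) :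
    ∑ l ∈ s, ∫ r in (0 : ℝ)..T,
      1 / 2 * (bd (u r) l ^ 2 + bd (u r) (l + 1) ^ 2) ≤ 1 := by
  set I : ℤ → ℝ := fun l => ∫ r in (0 : ℝ)..T, u r l ^ 2 with hI
  have hII : ∀ l, IntervalIntegrable (fun r => u r l ^ 2) volume 0 T := fun l =>
    ((hc l).pow 2).intervalIntegrable _ _
  have hcb : ∀ l, Continuous fun r => bd (u r) l := fun l => by
    simp only [bd_apply]; exact (hc l).sub (hc (l - 1))
  have hEI : ∀ l, IntervalIntegrable (fun r =>
      1 / 2 * (bd (u r) l ^ 2 + bd (u r) (l + 1) ^ 2)) volume 0 T := fun l =>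
    ((((hcb l).pow 2).add ((hcb (l + 1)).pow 2)).const_mul _).intervalIntegrable _ _
  have hIs : Summable I := by
    refine Summable.of_norm_bounded (hB.mul_right T) fun l => ?_
    have := intervalIntegral.norm_integral_le_of_norm_le_const (a := 0) (b := T) (C := B l)
      (f := fun r => u r l ^ 2) fun r hr => by
        rw [uIoc_of_le hT] at hr
        rw [Real.norm_of_nonneg (sq_nonneg _)]
        exact hpB r hr.1.le l
    rwa [sub_zero, abs_of_nonneg hT] at this
  have hform : ∀ l, ∫ r in (0 : ℝ)..T,
      1 / 2 * (bd (u r) l ^ 2 + bd (u r) (l + 1) ^ 2) =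
      u 0 l ^ 2 - u T l ^ 2 + 1 / 2 * (I (l + 1) - 2 * I l + I (l - 1)) := by
    intro l
    have hL := (((hII (l + 1)).sub ((hII l).const_mul 2)).add (hII (l - 1))).const_mul (1 / 2)
    have h1 := intervalIntegral.integral_eq_sub_of_hasDerivAt (a := 0) (b := T)
      (fun r _ => hd r l) (hL.sub (hEI l))
    rw [intervalIntegral.integral_sub hL (hEI l), intervalIntegral.integral_const_mul,
      intervalIntegral.integral_add ((hII (l + 1)).sub ((hII l).const_mul 2)) (hII (l - 1)),
      intervalIntegral.integral_sub (hII (l + 1)) ((hII l).const_mul 2),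
      intervalIntegral.integral_const_mul] at h1
    simp only [hI]
    linarith
  have hp0 : HasSum (fun l => u 0 l ^ 2) 1 := by
    have e : (fun l => u 0 l ^ 2) = fun l => if l = 0 then 1 else 0 := by
      ext l
      rw [h0]
      split_ifs <;> simp
    rw [e]
    exact hasSum_ite_eq (0 : ℤ) (1 : ℝ)
  have hpT : Summable fun l => u T l ^ 2 :=
    Summable.of_nonneg_of_le (fun l => sq_nonneg _) (hpB T hT) hB
  have hI1 : HasSum (fun l => I (l + 1)) (∑' l, I l) :=
    hasSum_shift hIs.hasSum 1
  have hI2 : HasSum (fun l => I (l - 1)) (∑' l, I l) :=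
    hasSum_shift hIs.hasSum (-1)
  have hsum := (hp0.sub hpT.hasSum).add (((hI1.sub (hIs.hasSum.mul_left 2)).add hI2).mul_left (1 / 2))
  simp only [← hform] at hsum
  refine (sum_le_hasSum s (fun l _ => ?_) hsum).trans ?_
  · exact intervalIntegral.integral_nonneg hT fun r _ => by positivity
  · have : 0 ≤ ∑' l, u T l ^ 2 := tsum_nonneg fun l => sq_nonneg _
    linarith

theorem sum_energy_le {T : ℝ} (hT : 0 ≤ T) (s : Finset ℤ) :
    ∑ l ∈ s, ∫ r in (0 : ℝ)..T,
      1 / 2 * (bd (heatKernel 1 r) l ^ 2 + bd (heatKernel 1 r) (l + 1) ^ 2) ≤ 1 := by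
  obtain ⟨B, hB, hpB⟩ := summable_heatKernel_sq_bound
  exact sum_energy_le_of_hasDerivAt continuous_heatKernel_one hasDerivAt_heatKernel_sq
    heatKernel_one_zero hB hpB hT s

theorem abs_qT_zero (t : ℝ) (k : ℤ) : |qT 0 t k| =
    1 / 2 * (bd (heatKernel 1 t) k ^ 2 + bd (heatKernel 1 t) (k + 1) ^ 2) -
      1 / 2 * (|bd (heatKernel 1 t) k| - |bd (heatKernel 1 t) (k + 1)|) ^ 2 := by
  have : qT 0 t k = bd (heatKernel 1 t) k * bd (heatKernel 1 t) (k + 1) := by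
    simp [qT, mulT, BD, pT_zero]
  rw [this, abs_mul, sub_sq, sq_abs, sq_abs]
  ring

/-- By `abs_qT_zero`, |q| falls short of the energy density by half the square of the difference of
the absolute gradients. It is enough that this deficit has positive integral at one site. -/
theorem exists_l1Bd_qT : ∃ Θ : ℝ, 0 < Θ ∧ Θ < 1 ∧ L1Bd (qT 0) Θ := by
  have hc := continuous_heatKernel_one
  have hcb : ∀ l, Continuous fun r => bd (heatKernel 1 r) l := fun l => by
    simp only [bd_apply]; exact (hc l).sub (hc (l - 1))
  set d : ℤ → ℝ → ℝ := fun l r =>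
    1 / 2 * (|bd (heatKernel 1 r) l| - |bd (heatKernel 1 r) (l + 1)|) ^ 2 with hd
  have hdc : ∀ l, Continuous (d l) := fun l =>
    (((hcb l).abs.sub (hcb (l + 1)).abs).pow 2).const_mul _
  have hd0 : ∀ l r, 0 ≤ d l r := fun l r => by simp only [hd]; positivity
  -- At time 0 and site 1 the backward gradient is -1 and the forward one is 0, so the deficit is
  -- 1/2 there. At site 0 it would be zero, by symmetry.
  set c := ∫ r in (0 : ℝ)..1, d 1 r with hcdef
  have hcpos : 0 < c := by
    apply intervalIntegral.integral_pos one_pos (hdc 1).continuousOn (fun r _ => hd0 1 r)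
    refine ⟨0, by simp, ?_⟩
    simp [hd, bd_apply, heatKernel_one_zero]
  have hqc : ∀ l, Continuous fun r => |qT 0 r l| := fun l => by
    simp only [abs_qT_zero]
    exact ((((hcb l).pow 2).add ((hcb (l + 1)).pow 2)).const_mul _).sub (hdc l)
  have hmain : ∀ T, 1 ≤ T → ∀ s : Finset ℤ, 1 ∈ s →
      ∑ l ∈ s, ∫ r in (0 : ℝ)..T, |qT 0 r l| ≤ 1 - c := by
    intro T hT s hs
    have hT0 : (0 : ℝ) ≤ T := by linarith
    have h1 : ∑ l ∈ s, ∫ r in (0 : ℝ)..T, |qT 0 r l| = ∑ l ∈ s, (∫ r in (0 : ℝ)..T,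
        1 / 2 * (bd (heatKernel 1 r) l ^ 2 + bd (heatKernel 1 r) (l + 1) ^ 2)) -
        ∑ l ∈ s, ∫ r in (0 : ℝ)..T, d l r := by
      rw [← Finset.sum_sub_distrib]
      refine Finset.sum_congr rfl fun l _ => ?_
      rw [← intervalIntegral.integral_sub]
      · simp only [abs_qT_zero, hd]
      · exact ((((hcb l).pow 2).add ((hcb (l + 1)).pow 2)).const_mul _).intervalIntegrable _ _
      · exact (hdc l).intervalIntegrable _ _
    have h2 : c ≤ ∑ l ∈ s, ∫ r in (0 : ℝ)..T, d l r := by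
      refine le_trans ?_ (Finset.single_le_sum (f := fun l => ∫ r in (0 : ℝ)..T, d l r)
        (fun l _ => intervalIntegral.integral_nonneg hT0 fun r _ => hd0 l r) hs)
      exact intervalIntegral.integral_mono_interval le_rfl zero_le_one hT
        (Filter.Eventually.of_forall fun r => hd0 1 r) ((hdc 1).intervalIntegrable _ _)
    have h3 := sum_energy_le hT0 s
    linarith
  -- The maximum with 1/2 only ensures positivity. Enlarging T to at least 1 and s to contain the
  -- site 1 makes the deficit available in every case.
  refine ⟨max (1 / 2) (1 - c), by positivity, max_lt (by norm_num) (by linarith), fun T hT s => ?_⟩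
  refine le_trans ?_ ((hmain (max T 1) (le_max_right _ _) (insert 1 s)
    (Finset.mem_insert_self _ _)).trans (le_max_right _ _))
  have hTm : 0 ≤ max T 1 := hT.trans (le_max_left _ _)
  refine (Finset.sum_le_sum fun l _ => ?_).trans (Finset.sum_le_sum_of_subset_of_nonneg
    (Finset.subset_insert 1 s) fun l _ _ =>
      intervalIntegral.integral_nonneg hTm fun r _ => abs_nonneg _)
  exact intervalIntegral.integral_mono_interval le_rfl hT (le_max_left _ _)
    (Filter.Eventually.of_forall fun r => abs_nonneg _) ((hqc l).intervalIntegrable _ _)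

theorem lintegral_tsum_le_of_l1Bd {f : ℝ → ℤ → ℝ} (hc : SCont f) {C : ℝ} (h : L1Bd f C) :
    ∫⁻ t in Ici (0 : ℝ), ∑' k : ℤ, ‖f t k‖ₑ ≤ ENNReal.ofReal C := by
  have hm : ∀ k, AEStronglyMeasurable (fun t => f t k) (volume.restrict (Ici 0)) := fun k =>
    (hc k).aestronglyMeasurable measurableSet_Ici
  rw [lintegral_tsum fun k => (hm k).enorm]
  rw [ENNReal.tsum_eq_iSup_sum]
  refine iSup_le fun s => ?_
  have hint : ∀ (l : ℤ) (T : ℝ), 0 ≤ T → IntervalIntegrable (fun t => f t l) volume 0 T := by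
    intro l T hT
    apply ContinuousOn.intervalIntegrable
    rw [uIcc_of_le hT]
    exact (hc l).mono Icc_subset_Ici_self
  have hI : ∀ l, IntegrableOn (fun t => f t l) (Ioi 0) := by
    intro l
    refine integrableOn_Ioi_of_intervalIntegral_norm_bounded (b := fun n : ℕ => (n : ℝ)) C 0
      (fun n => ?_) tendsto_natCast_atTop_atTop (Filter.Eventually.of_forall fun n => ?_)
    · exact (intervalIntegrable_iff_integrableOn_Ioc_of_le (Nat.cast_nonneg n)).1
        (hint l n (Nat.cast_nonneg n))
    · simpa using h n (Nat.cast_nonneg n) {l}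
  have h1 : ∀ l, ∫⁻ t in Ici (0 : ℝ), ‖f t l‖ₑ = ENNReal.ofReal (∫ t in Ioi (0 : ℝ), |f t l|) := by
    intro l
    rw [Measure.restrict_congr_set Ioi_ae_eq_Ici.symm]
    exact (ofReal_integral_norm_eq_lintegral_enorm (hI l)).symm
  simp only [h1]
  rw [← ENNReal.ofReal_sum_of_nonneg fun l _ => integral_nonneg fun t => abs_nonneg _]
  apply ENNReal.ofReal_le_ofReal
  have ht : Filter.Tendsto (fun n : ℕ => ∑ l ∈ s, ∫ t in (0 : ℝ)..(n : ℝ), |f t l|) Filter.atTop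
      (nhds (∑ l ∈ s, ∫ t in Ioi (0 : ℝ), |f t l|)) :=
    tendsto_finsetSum s fun l _ =>
      intervalIntegral_tendsto_integral_Ioi 0 (hI l).abs tendsto_natCast_atTop_atTop
  exact le_of_tendsto' ht fun n => h n (Nat.cast_nonneg n) s

end SemiDiscrete

end

noncomputable section

namespace SemiDiscrete

/-! ### The mass of the heat kernel -/

/-- Comparison of one factor a + n with a + n - 1 makes the sum telescope; the bound is uniform in
the width a. -/
theorem sum_range_cauchy_le {a : ℝ} (ha : 1 ≤ a) (N : ℕ) :
    ∑ n ∈ Finset.range N, a / (a + (n : ℝ)) ^ 2 ≤ 2 := by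
  have h : ∀ N : ℕ, ∑ n ∈ Finset.range (N + 1), a / (a + (n : ℝ)) ^ 2 ≤ 1 / a + N / (a + N) := by
    intro N
    induction N with
    | zero =>
      simp only [zero_add, Finset.sum_range_one, Nat.cast_zero, add_zero, zero_div]
      rw [div_le_div_iff₀ (by positivity) (by positivity)]
      nlinarith
    | succ N ih =>
      rw [Finset.sum_range_succ]
      have h1 : a / (a + ((N + 1 : ℕ) : ℝ)) ^ 2 ≤ a / ((a + N) * (a + (N + 1))) := by
        push_cast
        rw [sq]
        gcongr
        linarith
      have h2 : a / ((a + N) * (a + (N + 1))) = (N + 1) / (a + (N + 1)) - N / (a + N) := by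
        rw [div_sub_div _ _ (by positivity) (by positivity),
          div_eq_div_iff (by positivity) (by positivity)]
        ring
      push_cast at *
      linarith
  rcases N with _ | N
  · simp
  · refine (h N).trans ?_
    have h1 : 1 / a ≤ 1 := by rw [div_le_one (by linarith)]; exact ha
    have h2 : (N : ℝ) / (a + N) ≤ 1 := by rw [div_le_one (by positivity)]; linarith
    linarith

/-- The decay estimates dominate the kernel by the profile a / (a + |k|)² of width a = 1 + √t. Its
sum over each half-line is at most 2, whatever the width. -/
theorem exists_mass_heatKernel : ∃ H : ℝ, ∀ t, 0 ≤ t → ∀ s : Finset ℤ,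
    ∑ k ∈ s, |heatKernel 1 t k| ≤ H := by
  obtain ⟨A, hA0, hA⟩ := heatKernel_decay 0 0
  obtain ⟨B, hB0, hB⟩ := heatKernel_decay 2 0
  refine ⟨2 * (A + B) * 4, fun t ht s => ?_⟩
  set a := 1 + √t with ha
  have ha1 : 1 ≤ a := le_add_of_nonneg_right (Real.sqrt_nonneg t)
  have hp : ∀ k, |heatKernel 1 t k| ≤ 2 * (A + B) * (a / (a + |(k : ℝ)|) ^ 2) := by
    intro k
    have h1 := hA t ht k
    have h2 := hB t ht k
    simp only [pow_zero, Module.End.one_apply, zero_add, pow_one, mul_one] at h1 h2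
    rw [← ha] at h1 h2
    have h3 : |heatKernel 1 t k| * (1 + |(k : ℝ)|) ^ 2 ≤ B * a := by
      refine le_of_mul_le_mul_right ?_ (zero_lt_one.trans_le ha1)
      linarith
    have h4 : (a + |(k : ℝ)|) ^ 2 ≤ 2 * (a ^ 2 + (1 + |(k : ℝ)|) ^ 2) := by
      nlinarith [sq_nonneg (a - |(k : ℝ)|), abs_nonneg (k : ℝ)]
    have h5 : |heatKernel 1 t k| * a ^ 2 ≤ A * a := by
      rw [sq, ← mul_assoc]
      gcongr
    rw [← mul_div_assoc, le_div_iff₀ (by positivity)]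
    have := mul_le_mul_of_nonneg_left h4 (abs_nonneg (heatKernel 1 t k))
    linarith
  set f : ℤ → ℝ := fun k => a / (a + |(k : ℝ)|) ^ 2 with hf
  have h0 : ∀ n : ℕ, 0 ≤ a / (a + (n : ℝ)) ^ 2 := fun n => by positivity
  have hs := summable_of_sum_range_le h0 (sum_range_cauchy_le ha1)
  have ht1 := Real.tsum_le_of_sum_range_le h0 (sum_range_cauchy_le ha1)
  have hle : ∀ n : ℕ, f (-(n + 1 : ℤ)) ≤ a / (a + (n : ℝ)) ^ 2 := by
    intro n
    simp only [hf]
    push_cast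
    rw [abs_neg, abs_of_nonneg (by positivity)]
    gcongr
    linarith
  have hs2 : Summable fun n : ℕ => f (-(n + 1 : ℤ)) :=
    Summable.of_nonneg_of_le (fun n => by simp only [hf]; positivity) hle hs
  have hfs : HasSum f ((∑' n : ℕ, a / (a + (n : ℝ)) ^ 2) + ∑' n : ℕ, f (-(n + 1 : ℤ))) := by
    refine HasSum.of_nat_of_neg_add_one ?_ hs2.hasSum
    simpa [hf] using hs.hasSum
  have ht2 : ∑' n : ℕ, f (-(n + 1 : ℤ)) ≤ 2 := (hs2.tsum_le_tsum hle hs).trans ht1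
  calc _ ≤ ∑ k ∈ s, 2 * (A + B) * f k := Finset.sum_le_sum fun k _ => hp k
    _ = 2 * (A + B) * ∑ k ∈ s, f k := by rw [Finset.mul_sum]
    _ ≤ _ := by
      gcongr
      refine (sum_le_hasSum s (fun k _ => ?_) hfs).trans (by linarith)
      simp only [hf]
      positivity

theorem mass_bd {u : ℝ → ℤ → ℝ} {H : ℝ} (h : ∀ t, 0 ≤ t → ∀ s : Finset ℤ, ∑ k ∈ s, |u t k| ≤ H) :
    ∀ t, 0 ≤ t → ∀ s : Finset ℤ, ∑ k ∈ s, |bd (u t) k| ≤ 2 * H := by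
  intro t ht s
  calc _ ≤ ∑ k ∈ s, (|u t k| + |u t (k - 1)|) := Finset.sum_le_sum fun k _ => by
        rw [bd_apply]; exact abs_sub _ _
    _ = ∑ k ∈ s, |u t k| + ∑ k ∈ s.map (Equiv.subRight (1 : ℤ)).toEmbedding, |u t k| := by
        rw [Finset.sum_add_distrib, Finset.sum_map]
        rfl
    _ ≤ _ := by linarith [h t ht s, h t ht (s.map (Equiv.subRight (1 : ℤ)).toEmbedding)]

theorem Dec.decU {p : ℕ} {F : ℕ → ℝ → ℤ → ℝ} (h : Dec p F) : DecU p (fun _ : Unit => F) := by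
  intro n m
  obtain ⟨C, h0, hC⟩ := h.nonneg_bound n m
  exact ⟨C, h0, fun _ => hC⟩

theorem DecU.bdd {ι : Type*} {p : ℕ} {U : ι → ℕ → ℝ → ℤ → ℝ} (h : DecU p U) (n : ℕ) :
    ∃ M : ℝ, ∀ i t, 0 ≤ t → ∀ k, |U i n t k| ≤ M := by
  obtain ⟨C, h0, hC⟩ := h n 0
  refine ⟨C, fun i t ht k => le_trans ?_ (hC i t ht k)⟩
  simp only [pow_zero, Module.End.one_apply]
  exact le_mul_of_one_le_right (abs_nonneg _) (one_le_pow₀ (one_le_wt t k))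

theorem reg_bd_pT : Reg (fun _ : Unit => BD 1 pT) where
  tower _ := tower_pT.BD 1
  bdd := (dec_pT.BD 1).decU.bdd
  mass := by
    obtain ⟨H, hH⟩ := exists_mass_heatKernel
    refine ⟨2 * H, fun _ t ht s => ?_⟩
    simpa [BD, pT_zero] using mass_bd hH t ht s
  jet n := by
    obtain ⟨K, hK⟩ := finJet_pT.BD 1 n
    exact ⟨K, fun _ => hK⟩

theorem supBd_pT (n : ℕ) : SupBd (pT n) := by
  obtain ⟨M, hM⟩ := dec_pT.decU.bdd n
  exact ⟨M, hM ()⟩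

theorem ker_qT {Θ : ℝ} (h : L1Bd (qT 0) Θ) : Ker qT Θ := ⟨tower_qT, dec_qT, finJet_qT, h⟩

/-! ### The convolution of `q` with the heat kernel -/

theorem cI_add_left {a a' b : ℝ → ℝ} (ha : ContinuousOn a (Ici 0)) (ha' : ContinuousOn a' (Ici 0))
    (hb : ContinuousOn b (Ici 0)) {t : ℝ} (ht : 0 ≤ t) :
    cI (fun r => a r + a' r) b t = cI a b t + cI a' b t := by
  unfold cI
  rw [← intervalIntegral.integral_add (cI_integrand_intervalIntegrable ha hb le_rfl ht le_rfl)
    (cI_integrand_intervalIntegrable ha' hb le_rfl ht le_rfl)]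
  simp only [add_mul]

theorem cI_mul_left (c : ℝ) (a b : ℝ → ℝ) (t : ℝ) : cI (fun r => c * a r) b t = c * cI a b t := by
  unfold cI
  rw [← intervalIntegral.integral_const_mul]
  simp only [mul_assoc]

theorem cI_comm (a b : ℝ → ℝ) (t : ℝ) : cI a b t = cI b a t := by
  rw [cI_eq_flip, cI]
  simp only [mul_comm]

theorem hasSum_sub_shift {φ : ℤ → ℤ → ℝ} {A : ℤ → ℝ} (h : ∀ k, HasSum (fun l => φ l (k - l)) (A k))
    (c k : ℤ) : HasSum (fun l => φ (l + c) (k - l)) (A (k + c)) := by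
  have := hasSum_shift (h (k + c)) c
  simpa only [add_sub_add_right_eq_sub] using this

theorem pT_one (t : ℝ) (k : ℤ) :
    pT 1 t k = 1 / 2 * pT 0 t (k + 1) + (-1 * pT 0 t k + 1 / 2 * pT 0 t (k - 1)) := by
  simp only [pT, bd_pow_succ', bd_apply, pow_zero, Module.End.one_apply, mul_one,
    Nat.cast_one, Nat.cast_zero, add_zero, mul_zero]
  ring_nf

/-- Duhamel's formula for the product of neighbouring values of the heat kernel. -/
theorem convT_qT_pT_zero {t : ℝ} (ht : 0 ≤ t) (k : ℤ) :
    convT qT pT 0 t k + convT qT pT 0 t (k + 1) = -2 * nbT 0 t k := by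
  have hp := fun n l => tower_pT.continuousOn n l
  have hn := fun n l => tower_nbT.continuousOn n l
  have hq := fun n l => tower_qT.continuousOn n l
  -- The time derivative is moved from the product P to p. The boundary term at time zero vanishes
  -- with P, and the other one contains p at time zero, the unit mass at the origin.
  have hcut : ∀ l, cI (fun r => nbT 1 r l) (fun r => pT 0 r (k - l)) t =
      cI (fun r => nbT 0 r l) (fun r => pT 1 r (k - l)) t + nbT 0 t l * pT 0 0 (k - l) := by
    intro l
    have := jetE_eq (a := fun i r => nbT i r l) (b := fun i r => pT i r (k - l))
      (fun n t ht => tower_nbT n l t ht) (fun n t ht => tower_pT n (k - l) t ht) 1 ht le_rfl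
    simp only [jetE, intervalIntegral.integral_same, Finset.sum_range_one, sub_self, sub_zero,
      nbT_zero_zero, zero_mul, add_zero, zero_add] at this
    exact this.symm
  have hL : ∀ l, cI (fun r => nbT 1 r l) (fun r => pT 0 r (k - l)) t =
      1 / 2 * cI (fun r => nbT 0 r (l + 1)) (fun r => pT 0 r (k - l)) t +
      (-1 * cI (fun r => nbT 0 r l) (fun r => pT 0 r (k - l)) t +
      (1 / 2 * cI (fun r => nbT 0 r (l + -1)) (fun r => pT 0 r (k - l)) t +
      (-1 / 2 * cI (fun r => qT 0 r l) (fun r => pT 0 r (k - l)) t +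
       -1 / 2 * cI (fun r => qT 0 r (l + 1)) (fun r => pT 0 r (k - l)) t))) := by
    intro l
    have e : (fun r => nbT 1 r l) = fun r => 1 / 2 * nbT 0 r (l + 1) + (-1 * nbT 0 r l +
        (1 / 2 * nbT 0 r (l + -1) + (-1 / 2 * qT 0 r l + -1 / 2 * qT 0 r (l + 1)))) := by
      ext r
      rw [nbT_one, ← sub_eq_add_neg]
      ring
    have c1 := (hn 0 (l + 1)).const_mul (1 / 2 : ℝ)
    have c2 := (hn 0 l).const_mul (-1 : ℝ)
    have c3 := (hn 0 (l + -1)).const_mul (1 / 2 : ℝ)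
    have c4 := (hq 0 l).const_mul (-1 / 2 : ℝ)
    have c5 := (hq 0 (l + 1)).const_mul (-1 / 2 : ℝ)
    have cb := hp 0 (k - l)
    rw [e, cI_add_left c1 (c2.fun_add (c3.fun_add (c4.fun_add c5))) cb ht,
      cI_add_left c2 (c3.fun_add (c4.fun_add c5)) cb ht, cI_add_left c3 (c4.fun_add c5) cb ht,
      cI_add_left c4 c5 cb ht]
    simp only [cI_mul_left]
  have hR : ∀ l, cI (fun r => nbT 0 r l) (fun r => pT 1 r (k - l)) t =
      1 / 2 * cI (fun r => nbT 0 r l) (fun r => pT 0 r (k + 1 - l)) t +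
      (-1 * cI (fun r => nbT 0 r l) (fun r => pT 0 r (k - l)) t +
        1 / 2 * cI (fun r => nbT 0 r l) (fun r => pT 0 r (k + -1 - l)) t) := by
    intro l
    have e : (fun r => pT 1 r (k - l)) = fun r => 1 / 2 * pT 0 r (k + 1 - l) +
        (-1 * pT 0 r (k - l) + 1 / 2 * pT 0 r (k + -1 - l)) := by
      ext r
      rw [pT_one, show k - l + 1 = k + 1 - l by ring, show k - l - 1 = k + -1 - l by ring]
    have c1 := (hp 0 (k + 1 - l)).const_mul (1 / 2 : ℝ)
    have c2 := (hp 0 (k - l)).const_mul (-1 : ℝ)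
    have c3 := (hp 0 (k + -1 - l)).const_mul (1 / 2 : ℝ)
    have cb := hn 0 l
    rw [e, cI_comm, cI_add_left c1 (c2.fun_add c3) cb ht, cI_add_left c2 c3 cb ht]
    simp only [cI_mul_left]
    simp only [cI_comm _ fun r => nbT 0 r l]
  have hA : ∀ k, HasSum (fun l => cI (fun r => nbT 0 r l) (fun r => pT 0 r (k - l)) t)
      (cv (nbT 0) (pT 0) t k) := fun k =>
    (summable_cI (dec_nbT.sumBd le_rfl 0) (supBd_pT 0) ht k).hasSum
  have hB : ∀ k, HasSum (fun l => cI (fun r => qT 0 r l) (fun r => pT 0 r (k - l)) t)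
      (cv (qT 0) (pT 0) t k) := fun k =>
    (summable_cI (dec_qT.sumBd (by norm_num) 0) (supBd_pT 0) ht k).hasSum
  have hA' := hasSum_sub_shift
    (φ := fun l k => cI (fun r => nbT 0 r l) (fun r => pT 0 r k) t) hA
  have hB' := hasSum_sub_shift
    (φ := fun l k => cI (fun r => qT 0 r l) (fun r => pT 0 r k) t) hB
  have s1 := ((hA' 1 k).mul_left (1 / 2)).add (((hA k).mul_left (-1)).add
    (((hA' (-1) k).mul_left (1 / 2)).add (((hB k).mul_left (-1 / 2)).add
      ((hB' 1 k).mul_left (-1 / 2)))))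
  have s2 := ((hA (k + 1)).mul_left (1 / 2)).add (((hA k).mul_left (-1)).add
    ((hA (k + -1)).mul_left (1 / 2)))
  have s3 : HasSum (fun l => nbT 0 t l * pT 0 0 (k - l)) (nbT 0 t k) := by
    have : (fun l => nbT 0 t l * pT 0 0 (k - l)) = fun l => if l = k then nbT 0 t k else 0 := by
      ext l
      rw [pT_zero, heatKernel_one_zero]
      by_cases h : l = k
      · simp [h]
      · simp [h, sub_eq_zero, Ne.symm h]
    rw [this]
    exact hasSum_ite_eq k _
  have s4 := s2.add s3
  -- The Laplacian falls on P in one expression and on p in the other. After translation of the sums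
  -- the two coincide, and the source terms remain on one side and the boundary term on the other.
  simp only [← hL] at s1
  simp only [← hR, ← hcut] at s4
  have := s1.unique s4
  simp only [convT, Finset.range_zero, Finset.sum_empty, add_zero]
  linarith

theorem Tower.eq_of_zero {F G : ℕ → ℝ → ℤ → ℝ} (hF : Tower F) (hG : Tower G)
    (h : ∀ t, 0 ≤ t → ∀ k, F 0 t k = G 0 t k) (n : ℕ) {t : ℝ} (ht : 0 ≤ t) (k : ℤ) :
    F n t k = G n t k := by
  rw [← hF.iteratedDerivWithin_eq n k ht, ← hG.iteratedDerivWithin_eq n k ht]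
  exact iteratedDerivWithin_congr (fun s hs => h s hs k) ht

theorem tower_convT_qT_pT : Tower (convT qT pT) :=
  tower_convT tower_qT (dec_qT.sumBd (by norm_num)) tower_pT supBd_pT

/-- A value is the mean of itself and its neighbour minus half their difference. The mean is given
by Duhamel's formula, and the identity at time order 0 passes to all time derivatives. -/
theorem convT_qT_pT_eq (n : ℕ) {t : ℝ} (ht : 0 ≤ t) (k : ℤ) :
    convT qT pT n t k = -nbT n t k - 1 / 2 * bd (convT qT pT n t) (k + 1) := by
  have h := (tower_convT_qT_pT.add (tower_convT_qT_pT.shift 1)).eq_of_zero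
    (tower_nbT.const_mul (-2)) (fun t ht k => convT_qT_pT_zero ht k) n ht k
  beta_reduce at h
  rw [bd_apply, add_sub_cancel_right]
  linarith

/-- This is the gain of one order over p. In `convT_qT_pT_eq` the product P has order 2, and the
difference of the convolution falls on p, so that the second factor also has order 2 and
`spaceDec_convT`, `timeDec_convT` apply. -/
theorem decU_convT_qT_pT {Θ : ℝ} (h : L1Bd (qT 0) Θ) : DecU 2 (fun _ : Unit => convT qT pT) := by
  have hq := ker_qT h
  have hw : DecU 2 (fun _ : Unit => BD 1 pT) := (dec_pT.BD 1).decU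
  have e : ∀ (n m : ℕ) (t : ℝ), 0 ≤ t → ∀ k, (bd ^ m) (convT qT pT n t) k =
      -(bd ^ m) (nbT n t) k - 1 / 2 * (bd ^ m) (convT qT (BD 1 pT) n t) (k + 1) := by
    intro n m t ht k
    have h1 : convT qT pT n t = (-1 : ℝ) • nbT n t +
        (-1 / 2 : ℝ) • fun l => convT qT (BD 1 pT) n t (l + 1) := by
      ext l
      rw [convT_qT_pT_eq n ht]
      have h2 := bd_pow_convT tower_qT hq.sumBd tower_pT supBd_pT 1 n ht (l + 1)
      rw [pow_one] at h2
      simp only [h2, Pi.add_apply, Pi.smul_apply, smul_eq_mul]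
      ring
    rw [h1, map_add, map_smul, map_smul]
    simp only [Pi.add_apply, Pi.smul_apply, smul_eq_mul, bd_pow_shift]
    ring
  have hP := dec_nbT.decU
  refine decU_of_spaceDec_of_timeDec (fun n m => ?_) (fun n m => ?_)
    fun _ n t _ k => convT_even qT_neg pT_neg n t k
  · obtain ⟨A, hA0, hA⟩ := hP.spaceDec n m
    obtain ⟨B, hB0, hB⟩ := spaceDec_convT hq reg_bd_pT (m := m) fun i _ => hw.spaceDec n i
    refine ⟨A + B, by positivity, fun i t ht k hk => ?_⟩
    beta_reduce
    rw [e n m t ht]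
    have hk' : (0 : ℝ) ≤ k := by exact_mod_cast hk
    have h1 := hA i t ht k hk
    have h2 : |(bd ^ m) (convT qT (BD 1 pT) n t) (k + 1)| ≤
        B / (1 + (k : ℝ)) ^ (2 + 2 * n + m) := by
      refine (hB i t ht (k + 1) (by omega)).trans ?_
      gcongr
      linarith
    refine (abs_sub _ _).trans ?_
    rw [abs_neg, abs_mul, add_div]
    have h3 : |(1 / 2 : ℝ)| = 1 / 2 := by norm_num
    rw [h3]
    have := abs_nonneg ((bd ^ m) (convT qT (BD 1 pT) n t) (k + 1))
    linarith
  · obtain ⟨A, hA0, hA⟩ := hP.timeDec n m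
    obtain ⟨B, hB0, hB⟩ := timeDec_convT hq reg_bd_pT (fun i _ => hw.timeDec i 0) (hw.timeDec n m)
    refine ⟨A + B, by positivity, fun i t ht k => ?_⟩
    beta_reduce
    rw [e n m t ht]
    have h1 := hA i t ht k
    have h2 := hB i t ht (k + 1)
    refine (abs_sub _ _).trans ?_
    rw [abs_neg, abs_mul, add_div]
    have h3 : |(1 / 2 : ℝ)| = 1 / 2 := by norm_num
    rw [h3]
    have := abs_nonneg ((bd ^ m) (convT qT (BD 1 pT) n t) (k + 1))
    linarith

end SemiDiscrete

end

noncomputable section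

namespace SemiDiscrete

/-! ### Convolution on the group `ℤ × ℝ` -/

/-- The product of the counting measure on `ℤ` and the Lebesgue measure on `ℝ`. -/
abbrev stMeas : Measure (ℤ × ℝ) := (Measure.count : Measure ℤ).prod volume

instance : Measure.IsNegInvariant stMeas := by
  constructor
  have h1 : (Measure.count : Measure ℤ).map Neg.neg = Measure.count :=
    Measure.map_neg_eq_self _
  have h2 : (volume : Measure ℝ).map Neg.neg = volume := Measure.map_neg_eq_self _
  have h := Measure.map_prod_map (Measure.count : Measure ℤ) (volume : Measure ℝ)
    (f := Neg.neg) (g := Neg.neg) measurable_neg measurable_neg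
  rw [h1, h2] at h
  exact h.symm

/-- The convolution of functions on `ℤ × ℝ`. -/
def gcv (F G : ℤ × ℝ → ℝ) (x : ℤ × ℝ) : ℝ := ∫ z, F z * G (x - z) ∂stMeas

/-- Bounded measurable functions. -/
def BM (F : ℤ × ℝ → ℝ) : Prop :=
  AEStronglyMeasurable F stMeas ∧ ∃ M : ℝ, ∀ z, |F z| ≤ M

variable {F G H A : ℤ × ℝ → ℝ} {M ρ : ℝ}

theorem gcv_comm (F G : ℤ × ℝ → ℝ) : gcv F G = gcv G F := by
  ext x
  rw [gcv, ← integral_sub_left_eq_self _ _ x]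
  simp only [sub_sub_cancel, mul_comm]
  rfl

theorem aestronglyMeasurable_gcv_integrand (hF : AEStronglyMeasurable F stMeas)
    (hG : AEStronglyMeasurable G stMeas) (x : ℤ × ℝ) :
    AEStronglyMeasurable (fun z => F z * G (x - z)) stMeas :=
  AEStronglyMeasurable.convolution_integrand_snd (ContinuousLinearMap.mul ℝ ℝ) hF hG x

theorem integrable_gcv_integrand (hF : Integrable F stMeas) (hG : BM G) (x : ℤ × ℝ) :
    Integrable (fun z => F z * G (x - z)) stMeas := by
  obtain ⟨hGm, M, hM⟩ := hG
  refine (hF.abs.mul_const M).mono' (aestronglyMeasurable_gcv_integrand hF.1 hGm x)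
    (Filter.Eventually.of_forall fun z => ?_)
  rw [norm_mul]
  exact mul_le_mul_of_nonneg_left (hM _) (abs_nonneg _)

theorem integral_abs_gcv_integrand_le (hF : Integrable F stMeas) (hG : AEStronglyMeasurable G stMeas)
    (hM : ∀ z, |G z| ≤ M) (x : ℤ × ℝ) :
    ∫ z, |F z * G (x - z)| ∂stMeas ≤ (∫ z, |F z| ∂stMeas) * M := by
  rw [← integral_mul_const]
  refine integral_mono (integrable_gcv_integrand hF ⟨hG, M, hM⟩ x).abs (hF.abs.mul_const M)
    fun z => ?_
  beta_reduce
  rw [abs_mul]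
  exact mul_le_mul_of_nonneg_left (hM _) (abs_nonneg _)

theorem abs_gcv_le (hF : Integrable F stMeas) (hG : AEStronglyMeasurable G stMeas)
    (hM : ∀ z, |G z| ≤ M) (x : ℤ × ℝ) : |gcv F G x| ≤ (∫ z, |F z| ∂stMeas) * M :=
  (abs_integral_le_integral_abs).trans (integral_abs_gcv_integrand_le hF hG hM x)

theorem aestronglyMeasurable_gcv (hF : AEStronglyMeasurable F stMeas)
    (hG : AEStronglyMeasurable G stMeas) : AEStronglyMeasurable (gcv F G) stMeas :=
  (AEStronglyMeasurable.convolution_integrand (ContinuousLinearMap.mul ℝ ℝ) hF hG).integral_prod_right'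

theorem BM.gcv (hF : Integrable F stMeas) (hG : BM G) : BM (gcv F G) := by
  obtain ⟨hGm, M, hM⟩ := hG
  exact ⟨aestronglyMeasurable_gcv hF.1 hGm, _, abs_gcv_le hF hGm hM⟩

theorem BM.abs (hF : BM F) : BM fun z => |F z| := by
  obtain ⟨h, M, hM⟩ := hF
  exact ⟨h.norm, M, fun z => by rw [abs_abs]; exact hM z⟩

theorem BM.add (hF : BM F) (hG : BM G) : BM fun z => F z + G z := by
  obtain ⟨h, M, hM⟩ := hF
  obtain ⟨h', M', hM'⟩ := hG
  exact ⟨h.add h', M + M', fun z => (abs_add_le _ _).trans (add_le_add (hM z) (hM' z))⟩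

theorem BM.sub (hF : BM F) (hG : BM G) : BM fun z => F z - G z := by
  obtain ⟨h, M, hM⟩ := hF
  obtain ⟨h', M', hM'⟩ := hG
  exact ⟨h.sub h', M + M', fun z => (abs_sub _ _).trans (add_le_add (hM z) (hM' z))⟩

theorem gcv_add (hF : Integrable F stMeas) (hG : BM G) (hH : BM H) (x : ℤ × ℝ) :
    gcv F (fun z => G z + H z) x = gcv F G x + gcv F H x := by
  unfold gcv
  rw [← integral_add (integrable_gcv_integrand hF hG x) (integrable_gcv_integrand hF hH x)]
  simp only [mul_add]

theorem gcv_sub (hF : Integrable F stMeas) (hG : BM G) (hH : BM H) (x : ℤ × ℝ) :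
    gcv F (fun z => G z - H z) x = gcv F G x - gcv F H x := by
  unfold gcv
  rw [← integral_sub (integrable_gcv_integrand hF hG x) (integrable_gcv_integrand hF hH x)]
  simp only [mul_sub]

theorem gcv_assoc (hF : Integrable F stMeas) (hG : Integrable G stMeas) (hGb : BM G) (hH : BM H) :
    gcv (gcv F G) H = gcv F (gcv G H) := by
  ext x
  refine convolution_assoc (ContinuousLinearMap.mul ℝ ℝ) (ContinuousLinearMap.mul ℝ ℝ)
    (ContinuousLinearMap.mul ℝ ℝ) (ContinuousLinearMap.mul ℝ ℝ) (fun x y z => mul_assoc x y z)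
    hF.1 hG.1 hH.1 ?_ ?_ ?_
  · exact Filter.Eventually.of_forall fun y => integrable_gcv_integrand hF hGb y
  · exact Filter.Eventually.of_forall fun y => integrable_gcv_integrand hG.norm hH.abs y
  · exact integrable_gcv_integrand hF.norm (BM.gcv hG.norm hH.abs) x

theorem integrable_gcv (hF : Integrable F stMeas) (hG : Integrable G stMeas) :
    Integrable (gcv F G) stMeas :=
  hF.integrable_convolution (ContinuousLinearMap.mul ℝ ℝ) hG

theorem integral_abs_gcv_le (hF : Integrable F stMeas) (hG : Integrable G stMeas) :
    ∫ x, |gcv F G x| ∂stMeas ≤ (∫ z, |F z| ∂stMeas) * ∫ z, |G z| ∂stMeas := by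
  have h : ∫ x, gcv (fun z => |F z|) (fun z => |G z|) x ∂stMeas =
      (∫ z, |F z| ∂stMeas) * ∫ z, |G z| ∂stMeas :=
    integral_convolution (ContinuousLinearMap.mul ℝ ℝ) hF.abs hG.abs
  rw [← h]
  refine integral_mono (integrable_gcv hF hG).abs (integrable_gcv hF.abs hG.abs) fun x => ?_
  refine (abs_integral_le_integral_abs).trans (le_of_eq ?_)
  simp only [abs_mul]
  rfl

/-- Convolutions of series. -/
theorem hasSum_gcv_right {G : ℕ → ℤ × ℝ → ℝ} {b : ℕ → ℝ} (hb : Summable b)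
    (hF : Integrable F stMeas) (hG : ∀ n, AEStronglyMeasurable (G n) stMeas)
    (hGb : ∀ n z, |G n z| ≤ b n) (x : ℤ × ℝ) :
    HasSum (fun n => gcv F (G n) x) (gcv F (fun z => ∑' n, G n z) x) := by
  have h := hasSum_integral_of_summable_integral_norm
    (F := fun n z => F z * G n (x - z)) (μ := stMeas)
    (fun n => integrable_gcv_integrand hF ⟨hG n, b n, hGb n⟩ x)
    (Summable.of_nonneg_of_le (fun n => integral_nonneg fun z => norm_nonneg _)
      (fun n => integral_abs_gcv_integrand_le hF (hG n) (hGb n) x) (hb.mul_left _))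
  simp only [tsum_mul_left] at h
  exact h

theorem hasSum_gcv_left {F : ℕ → ℤ × ℝ → ℝ} (hF : ∀ n, Integrable (F n) stMeas)
    (hFs : Summable fun n => ∫ z, |F n z| ∂stMeas) (hG : BM G) (x : ℤ × ℝ) :
    HasSum (fun n => gcv (F n) G x) (gcv (fun z => ∑' n, F n z) G x) := by
  obtain ⟨hGm, M, hM⟩ := hG
  have h := hasSum_integral_of_summable_integral_norm
    (F := fun n z => F n z * G (x - z)) (μ := stMeas)
    (fun n => integrable_gcv_integrand (hF n) ⟨hGm, M, hM⟩ x)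
    (Summable.of_nonneg_of_le (fun n => integral_nonneg fun z => norm_nonneg _)
      (fun n => integral_abs_gcv_integrand_le (hF n) hGm hM x) (hFs.mul_right _))
  simp only [tsum_mul_right] at h
  exact h

theorem aestronglyMeasurable_tsum {G : ℕ → ℤ × ℝ → ℝ}
    (hG : ∀ n, AEStronglyMeasurable (G n) stMeas) (hs : ∀ z, Summable fun n => G n z) :
    AEStronglyMeasurable (fun z => ∑' n, G n z) stMeas := by
  refine aestronglyMeasurable_of_tendsto_ae Filter.atTop
    (f := fun N z => ∑ n ∈ Finset.range N, G n z) (fun N => ?_)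
    (Filter.Eventually.of_forall fun z => (hs z).hasSum.tendsto_sum_nat)
  exact Finset.aestronglyMeasurable_fun_sum _ fun n _ => hG n

/-! ### The Neumann series -/

/-- Convolution powers; `gpow A n` has `n + 1` factors. -/
def gpow (A : ℤ × ℝ → ℝ) : ℕ → ℤ × ℝ → ℝ
  | 0 => A
  | n + 1 => gcv A (gpow A n)

/-- A bounded function of `L¹` norm at most `ρ`. -/
structure Contr (A : ℤ × ℝ → ℝ) (ρ : ℝ) : Prop where
  int : Integrable A stMeas
  bm : BM A
  norm : ∫ z, |A z| ∂stMeas ≤ ρ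
  lt : ρ < 1

theorem Contr.nonneg (h : Contr A ρ) : 0 ≤ ρ := (integral_nonneg fun _ => abs_nonneg _).trans h.norm

theorem Contr.gpow (h : Contr A ρ) (n : ℕ) :
    Integrable (gpow A n) stMeas ∧ ∫ z, |gpow A n z| ∂stMeas ≤ ρ ^ (n + 1) := by
  induction n with
  | zero => exact ⟨h.int, by simpa [SemiDiscrete.gpow] using h.norm⟩
  | succ n ih =>
    refine ⟨integrable_gcv h.int ih.1, (integral_abs_gcv_le h.int ih.1).trans ?_⟩
    rw [pow_succ' ρ (n + 1)]
    exact mul_le_mul h.norm ih.2 (integral_nonneg fun _ => abs_nonneg _) h.nonneg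

theorem Contr.gpow_bm (h : Contr A ρ) (n : ℕ) : BM (SemiDiscrete.gpow A n) := by
  induction n with
  | zero => exact h.bm
  | succ n ih => exact ih.gcv h.int

theorem Contr.abs_gpow_le (h : Contr A ρ) (hM : ∀ z, |A z| ≤ M) (n : ℕ) (z : ℤ × ℝ) :
    |SemiDiscrete.gpow A n z| ≤ ρ ^ n * M := by
  induction n generalizing z with
  | zero => simpa [SemiDiscrete.gpow] using hM z
  | succ n ih =>
    have h0 : 0 ≤ ρ ^ n * M := (abs_nonneg _).trans (ih z)
    refine (abs_gcv_le h.int (h.gpow_bm n).1 ih z).trans ?_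
    rw [pow_succ', mul_assoc]
    exact mul_le_mul_of_nonneg_right h.norm h0

theorem Contr.summable_pow (h : Contr A ρ) : Summable fun n : ℕ => ρ ^ n :=
  summable_geometric_of_lt_one h.nonneg h.lt

theorem Contr.summable_gpow (h : Contr A ρ) (z : ℤ × ℝ) :
    Summable fun n => SemiDiscrete.gpow A n z := by
  obtain ⟨M, hM⟩ := h.bm.2
  exact Summable.of_norm_bounded (h.summable_pow.mul_right M) fun n => h.abs_gpow_le hM n z

theorem Contr.abs_gcv_gpow_le (h : Contr A ρ) (hF : AEStronglyMeasurable F stMeas)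
    (hM : ∀ z, |F z| ≤ M) (n : ℕ) (z : ℤ × ℝ) : |gcv (SemiDiscrete.gpow A n) F z| ≤ ρ ^ n * M := by
  have hM0 : 0 ≤ M := (abs_nonneg _).trans (hM z)
  refine (abs_gcv_le (h.gpow n).1 hF hM z).trans ?_
  refine mul_le_mul_of_nonneg_right ((h.gpow n).2.trans ?_) hM0
  exact pow_le_pow_of_le_one h.nonneg h.lt.le (Nat.le_succ n)

theorem Contr.summable_gcv_gpow (h : Contr A ρ) (hF : BM F) (z : ℤ × ℝ) :
    Summable fun n => gcv (SemiDiscrete.gpow A n) F z := by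
  obtain ⟨hFm, M, hM⟩ := hF
  exact Summable.of_norm_bounded (h.summable_pow.mul_right M) fun n => h.abs_gcv_gpow_le hFm hM n z

/-- The sum of the convolution powers. -/
def gsum (A : ℤ × ℝ → ℝ) (z : ℤ × ℝ) : ℝ := ∑' n, gpow A n z

theorem Contr.summable_integral_gpow (h : Contr A ρ) :
    Summable fun n => ∫ z, |SemiDiscrete.gpow A n z| ∂stMeas :=
  Summable.of_nonneg_of_le (fun _ => integral_nonneg fun _ => abs_nonneg _)
    (fun n => (h.gpow n).2) ((summable_nat_add_iff 1).2 h.summable_pow)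

theorem Contr.hasSum_gcv_gpow (h : Contr A ρ) (hF : BM F) (z : ℤ × ℝ) :
    HasSum (fun n => gcv (SemiDiscrete.gpow A n) F z) (gcv (gsum A) F z) :=
  hasSum_gcv_left (fun n => (h.gpow n).1) h.summable_integral_gpow hF z

theorem Contr.gsum_bm (h : Contr A ρ) : BM (gsum A) := by
  refine ⟨aestronglyMeasurable_tsum (fun n => (h.gpow n).1.1) h.summable_gpow, ?_⟩
  obtain ⟨M, hM⟩ := h.bm.2
  exact ⟨∑' n, ρ ^ n * M, fun z => tsum_of_norm_bounded
    (f := fun n => SemiDiscrete.gpow A n z) (h.summable_pow.mul_right M).hasSum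
    fun n => h.abs_gpow_le hM n z⟩

theorem Contr.lintegral_gsum_le (h : Contr A ρ) :
    ∫⁻ z, ‖gsum A z‖ₑ ∂stMeas ≤ ENNReal.ofReal (ρ / (1 - ρ)) := by
  have hg : HasSum (fun n => ρ ^ (n + 1)) (ρ / (1 - ρ)) := by
    have := (hasSum_geometric_of_lt_one h.nonneg h.lt).mul_left ρ
    simpa only [pow_succ', div_eq_mul_inv] using this
  have e : ∀ n, ∫⁻ z, ‖SemiDiscrete.gpow A n z‖ₑ ∂stMeas =
      ENNReal.ofReal (∫ z, |SemiDiscrete.gpow A n z| ∂stMeas) := fun n =>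
    (ofReal_integral_norm_eq_lintegral_enorm (h.gpow n).1).symm
  calc _ ≤ ∫⁻ z, ∑' n, ‖SemiDiscrete.gpow A n z‖ₑ ∂stMeas :=
        lintegral_mono fun z => enorm_tsum_le_tsum_enorm
    _ = ∑' n, ENNReal.ofReal (∫ z, |SemiDiscrete.gpow A n z| ∂stMeas) := by
        rw [lintegral_tsum fun n => (h.gpow n).1.1.enorm]
        simp only [e]
    _ ≤ ∑' n, ENNReal.ofReal (ρ ^ (n + 1)) :=
        ENNReal.tsum_le_tsum fun n => ENNReal.ofReal_le_ofReal (h.gpow n).2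
    _ = _ := by
        rw [← hg.tsum_eq, ENNReal.ofReal_tsum_of_nonneg (fun n => pow_nonneg h.nonneg _) hg.summable]

theorem Contr.gsum_integrable (h : Contr A ρ) : Integrable (gsum A) stMeas :=
  ⟨h.gsum_bm.1, h.lintegral_gsum_le.trans_lt ENNReal.ofReal_lt_top⟩

theorem Contr.integral_abs_gsum_le (h : Contr A ρ) : ∫ z, |gsum A z| ∂stMeas ≤ ρ / (1 - ρ) := by
  have h1 := h.lintegral_gsum_le
  rw [← ofReal_integral_norm_eq_lintegral_enorm h.gsum_integrable] at h1
  exact (ENNReal.ofReal_le_ofReal_iff (div_nonneg h.nonneg (sub_nonneg.2 h.lt.le))).1 h1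

theorem Contr.gcv_gcv_gpow (h : Contr A ρ) (hF : BM F) (n : ℕ) :
    gcv A (gcv (SemiDiscrete.gpow A n) F) = gcv (SemiDiscrete.gpow A (n + 1)) F :=
  (gcv_assoc h.int (h.gpow n).1 (h.gpow_bm n) hF).symm

theorem Contr.gcv_gsum_eq (h : Contr A ρ) (hF : BM F) (z : ℤ × ℝ) :
    gcv (gsum A) F z = gcv A F z + gcv A (gcv (gsum A) F) z := by
  obtain ⟨hFm, M, hM⟩ := hF
  have h1 := hasSum_gcv_right (h.summable_pow.mul_right M) h.int
    (fun n => aestronglyMeasurable_gcv (h.gpow n).1.1 hFm) (h.abs_gcv_gpow_le hFm hM) z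
  have h2 : (fun z => ∑' n, gcv (SemiDiscrete.gpow A n) F z) = gcv (gsum A) F := by
    ext z
    exact (h.hasSum_gcv_gpow ⟨hFm, M, hM⟩ z).tsum_eq
  rw [h2] at h1
  simp only [h.gcv_gcv_gpow ⟨hFm, M, hM⟩] at h1
  exact (h.hasSum_gcv_gpow ⟨hFm, M, hM⟩ z).unique
    (((hasSum_nat_add_iff' (f := fun n => gcv (SemiDiscrete.gpow A n) F z) 1).1 (by
      simpa [SemiDiscrete.gpow] using h1)))

/-- Commutativity of the convolution; it makes the right inverse of Id - A a left inverse too. -/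
theorem Contr.gcv_gsum_gcv (h : Contr A ρ) (hF : BM F) (z : ℤ × ℝ) :
    gcv (gsum A) (gcv A F) z = gcv A (gcv (gsum A) F) z := by
  rw [← gcv_assoc h.gsum_integrable h.int h.bm hF, gcv_comm (gsum A) A,
    gcv_assoc h.int h.gsum_integrable h.gsum_bm hF]

theorem Contr.gsum_eq (h : Contr A ρ) (z : ℤ × ℝ) : gsum A z = A z + gcv A (gsum A) z := by
  obtain ⟨M, hM⟩ := h.bm.2
  have h1 := hasSum_gcv_right (h.summable_pow.mul_right M) h.int
    (fun n => (h.gpow n).1.1) (h.abs_gpow_le hM) z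
  rw [gsum, (h.summable_gpow z).tsum_eq_zero_add]
  congr 1
  exact h1.tsum_eq

/-- Uniqueness of bounded solutions: each use of the equation gains a factor ρ < 1 in the pointwise
bound. -/
theorem Contr.eq_zero_of_eq_gcv (h : Contr A ρ) (hF : BM F) (hfix : ∀ z, F z = gcv A F z)
    (z : ℤ × ℝ) : F z = 0 := by
  obtain ⟨hFm, M, hM⟩ := hF
  have hn : ∀ (n : ℕ) z, |F z| ≤ ρ ^ n * M := by
    intro n
    induction n with
    | zero => simpa using hM
    | succ n ih =>
      intro z
      have h0 : 0 ≤ ρ ^ n * M := (abs_nonneg _).trans (ih z)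
      rw [hfix, pow_succ', mul_assoc]
      exact (abs_gcv_le h.int hFm ih z).trans (mul_le_mul_of_nonneg_right h.norm h0)
  have ht : Filter.Tendsto (fun n : ℕ => ρ ^ n * M) Filter.atTop (nhds 0) := by
    simpa using (tendsto_pow_atTop_nhds_zero_of_lt_one h.nonneg h.lt).mul_const M
  exact abs_nonpos_iff.1 (ge_of_tendsto' ht fun n => hn n z)

end SemiDiscrete

end

noncomputable section

namespace SemiDiscrete

/-! ### Zero extension to negative times -/

/-- The extension by zero to negative times. -/
def zext (f : ℝ → ℤ → ℝ) (z : ℤ × ℝ) : ℝ := if 0 ≤ z.2 then f z.2 z.1 else 0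

variable {f u a : ℝ → ℤ → ℝ}

theorem zext_of_nonneg {t : ℝ} (ht : 0 ≤ t) (k : ℤ) : zext f (k, t) = f t k := if_pos ht

theorem zext_of_neg {t : ℝ} (ht : t < 0) (k : ℤ) : zext f (k, t) = 0 := if_neg ht.not_ge

theorem aestronglyMeasurable_stMeas_iff {F : ℤ × ℝ → ℝ} :
    AEStronglyMeasurable F stMeas ↔ ∀ k, AEStronglyMeasurable (fun s => F (k, s)) volume := by
  rw [stMeas, Measure.count, Measure.prod_sum_left, aestronglyMeasurable_sum_measure_iff]
  refine forall_congr' fun k => ?_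
  rw [Measure.dirac_prod]
  exact (MeasurableEmbedding.prodMk_left k MeasurableEmbedding.id).aestronglyMeasurable_map_iff

theorem aestronglyMeasurable_zext_iff : AEStronglyMeasurable (zext f) stMeas ↔
    ∀ k, AEStronglyMeasurable (fun t => f t k) (volume.restrict (Ici 0)) := by
  rw [aestronglyMeasurable_stMeas_iff]
  refine forall_congr' fun k => ?_
  rw [← aestronglyMeasurable_indicator_iff measurableSet_Ici]
  rfl

theorem isBoundedMeas_iff : IsBoundedMeas f ↔ BM (zext f) := by
  constructor
  · rintro ⟨h1, M, hM⟩
    refine ⟨aestronglyMeasurable_zext_iff.2 h1, |M|, fun z => ?_⟩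
    unfold zext
    split_ifs with h
    · exact (hM _ h _).trans (le_abs_self M)
    · simp
  · rintro ⟨h1, M, hM⟩
    refine ⟨aestronglyMeasurable_zext_iff.1 h1, M, fun t ht k => ?_⟩
    have := hM (k, t)
    rwa [zext_of_nonneg ht] at this

theorem lintegral_zext (h : AEStronglyMeasurable (zext f) stMeas) :
    ∫⁻ z, ‖zext f z‖ₑ ∂stMeas = ∫⁻ t in Ici (0 : ℝ), ∑' k : ℤ, ‖f t k‖ₑ := by
  rw [lintegral_prod_symm _ h.enorm, ← lintegral_indicator measurableSet_Ici]
  refine lintegral_congr fun t => ?_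
  rw [lintegral_count]
  by_cases ht : 0 ≤ t
  · rw [indicator_of_mem (mem_Ici.2 ht)]
    simp only [zext_of_nonneg ht]
  · rw [indicator_of_notMem (by simpa using ht)]
    simp [zext_of_neg (not_le.1 ht)]

/-- The product of the zero extensions is supported in times 0 ≤ s ≤ t. Convolution in positive time
is thus a convolution on a commutative group, with its associativity and commutativity. -/
theorem zext_conv (hf : Integrable (zext f) stMeas) (hu : BM (zext u)) :
    zext (conv 1 f u) = gcv (zext f) (zext u) := by
  rw [gcv_comm]
  ext ⟨k, t⟩
  by_cases ht : 0 ≤ t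
  swap
  · rw [zext_of_neg (not_le.1 ht), gcv, integral_eq_zero_of_ae]
    refine Filter.Eventually.of_forall fun z => ?_
    simp only [Pi.zero_apply]
    unfold zext
    split_ifs with h1 h2
    · exact absurd (h1.trans (sub_nonneg.1 h2)) ht
    all_goals simp
  have hint : Integrable (fun z => zext u z * zext f ((k, t) - z)) stMeas := by
    have := (integrable_gcv_integrand hf hu (k, t)).comp_sub_left (k, t)
    simpa only [sub_sub_cancel, mul_comm] using this
  rw [zext_of_nonneg ht, gcv, integral_prod_symm _ hint]
  have h1 : ∀ᵐ s : ℝ, ∫ l : ℤ, zext u (l, s) * zext f ((k, t) - (l, s)) ∂Measure.count =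
      (Icc 0 t).indicator (fun s => ∑' l : ℤ, f (t - s) (k - l) * u s l) s := by
    filter_upwards [hint.prod_left_ae] with s hs
    rw [integral_countable hs]
    simp only [Measure.real, Measure.count_singleton, ENNReal.toReal_one, one_smul]
    by_cases hst : s ∈ Icc 0 t
    · rw [indicator_of_mem hst]
      refine tsum_congr fun l => ?_
      rw [zext_of_nonneg hst.1, Prod.mk_sub_mk, zext_of_nonneg (sub_nonneg.2 hst.2), mul_comm]
    · rw [indicator_of_notMem hst]
      have : ∀ l : ℤ, zext u (l, s) * zext f ((k, t) - (l, s)) = 0 := by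
        intro l
        rw [Prod.mk_sub_mk]
        by_cases h0 : 0 ≤ s
        · rw [zext_of_neg (f := f) (by
            by_contra h
            exact hst ⟨h0, by linarith⟩), mul_zero]
        · rw [zext_of_neg (not_le.1 h0), zero_mul]
      simp only [this, tsum_zero]
  rw [integral_congr_ae h1, integral_indicator measurableSet_Icc, conv,
    intervalIntegral.integral_of_le ht, integral_Icc_eq_integral_Ioc]
  simp only [one_mul]

theorem conv_eq_gcv (hf : Integrable (zext f) stMeas) (hu : BM (zext u)) {t : ℝ} (ht : 0 ≤ t)
    (k : ℤ) : conv 1 f u t k = gcv (zext f) (zext u) (k, t) := by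
  rw [← zext_conv hf hu, zext_of_nonneg ht]

theorem conv_eq_mul (ε : ℝ) (f u : ℝ → ℤ → ℝ) (t : ℝ) (k : ℤ) :
    conv ε f u t k = ε * conv 1 f u t k := by
  simp only [conv, one_mul, intervalIntegral.integral_const_mul]

theorem conv_mul_mul (c d : ℝ) (f u : ℝ → ℤ → ℝ) (t : ℝ) (k : ℤ) :
    conv 1 (fun t k => c * f t k) (fun t k => d * u t k) t k = c * d * conv 1 f u t k := by
  simp only [conv, one_mul]
  rw [← intervalIntegral.integral_const_mul]
  congr 1
  ext s
  rw [← tsum_mul_left]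
  refine tsum_congr fun l => ?_
  ring

theorem conv_scale {σ : ℝ} (hσ : 0 < σ) (f u : ℝ → ℤ → ℝ) (t : ℝ) (k : ℤ) :
    conv 1 (fun t k => f (t / σ) k) (fun t k => u (t / σ) k) t k = σ * conv 1 f u (t / σ) k := by
  simp only [conv, one_mul, sub_div]
  rw [intervalIntegral.integral_comp_div
    (fun s => ∑' l : ℤ, f (t / σ - s) (k - l) * u s l) hσ.ne', zero_div, smul_eq_mul]

/-! ### Convolution powers and their sum -/

/-- Convolution powers; `cpow a n` has `n + 1` factors. -/
def cpow (a : ℝ → ℤ → ℝ) : ℕ → ℝ → ℤ → ℝ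
  | 0 => a
  | n + 1 => conv 1 a (cpow a n)

/-- The sum of the convolution powers. -/
def csum (a : ℝ → ℤ → ℝ) (t : ℝ) (k : ℤ) : ℝ := ∑' n, cpow a n t k

/-- The sum of the convolutions of a function with the powers of a kernel. -/
def cneu (a f : ℝ → ℤ → ℝ) (t : ℝ) (k : ℤ) : ℝ := ∑' n, conv 1 (cpow a n) f t k

variable {ρ : ℝ}

theorem zext_cpow (h : Contr (zext a) ρ) (n : ℕ) : zext (cpow a n) = gpow (zext a) n := by
  induction n with
  | zero => rfl
  | succ n ih =>
    rw [cpow, zext_conv h.int (by rw [ih]; exact h.gpow_bm n), ih, gpow]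

theorem cpow_eq (h : Contr (zext a) ρ) (n : ℕ) {t : ℝ} (ht : 0 ≤ t) (k : ℤ) :
    cpow a n t k = gpow (zext a) n (k, t) := by
  rw [← zext_cpow h, zext_of_nonneg ht]

theorem zext_csum (h : Contr (zext a) ρ) : zext (csum a) = gsum (zext a) := by
  ext ⟨k, t⟩
  unfold gsum
  by_cases ht : 0 ≤ t
  · rw [zext_of_nonneg ht, csum]
    simp only [cpow_eq h _ ht]
  · rw [zext_of_neg (not_le.1 ht)]
    simp only [← zext_cpow h, zext_of_neg (not_le.1 ht), tsum_zero]

theorem conv_cpow_eq (h : Contr (zext a) ρ) (hf : BM (zext f)) (n : ℕ) {t : ℝ} (ht : 0 ≤ t)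
    (k : ℤ) : conv 1 (cpow a n) f t k = gcv (gpow (zext a) n) (zext f) (k, t) := by
  rw [conv_eq_gcv (by rw [zext_cpow h]; exact (h.gpow n).1) hf ht, zext_cpow h]

theorem cneu_eq (h : Contr (zext a) ρ) (hf : BM (zext f)) {t : ℝ} (ht : 0 ≤ t)
    (k : ℤ) : cneu a f t k = gcv (gsum (zext a)) (zext f) (k, t) := by
  unfold cneu
  simp only [conv_cpow_eq h hf _ ht]
  exact (h.hasSum_gcv_gpow hf _).tsum_eq

theorem cneu_eq_conv (h : Contr (zext a) ρ) (hf : BM (zext f)) {t : ℝ} (ht : 0 ≤ t)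
    (k : ℤ) : cneu a f t k = conv 1 (csum a) f t k := by
  rw [cneu_eq h hf ht, ← zext_csum h,
    ← conv_eq_gcv (by rw [zext_csum h]; exact h.gsum_integrable) hf ht]

theorem zext_cneu (h : Contr (zext a) ρ) (hf : BM (zext f)) :
    zext (cneu a f) = gcv (gsum (zext a)) (zext f) := by
  rw [← zext_csum h, ← zext_conv (by rw [zext_csum h]; exact h.gsum_integrable) hf]
  ext ⟨k, t⟩
  by_cases ht : 0 ≤ t
  · rw [zext_of_nonneg ht, zext_of_nonneg ht, cneu_eq_conv h hf ht]
  · rw [zext_of_neg (not_le.1 ht), zext_of_neg (not_le.1 ht)]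

theorem contr_zext (hc : SCont a) (hb : SupBd a) (h : L1Bd a ρ) (hρ : ρ < 1) :
    Contr (zext a) ρ := by
  obtain ⟨M, hM⟩ := hb
  have hbm : BM (zext a) := isBoundedMeas_iff.1
    ⟨fun k => (hc k).aestronglyMeasurable measurableSet_Ici, M, hM⟩
  have hl : ∫⁻ z, ‖zext a z‖ₑ ∂stMeas ≤ ENNReal.ofReal ρ := by
    rw [lintegral_zext hbm.1]
    exact lintegral_tsum_le_of_l1Bd hc h
  have hint : Integrable (zext a) stMeas := ⟨hbm.1, hl.trans_lt ENNReal.ofReal_lt_top⟩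
  refine ⟨hint, hbm, ?_, hρ⟩
  rw [← ofReal_integral_norm_eq_lintegral_enorm hint] at hl
  exact (ENNReal.ofReal_le_ofReal_iff h.nonneg).1 hl

/-! ### The operators at a general scale -/

theorem heatKernel_scale {ε : ℝ} (hε : 0 < ε) (t : ℝ) (k : ℤ) :
    heatKernel ε t k = ε⁻¹ * heatKernel 1 (t / ε ^ 2) k := by
  unfold heatKernel
  have h := intervalIntegral.integral_comp_mul_left (a := -(1 / (2 * ε))) (b := 1 / (2 * ε))
    (fun ω => Real.exp (-symbol 1 ω * (t / ε ^ 2)) * Real.cos (2 * Real.pi * ω * (1 * (k : ℝ))))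
    hε.ne'
  have e : ε * (1 / (2 * ε)) = 1 / (2 * 1) := by field_simp
  rw [mul_neg, e, smul_eq_mul] at h
  rw [← h]
  congr 1
  ext ω
  congr 2
  · simp only [symbol, one_pow, inv_one, one_mul, mul_one]
    rw [show 2 * Real.pi * ε * ω = 2 * Real.pi * (ε * ω) by ring]
    field_simp
  · ring

theorem qKernel_scale {ε : ℝ} (hε : 0 < ε) (t : ℝ) (k : ℤ) :
    qKernel ε t k = (ε ^ 4)⁻¹ * qKernel 1 (t / ε ^ 2) k := by
  have e := heatKernel_scale hε t
  simp only [qKernel, gradMinus, gradPlus, e, inv_one, one_mul]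
  field_simp

/-- The kernel of `Id - 𝒬^ε`, with respect to the convolution at scale one. -/
def aKernel (ε lam : ℝ) (t : ℝ) (k : ℤ) : ℝ := -(lam * ε ^ 2) * qKernel ε t k

/-- The prefactor ε⁻² compensates the dilation of time, so the L¹ norm is independent of ε and the
convolution powers scale in the same way. -/
theorem aKernel_scale {ε : ℝ} (hε : 0 < ε) (lam : ℝ) (t : ℝ) (k : ℤ) :
    aKernel ε lam t k = (ε ^ 2)⁻¹ * aKernel 1 lam (t / ε ^ 2) k := by
  rw [aKernel, aKernel, qKernel_scale hε]
  field_simp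

theorem cpow_aKernel_scale {ε : ℝ} (hε : 0 < ε) (lam : ℝ) (n : ℕ) (t : ℝ) (k : ℤ) :
    cpow (aKernel ε lam) n t k = (ε ^ 2)⁻¹ * cpow (aKernel 1 lam) n (t / ε ^ 2) k := by
  induction n generalizing t k with
  | zero => exact aKernel_scale hε lam t k
  | succ n ih =>
    have e1 : aKernel ε lam = fun t k => (ε ^ 2)⁻¹ * aKernel 1 lam (t / ε ^ 2) k := by
      ext t k; exact aKernel_scale hε lam t k
    have e2 : cpow (aKernel ε lam) n =
      fun t k => (ε ^ 2)⁻¹ * cpow (aKernel 1 lam) n (t / ε ^ 2) k := by ext t k; exact ih t k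
    rw [cpow, cpow, e2, e1, conv_mul_mul (ε ^ 2)⁻¹ (ε ^ 2)⁻¹ (fun t k => aKernel 1 lam (t / ε ^ 2) k)
      (fun t k => cpow (aKernel 1 lam) n (t / ε ^ 2) k), conv_scale (by positivity)]
    field_simp

theorem cpow_aKernel (ε : ℝ) (n : ℕ) (t : ℝ) (k : ℤ) : cpow (aKernel ε (1 + √ε)) n t k =
    ε * ((-ε) ^ (n + 1) * (1 + √ε) ^ (n + 1)) * qPower ε n t k := by
  induction n generalizing t k with
  | zero => simp only [cpow, aKernel, qPower]; ring
  | succ n ih =>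
    have e2 : cpow (aKernel ε (1 + √ε)) n =
      fun t k => ε * ((-ε) ^ (n + 1) * (1 + √ε) ^ (n + 1)) * qPower ε n t k := by
      ext t k; exact ih t k
    rw [cpow, e2, qPower, conv_eq_mul ε]
    unfold aKernel
    rw [conv_mul_mul]
    ring

theorem conv_cpow_aKernel (ε : ℝ) (n : ℕ) (f : ℝ → ℤ → ℝ) (t : ℝ) (k : ℤ) :
    (-ε) ^ (n + 1) * (1 + √ε) ^ (n + 1) * conv ε (qPower ε n) f t k =
      conv 1 (cpow (aKernel ε (1 + √ε)) n) f t k := by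
  have e2 : cpow (aKernel ε (1 + √ε)) n =
    fun t k => ε * ((-ε) ^ (n + 1) * (1 + √ε) ^ (n + 1)) * qPower ε n t k := by
    ext t k; exact cpow_aKernel ε n t k
  have := conv_mul_mul (ε * ((-ε) ^ (n + 1) * (1 + √ε) ^ (n + 1))) 1 (qPower ε n) f t k
  simp only [one_mul] at this
  rw [e2, this, conv_eq_mul ε]
  ring

theorem qOpInv_eq (ε : ℝ) (f : ℝ → ℤ → ℝ) (t : ℝ) (k : ℤ) :
    qOpInv ε f t k = f t k + cneu (aKernel ε (1 + √ε)) f t k := by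
  simp only [qOpInv, cneu, conv_cpow_aKernel]

theorem qOp_eq (ε : ℝ) (f : ℝ → ℤ → ℝ) (t : ℝ) (k : ℤ) :
    qOp ε f t k = f t k - conv 1 (aKernel ε (1 + √ε)) f t k := by
  have := conv_mul_mul (-((1 + √ε) * ε ^ 2)) 1 (qKernel ε) f t k
  simp only [one_mul] at this
  unfold aKernel
  rw [this, qOp, conv_eq_mul ε]
  ring

/-- The factor ε⁻¹ accounts for the weight ε of a lattice point in `conv ε`, absent from `conv 1`.
-/
theorem sKernel_eq {ε : ℝ} (hε : 0 < ε) (t : ℝ) (k : ℤ) :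
    sKernel ε t k = ε⁻¹ * csum (aKernel ε (1 + √ε)) t k := by
  simp only [sKernel, csum, cpow_aKernel]
  rw [← tsum_mul_left]
  refine tsum_congr fun n => ?_
  field_simp

theorem sKernel_scale {ε : ℝ} (hε : 0 < ε) (t : ℝ) (k : ℤ) :
    sKernel ε t k = (ε ^ 3)⁻¹ * csum (aKernel 1 (1 + √ε)) (t / ε ^ 2) k := by
  rw [sKernel_eq hε, csum, csum]
  simp only [cpow_aKernel_scale hε]
  rw [tsum_mul_left]
  field_simp

theorem modHeatKernel_sub_scale {ε : ℝ} (hε : 0 < ε) (t : ℝ) (k : ℤ) :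
    modHeatKernel ε t k - heatKernel ε t k =
      ε⁻¹ * cneu (aKernel 1 (1 + √ε)) (heatKernel 1) (t / ε ^ 2) k := by
  rw [modHeatKernel, qOpInv_eq, add_sub_cancel_left, cneu, cneu, ← tsum_mul_left]
  refine tsum_congr fun n => ?_
  have e1 : cpow (aKernel ε (1 + √ε)) n =
    fun t k => (ε ^ 2)⁻¹ * cpow (aKernel 1 (1 + √ε)) n (t / ε ^ 2) k := by
    ext t k; exact cpow_aKernel_scale hε _ n t k
  have e2 : heatKernel ε = fun t k => ε⁻¹ * heatKernel 1 (t / ε ^ 2) k := by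
    ext t k; exact heatKernel_scale hε t k
  rw [e1, e2, conv_mul_mul (ε ^ 2)⁻¹ ε⁻¹ (fun t k => cpow (aKernel 1 (1 + √ε)) n (t / ε ^ 2) k)
    (fun t k => heatKernel 1 (t / ε ^ 2) k), conv_scale (by positivity)]
  field_simp

theorem L1Bd.scale {C : ℝ} (h : L1Bd f C) (c : ℝ) {σ : ℝ} (hσ : 0 < σ) :
    L1Bd (fun t k => c * f (t / σ) k) (|c| * σ * C) := by
  intro T hT s
  have e : ∀ l, ∫ r in (0 : ℝ)..T, |c * f (r / σ) l| =
      |c| * σ * ∫ r in (0 : ℝ)..T / σ, |f r l| := by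
    intro l
    simp only [abs_mul]
    rw [intervalIntegral.integral_const_mul,
      intervalIntegral.integral_comp_div (fun r => |f r l|) hσ.ne', zero_div, smul_eq_mul, mul_assoc]
  simp only [e]
  rw [← Finset.mul_sum]
  gcongr
  exact h (T / σ) (by positivity) s

theorem SCont.scale (h : SCont f) (c : ℝ) {σ : ℝ} (hσ : 0 < σ) :
    SCont (fun t k => c * f (t / σ) k) := fun k =>
  continuousOn_const.mul ((h k).comp (by fun_prop) fun t ht => div_nonneg (mem_Ici.1 ht) hσ.le)

theorem SupBd.scale (h : SupBd f) (c : ℝ) {σ : ℝ} (hσ : 0 < σ) :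
    SupBd (fun t k => c * f (t / σ) k) := by
  obtain ⟨M, hM⟩ := h
  refine ⟨|c| * M, fun t ht k => ?_⟩
  rw [abs_mul]
  exact mul_le_mul_of_nonneg_left (hM _ (by positivity) k) (abs_nonneg c)

theorem qKernel_one_eq : qKernel 1 = qT 0 := by
  ext t k; exact (qT_zero t k).symm

theorem qKernel_eq {ε : ℝ} (hε : 0 < ε) :
    qKernel ε = fun t k => (ε ^ 4)⁻¹ * qT 0 (t / ε ^ 2) k := by
  ext t k
  rw [qKernel_scale hε, qKernel_one_eq]

theorem supBd_qT : SupBd (qT 0) := (dec_qT.sumBd (by norm_num) 0).supBd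

theorem lintegral_qKernel_le {Θ : ℝ} (h : L1Bd (qT 0) Θ) {ε : ℝ} (hε : 0 < ε) :
    ∫⁻ t in Ici (0 : ℝ), ENNReal.ofReal ε * ∑' k : ℤ, ‖qKernel ε t k‖ₑ
      ≤ ENNReal.ofReal (Θ / ε) := by
  have hσ : 0 < ε ^ 2 := by positivity
  rw [lintegral_const_mul' _ _ ENNReal.ofReal_ne_top, qKernel_eq hε]
  refine (mul_le_mul_right (lintegral_tsum_le_of_l1Bd ((tower_qT.sCont 0).scale _ hσ)
    (h.scale _ hσ)) _).trans (le_of_eq ?_)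
  rw [← ENNReal.ofReal_mul hε.le, abs_of_nonneg (by positivity)]
  congr 1
  field_simp

theorem contr_aKernel {Θ : ℝ} (h : L1Bd (qT 0) Θ) {ε lam ρ : ℝ} (hε : 0 < ε) (hl : 0 ≤ lam)
    (hρ : lam * Θ ≤ ρ) (hρ1 : ρ < 1) : Contr (zext (aKernel ε lam)) ρ := by
  have hσ : 0 < ε ^ 2 := by positivity
  have e : aKernel ε lam = fun t k => (-(lam * (ε ^ 2)⁻¹)) * qT 0 (t / ε ^ 2) k := by
    ext t k
    rw [aKernel, qKernel_eq hε]
    field_simp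
  rw [e]
  refine contr_zext ((tower_qT.sCont 0).scale _ hσ) (supBd_qT.scale _ hσ) ?_ hρ1
  intro T hT s
  refine (h.scale _ hσ T hT s).trans (le_trans (le_of_eq ?_) hρ)
  rw [abs_neg, abs_of_nonneg (by positivity)]
  field_simp

theorem zext_sub_conv (h : Contr (zext a) ρ) (hf : BM (zext f)) {g : ℝ → ℤ → ℝ}
    (hg : ∀ t k, g t k = f t k - conv 1 a f t k) :
    zext g = fun z => zext f z - gcv (zext a) (zext f) z := by
  ext ⟨k, t⟩
  rw [← zext_conv h.int hf]
  by_cases ht : 0 ≤ t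
  · simp only [zext_of_nonneg ht, hg]
  · simp only [zext_of_neg (not_le.1 ht), sub_zero]

theorem zext_add_cneu (h : Contr (zext a) ρ) (hf : BM (zext f)) {g : ℝ → ℤ → ℝ}
    (hg : ∀ t k, g t k = f t k + cneu a f t k) :
    zext g = fun z => zext f z + gcv (gsum (zext a)) (zext f) z := by
  ext ⟨k, t⟩
  rw [← zext_cneu h hf]
  by_cases ht : 0 ≤ t
  · simp only [zext_of_nonneg ht, hg]
  · simp only [zext_of_neg (not_le.1 ht), add_zero]

/-- In the convolution algebra 𝒬^ε is Id - A and the Neumann series is Id + S. The right inverse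
property is S = A + A ⋆ S, acting on bounded functions, and the left one follows from A ⋆ S = S ⋆ A.
-/
theorem isInverseWithKernel {ε : ℝ} (hε : 0 < ε) (h : Contr (zext (aKernel ε (1 + √ε))) ρ) :
    IsInverseWithKernel ε (sKernel ε) := by
  have hop : ∀ f, BM (zext f) → zext (qOp ε f) =
      fun z => zext f z - gcv (zext (aKernel ε (1 + √ε))) (zext f) z :=
    fun f hf => zext_sub_conv h hf (qOp_eq ε f)
  have hinv : ∀ f, BM (zext f) → zext (qOpInv ε f) =
      fun z => zext f z + gcv (gsum (zext (aKernel ε (1 + √ε)))) (zext f) z :=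
    fun f hf => zext_add_cneu h hf (qOpInv_eq ε f)
  have hop' : ∀ f, BM (zext f) → BM (zext (qOp ε f)) := fun f hf => by
    rw [hop f hf]
    exact hf.sub (hf.gcv h.int)
  have hinv' : ∀ f, BM (zext f) → BM (zext (qOpInv ε f)) := fun f hf => by
    rw [hinv f hf]
    exact hf.add (hf.gcv h.gsum_integrable)
  refine ⟨fun f hf t ht k => ?_, fun f hf => isBoundedMeas_iff.2 (hop' f (isBoundedMeas_iff.1 hf)),
    fun f hf => isBoundedMeas_iff.2 (hinv' f (isBoundedMeas_iff.1 hf)), fun f hf t ht k => ?_,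
    fun f hf t ht k => ?_, ?_, fun f hf t ht k => ?_⟩
  · have hf' := isBoundedMeas_iff.1 hf
    simp only [conv_cpow_aKernel, conv_cpow_eq h hf' _ ht]
    exact h.summable_gcv_gpow hf' _
  · have hf' := isBoundedMeas_iff.1 hf
    have hS := hf'.gcv h.gsum_integrable
    rw [← zext_of_nonneg (f := qOp ε (qOpInv ε f)) ht, hop _ (hinv' f hf'), hinv f hf']
    beta_reduce
    rw [gcv_add h.int hf' hS, h.gcv_gsum_eq hf' (k, t), zext_of_nonneg ht]
    ring
  · have hf' := isBoundedMeas_iff.1 hf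
    have hA := hf'.gcv h.int
    rw [← zext_of_nonneg (f := qOpInv ε (qOp ε f)) ht, hinv _ (hop' f hf'), hop f hf']
    beta_reduce
    rw [gcv_sub h.gsum_integrable hf' hA, h.gcv_gsum_gcv hf', h.gcv_gsum_eq hf' (k, t),
      zext_of_nonneg ht]
    ring
  · have e : ∀ t, ENNReal.ofReal ε * ∑' k : ℤ, ‖sKernel ε t k‖ₑ =
        ∑' k : ℤ, ‖csum (aKernel ε (1 + √ε)) t k‖ₑ := by
      intro t
      rw [← ENNReal.tsum_mul_left]
      refine tsum_congr fun k => ?_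
      rw [← Real.enorm_of_nonneg hε.le, ← enorm_mul, sKernel_eq hε]
      congr 1
      field_simp
    simp only [e]
    rw [← lintegral_zext (by rw [zext_csum h]; exact h.gsum_integrable.1), zext_csum h]
    exact h.gsum_integrable.2
  · have hf' := isBoundedMeas_iff.1 hf
    rw [qOpInv_eq, add_sub_cancel_left, cneu_eq_conv h hf' ht, conv_eq_mul ε]
    have e : csum (aKernel ε (1 + √ε)) = fun t k => ε * sKernel ε t k := by
      ext t k
      rw [sKernel_eq hε]
      field_simp
    have := conv_mul_mul ε 1 (sKernel ε) f t k
    simp only [one_mul, mul_one] at this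
    rw [e, this]

theorem summable_qPower {ε : ℝ} (hε : 0 < ε) (h : Contr (zext (aKernel ε (1 + √ε))) ρ) {t : ℝ}
    (ht : 0 ≤ t) (k : ℤ) :
    Summable fun n : ℕ => (-ε) ^ (n + 1) * (1 + √ε) ^ (n + 1) * qPower ε n t k := by
  have h1 := (h.summable_gpow (k, t)).mul_left ε⁻¹
  simp only [← cpow_eq h _ ht, cpow_aKernel] at h1
  refine h1.congr fun n => ?_
  field_simp

end SemiDiscrete

end

noncomputable section

namespace SemiDiscrete

variable {Θ Λ lam ρ : ℝ} {a : ℝ → ℤ → ℝ}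

/-! ### Jets of convolutions at the time zero -/

theorem convT_jet {ι : Type*} {F : ℕ → ℝ → ℤ → ℝ} {U : ι → ℕ → ℝ → ℤ → ℝ} (hF : FinJet F) (n : ℕ)
    (hU : ∀ j ≤ n - 1, ∃ K : ℕ, ∀ i, ∀ k : ℤ, (K : ℤ) < |k| → U i j 0 k = 0) :
    ∃ K : ℕ, ∀ i, ∀ k : ℤ, (K : ℤ) < |k| → convT F (U i) n 0 k = 0 := by
  choose KF hKF using hF
  choose! KU hKU using hU
  refine ⟨∑ j ∈ Finset.range n, (KF j + KU (n - 1 - j)), fun i k hk => ?_⟩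
  have h0 : cv (F n) (U i 0) 0 k = 0 := by simp [cv, cI]
  rw [convT, h0, zero_add]
  refine Finset.sum_eq_zero fun j hj => ?_
  have hle : KF j + KU (n - 1 - j) ≤ ∑ j ∈ Finset.range n, (KF j + KU (n - 1 - j)) :=
    Finset.single_le_sum (f := fun j => KF j + KU (n - 1 - j)) (fun _ _ => Nat.zero_le _) hj
  have : ∀ l : ℤ, F j 0 l * U i (n - 1 - j) 0 (k - l) = 0 := by
    intro l
    by_cases hl : (KF j : ℤ) < |l|
    · rw [hKF j l hl, zero_mul]
    · rw [hKU (n - 1 - j) (Nat.sub_le _ _) i, mul_zero]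
      have h1 : |k| ≤ |k - l| + |l| := by simpa using abs_add_le (k - l) l
      omega
  simp only [this, tsum_zero]

/-! ### The difference of the modified heat kernel and the heat kernel -/

theorem bm_zext {u : ℝ → ℤ → ℝ} (hc : SCont u) (hb : SupBd u) : BM (zext u) := by
  obtain ⟨M, hM⟩ := hb
  exact isBoundedMeas_iff.1 ⟨fun k => (hc k).aestronglyMeasurable measurableSet_Ici, M, hM⟩

theorem sCont_heatKernel_one : SCont (heatKernel 1) := fun k =>
  (continuous_heatKernel_one k).continuousOn

theorem abs_heatKernel_one_le {t : ℝ} (ht : 0 ≤ t) (k : ℤ) : |heatKernel 1 t k| ≤ 1 := by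
  simpa using abs_heatKernel_le one_pos ht k

theorem bm_heatKernel : BM (zext (heatKernel 1)) :=
  bm_zext sCont_heatKernel_one ⟨1, fun _ ht k => abs_heatKernel_one_le ht k⟩

theorem aKernel_one : aKernel 1 lam = fun t k => -lam * qT 0 t k := by
  ext t k
  rw [aKernel, qKernel_one_eq]
  ring

theorem conv_aKernel {u : ℝ → ℤ → ℝ} (hb : SupBd u) (hc : SCont u) {t : ℝ} (ht : 0 ≤ t) (k : ℤ) :
    conv 1 (aKernel 1 lam) u t k = -lam * cv (qT 0) u t k := by
  have := conv_mul_mul (-lam) 1 (qT 0) u t k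
  simp only [one_mul, mul_one] at this
  rw [aKernel_one, this, conv_eq_cv (dec_qT.sumBd (by norm_num) 0) (tower_qT.sCont 0) hb hc ht]

theorem sCont_cv_qT {u : ℝ → ℤ → ℝ} (hb : SupBd u) (hc : SCont u) : SCont (cv (qT 0) u) :=
  sCont_cv (dec_qT.sumBd (by norm_num) 0) (dec_qT.sumBd (by norm_num) 1) (tower_qT.sCont 1)
    (fun k t ht => tower_qT 0 k t ht) hb hc

theorem abs_conv_cpow_le (h : Contr (zext a) ρ) {u : ℝ → ℤ → ℝ} {M : ℝ} (hc : SCont u) (hM0 : 0 ≤ M)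
    (hM : ∀ t, 0 ≤ t → ∀ k, |u t k| ≤ M) (n : ℕ) {t : ℝ} (ht : 0 ≤ t) (k : ℤ) :
    |conv 1 (cpow a n) u t k| ≤ ρ ^ n * M := by
  have hu := bm_zext hc ⟨M, hM⟩
  rw [conv_cpow_eq h hu n ht]
  refine h.abs_gcv_gpow_le hu.1 (fun z => ?_) n _
  unfold zext
  split_ifs with hz
  · exact hM _ hz _
  · simpa using hM0

/-- By associativity the next term is a single convolution of the smooth kernel q with the previous
continuous bounded one, and such a convolution is continuous in time. -/
theorem sCont_conv_cpow (h : Contr (zext (aKernel 1 lam)) ρ) (n : ℕ) :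
    SCont (conv 1 (cpow (aKernel 1 lam) n) (heatKernel 1)) := by
  have hstep : ∀ u v : ℝ → ℤ → ℝ, SupBd u → SCont u →
      (∀ t, 0 ≤ t → ∀ k, v t k = conv 1 (aKernel 1 lam) u t k) → SCont v := by
    intro u v hb hc hv k
    refine ContinuousOn.congr (f := fun t => -lam * cv (qT 0) u t k)
      (continuousOn_const.mul (sCont_cv_qT hb hc k)) fun t ht => ?_
    exact (hv t ht k).trans (conv_aKernel hb hc ht k)
  induction n with
  | zero =>
    exact hstep (heatKernel 1) _ ⟨1, fun _ ht k => abs_heatKernel_one_le ht k⟩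
      sCont_heatKernel_one fun t _ k => rfl
  | succ n ih =>
    have hb : SupBd (conv 1 (cpow (aKernel 1 lam) n) (heatKernel 1)) :=
      ⟨ρ ^ n * 1, fun t ht k => abs_conv_cpow_le h sCont_heatKernel_one zero_le_one
        (fun _ ht k => abs_heatKernel_one_le ht k) n ht k⟩
    refine hstep _ _ hb ih fun t ht k => ?_
    rw [conv_cpow_eq h bm_heatKernel _ ht, ← h.gcv_gcv_gpow bm_heatKernel,
      conv_eq_gcv h.int (bm_zext ih hb) ht, zext_conv (by rw [zext_cpow h]; exact (h.gpow n).1)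
      bm_heatKernel, zext_cpow h]

/-- The difference of the modified heat kernel and the heat kernel, at scale one. -/
def hK (lam : ℝ) : ℝ → ℤ → ℝ := cneu (aKernel 1 lam) (heatKernel 1)

theorem sCont_hK (h : Contr (zext (aKernel 1 lam)) ρ) : SCont (hK lam) := by
  intro k
  refine continuousOn_tsum (fun n => sCont_conv_cpow h n k) (h.summable_pow.mul_right 1)
    fun n t ht => ?_
  exact abs_conv_cpow_le h sCont_heatKernel_one zero_le_one
    (fun _ ht k => abs_heatKernel_one_le ht k) n ht k

theorem abs_hK_le (h : Contr (zext (aKernel 1 lam)) ρ) {t : ℝ} (ht : 0 ≤ t) (k : ℤ) :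
    |hK lam t k| ≤ ρ / (1 - ρ) := by
  rw [hK, cneu_eq h bm_heatKernel ht]
  refine (abs_gcv_le h.gsum_integrable bm_heatKernel.1 (M := 1) (fun z => ?_) _).trans ?_
  · unfold zext
    split_ifs with hz
    · exact abs_heatKernel_one_le hz _
    · simp
  · rw [mul_one]
    exact h.integral_abs_gsum_le

/-- Young's inequality in mixed norms: an integrable function convolved with one of spatial mass at
most H at every time. -/
theorem sum_abs_gcv_le {F G : ℤ × ℝ → ℝ} (hF : Integrable F stMeas) (hG : BM G) {H : ℝ}
    (hH : ∀ t, ∀ s : Finset ℤ, ∑ k ∈ s, |G (k, t)| ≤ H) (t : ℝ) (s : Finset ℤ) :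
    ∑ k ∈ s, |gcv F G (k, t)| ≤ (∫ z, |F z| ∂stMeas) * H := by
  have hint : ∀ k, Integrable (fun z => |F z| * |G ((k, t) - z)|) stMeas := fun k =>
    integrable_gcv_integrand hF.abs hG.abs (k, t)
  calc _ ≤ ∑ k ∈ s, ∫ z, |F z| * |G ((k, t) - z)| ∂stMeas := by
        refine Finset.sum_le_sum fun k _ => abs_integral_le_integral_abs.trans (le_of_eq ?_)
        simp only [abs_mul]
    _ = ∫ z, ∑ k ∈ s, |F z| * |G ((k, t) - z)| ∂stMeas :=
        (integral_finsetSum _ fun k _ => hint k).symm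
    _ ≤ ∫ z, |F z| * H ∂stMeas := by
        refine integral_mono (integrable_finsetSum _ fun k _ => hint k) (hF.abs.mul_const H)
          fun z => ?_
        beta_reduce
        rw [← Finset.mul_sum]
        refine mul_le_mul_of_nonneg_left ?_ (abs_nonneg _)
        have := hH (t - z.2) (s.map (Equiv.subRight z.1).toEmbedding)
        rw [Finset.sum_map] at this
        exact this
    _ = _ := integral_mul_const _ _

theorem exists_mass_hK : ∃ H : ℝ, 0 ≤ H ∧ ∀ lam ρ : ℝ, Contr (zext (aKernel 1 lam)) ρ →
    ∀ t, 0 ≤ t → ∀ s : Finset ℤ, ∑ k ∈ s, |hK lam t k| ≤ ρ / (1 - ρ) * H := by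
  obtain ⟨H, hH⟩ := exists_mass_heatKernel
  have hH0 : 0 ≤ H := by simpa using hH 0 le_rfl ∅
  refine ⟨H, hH0, fun lam ρ h t ht s => ?_⟩
  have h1 := sum_abs_gcv_le h.gsum_integrable bm_heatKernel (H := H) (fun t s => by
    by_cases ht : 0 ≤ t
    · simpa only [zext_of_nonneg ht] using hH t ht s
    · simpa only [zext_of_neg (not_le.1 ht), abs_zero, Finset.sum_const_zero] using hH0) t s
  simp only [hK, cneu_eq h bm_heatKernel ht]
  exact h1.trans (mul_le_mul_of_nonneg_right h.integral_abs_gsum_le hH0)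

theorem hK_eq (h : Contr (zext (aKernel 1 lam)) ρ) {t : ℝ} (ht : 0 ≤ t) (k : ℤ) :
    hK lam t k = -lam * cv (qT 0) (heatKernel 1) t k - lam * cv (qT 0) (hK lam) t k := by
  have hb : SupBd (hK lam) := ⟨_, fun t ht k => abs_hK_le h ht k⟩
  have hc := sCont_hK h
  have e := conv_aKernel (lam := lam) ⟨1, fun _ ht k => abs_heatKernel_one_le ht k⟩
    sCont_heatKernel_one ht k
  have e' := conv_aKernel (lam := lam) hb hc ht k
  rw [conv_eq_gcv h.int bm_heatKernel ht] at e
  rw [conv_eq_gcv h.int (bm_zext hc hb) ht, hK, zext_cneu h bm_heatKernel] at e'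
  rw [hK, cneu_eq h bm_heatKernel ht, h.gcv_gsum_eq bm_heatKernel, e, e']
  ring

theorem conv_neg {f u : ℝ → ℤ → ℝ} (hf : ∀ t k, f t (-k) = f t k) (hu : ∀ t k, u t (-k) = u t k)
    (t : ℝ) (k : ℤ) : conv 1 f u t (-k) = conv 1 f u t k := by
  unfold conv
  congr 1
  ext s
  rw [← (Equiv.neg ℤ).tsum_eq]
  congr 1
  refine tsum_congr fun l => ?_
  rw [Equiv.neg_apply, hu, show -k - -l = -(k - l) by ring, hf]

theorem hK_neg (lam t : ℝ) (k : ℤ) : hK lam t (-k) = hK lam t k := by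
  have ha : ∀ t k, aKernel 1 lam t (-k) = aKernel 1 lam t k := by
    intro t k
    simp only [aKernel_one, qT_neg]
  have hp : ∀ n t k, cpow (aKernel 1 lam) n t (-k) = cpow (aKernel 1 lam) n t k := by
    intro n
    induction n with
    | zero => exact ha
    | succ n ih => exact conv_neg ha ih
  unfold hK cneu
  simp only [conv_neg (hp _) heatKernel_neg]

/-- The time derivatives of `hK`. -/
def solT (lam : ℝ) : ℕ → ℝ → ℤ → ℝ
  | 0 => hK lam
  | n + 1 => fun t k => -lam * convT qT pT (n + 1) t k - lam * (cv (qT (n + 1)) (hK lam) t k +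
      ∑ i : Fin (n + 1), ∑' l, qT i 0 l * solT lam (n - i) t (k - l))
decreasing_by omega

/-- The recursion defining `solT` is the differentiated fixed-point equation, written with a sum
over `Fin (n + 1)` to make the decrease of the order visible. -/
theorem solT_succ (lam : ℝ) (n : ℕ) (t : ℝ) (k : ℤ) : solT lam (n + 1) t k =
    -lam * convT qT pT (n + 1) t k - lam * convT qT (solT lam) (n + 1) t k := by
  have h0 : solT lam 0 = hK lam := by rw [solT]
  have e : convT qT (solT lam) (n + 1) t k = cv (qT (n + 1)) (hK lam) t k +
      ∑ i : Fin (n + 1), ∑' l, qT i 0 l * solT lam (n - i) t (k - l) := by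
    rw [convT, ← Fin.sum_univ_eq_sum_range
      (fun i => ∑' l, qT i 0 l * solT lam (n + 1 - 1 - i) t (k - l)), h0]
    rfl
  rw [e, solT]

theorem sumBd_qT (n : ℕ) : SumBd (qT n) := dec_qT.sumBd (by norm_num) n

theorem solT_eq (h : Contr (zext (aKernel 1 lam)) ρ) (n : ℕ) {t : ℝ} (ht : 0 ≤ t) (k : ℤ) :
    solT lam n t k = -lam * convT qT pT n t k - lam * convT qT (solT lam) n t k := by
  rcases n with _ | n
  · have hp : pT 0 = heatKernel 1 := by ext t k; rw [pT_zero]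
    have h0 : solT lam 0 = hK lam := by rw [solT]
    simp only [convT, Finset.range_zero, Finset.sum_empty, add_zero, hp, h0]
    exact hK_eq h ht k
  · exact solT_succ lam n t k

theorem convT_pT_bdd (hq : Ker qT Θ) (n : ℕ) :
    ∃ C : ℝ, ∀ t, 0 ≤ t → ∀ k, |convT qT pT n t k| ≤ C := by
  obtain ⟨C, hC⟩ := convT_bdd (ι := Unit) (U := fun _ => pT) hq n fun j _ => dec_pT.decU.bdd j
  exact ⟨C, hC ()⟩

/-- The admissible values of the parameter. -/
abbrev Par (Λ : ℝ) := {lam : ℝ // 0 ≤ lam ∧ lam ≤ Λ}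

theorem contr_par (h : L1Bd (qT 0) Θ) (hΛ : Λ * Θ < 1) (i : Par Λ) :
    Contr (zext (aKernel 1 i.1)) (Λ * Θ) :=
  contr_aKernel h one_pos i.2.1 (mul_le_mul_of_nonneg_right i.2.2 h.nonneg) hΛ

theorem solT_bdd (h : L1Bd (qT 0) Θ) (hΛ : Λ * Θ < 1) (n : ℕ) :
    ∃ M : ℝ, ∀ (i : Par Λ) t, 0 ≤ t → ∀ k, |solT i.1 n t k| ≤ M := by
  induction n using Nat.strong_induction_on with
  | _ n ih =>
  rcases n with _ | n
  · refine ⟨Λ * Θ / (1 - Λ * Θ), fun i t ht k => ?_⟩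
    rw [solT]
    exact abs_hK_le (contr_par h hΛ i) ht k
  · obtain ⟨A, hA⟩ := convT_pT_bdd (ker_qT h) (n + 1)
    obtain ⟨B, hB⟩ := convT_bdd (U := fun i : Par Λ => solT i.1) (ker_qT h) (n + 1)
      fun j hj => ih j (by omega)
    refine ⟨Λ * A + Λ * B, fun i t ht k => ?_⟩
    have hi0 := i.2.1
    have hi := i.2.2
    have hΛ0 : 0 ≤ Λ := hi0.trans hi
    rw [solT_succ]
    refine (abs_sub _ _).trans ?_
    rw [abs_mul, abs_mul, abs_neg, abs_of_nonneg hi0]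
    gcongr
    · exact hA t ht k
    · exact hB i t ht k

theorem solT_supBd (h : L1Bd (qT 0) Θ) (hΛ : Λ * Θ < 1) (i : Par Λ) (n : ℕ) :
    SupBd (solT i.1 n) := by
  obtain ⟨M, hM⟩ := solT_bdd h hΛ n
  exact ⟨M, hM i⟩

theorem solT_sCont (h : L1Bd (qT 0) Θ) (hΛ : Λ * Θ < 1) (i : Par Λ) (n : ℕ) :
    SCont (solT i.1 n) := by
  induction n using Nat.strong_induction_on with
  | _ n ih =>
  rcases n with _ | n
  · rw [solT]
    exact sCont_hK (contr_par h hΛ i)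
  · have h1 := sCont_convT (n := n + 1) tower_qT sumBd_qT (fun j _ => solT_supBd h hΛ i j)
      fun j hj => ih j (by omega)
    intro k
    refine (((tower_convT_qT_pT.sCont (n + 1) k).const_mul (-i.1)).sub
      ((h1 k).const_mul i.1)).congr fun t ht => ?_
    exact solT_succ i.1 n t k

/-- Bootstrapping: the right side of the fixed-point equation at order n is differentiable once the
derivative relations below order n are known, and its derivative is the definition of the next
member. -/
theorem tower_solT (h : L1Bd (qT 0) Θ) (hΛ : Λ * Θ < 1) (i : Par Λ) : Tower (solT i.1) := by
  intro n
  induction n using Nat.strong_induction_on with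
  | _ n ih =>
  intro k t ht
  have h1 := (tower_convT_qT_pT n k t ht).const_mul (-i.1)
  have h2 := (hasDerivWithinAt_convT (n := n) tower_qT sumBd_qT ih
    (fun j _ => solT_supBd h hΛ i j) (fun j _ => solT_sCont h hΛ i j) ht k).const_mul i.1
  rw [solT_succ]
  exact (h1.sub h2).congr (fun s hs => solT_eq (contr_par h hΛ i) n hs k)
    (solT_eq (contr_par h hΛ i) n ht k)

theorem reg_solT (h : L1Bd (qT 0) Θ) (hΛ : Λ * Θ < 1) : Reg (fun i : Par Λ => solT i.1) where
  tower := tower_solT h hΛ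
  bdd := solT_bdd h hΛ
  mass := by
    obtain ⟨H, _, hH⟩ := exists_mass_hK
    refine ⟨Λ * Θ / (1 - Λ * Θ) * H, fun i t ht s => ?_⟩
    have := hH i.1 _ (contr_par h hΛ i) t ht s
    rwa [solT]
  jet n := by
    induction n using Nat.strong_induction_on with
    | _ n ih =>
    rcases n with _ | n
    · refine ⟨0, fun i k _ => ?_⟩
      rw [solT_eq (contr_par h hΛ i) 0 le_rfl]
      simp [convT, cv, cI]
    · obtain ⟨A, hA⟩ := convT_jet (ι := Unit) (U := fun _ => pT) finJet_qT (n + 1) fun j _ => by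
        obtain ⟨K, hK⟩ := finJet_pT j
        exact ⟨K, fun _ => hK⟩
      obtain ⟨B, hB⟩ := convT_jet (U := fun i : Par Λ => solT i.1) finJet_qT (n + 1)
        fun j hj => ih j (by omega)
      refine ⟨A + B, fun i k hk => ?_⟩
      push_cast at hk
      rw [solT_succ, hA () k (by omega), hB i k (by omega)]
      simp

/-- The family is indexed by λ in [0, Λ], so the constants are uniform in λ, and hence in ε after
rescaling. The source -λ q ⋆ p has order 2 by cancellation, and the contraction argument passes this
on to the solution. -/
theorem decU_solT (h : L1Bd (qT 0) Θ) (hΛ : Λ * Θ < 1) : DecU 2 (fun i : Par Λ => solT i.1) := by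
  have hfix : ∀ (i : Par Λ) n t, 0 ≤ t → ∀ k, solT i.1 n t k =
      -i.1 * convT qT pT n t k - i.1 * convT qT (solT i.1) n t k :=
    fun i n t ht k => solT_eq (contr_par h hΛ i) n ht k
  have hv := decU_convT_qT_pT h
  have hF : DecU 2 (fun (i : Par Λ) n t k => -i.1 * convT qT pT n t k) := by
    intro n m
    obtain ⟨C, hC0, hC⟩ := hv n m
    refine ⟨|Λ| * C, by positivity, fun i t ht k => ?_⟩
    have e : (fun k => -i.1 * convT qT pT n t k) = (-i.1) • convT qT pT n t := rfl
    beta_reduce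
    rw [e, map_smul, Pi.smul_apply, smul_eq_mul, abs_mul, abs_neg, abs_of_nonneg i.2.1, mul_assoc]
    have hi := i.2.1
    have := hC () t ht k
    have hw := wt_pos t k
    gcongr
    exact i.2.2.trans (le_abs_self Λ)
  refine decU_of_spaceDec_of_timeDec
    (spaceDec_of_fixedPoint (ker_qT h) (reg_solT h hΛ) (fun n m => hF.spaceDec n m)
      (fun i => i.2.1) (fun i => i.2.2) hΛ hfix)
    (timeDec_of_fixedPoint (ker_qT h) (reg_solT h hΛ) (fun n m => hF.timeDec n m)
      (fun i => i.2.1) (fun i => i.2.2) hΛ hfix) fun i n t ht k => ?_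
  have hT := tower_solT h hΛ i
  exact Tower.eq_of_zero (F := fun n t k => solT i.1 n t (-k)) (fun n k t ht => hT n (-k) t ht) hT
    (fun t ht k => by rw [solT]; exact hK_neg i.1 t k) n ht k

/-! ### The sum of the convolution powers -/

/-- The discrete heat operator, applied to a tower. -/
def heatOp (U : ℕ → ℝ → ℤ → ℝ) (n : ℕ) (t : ℝ) (k : ℤ) : ℝ :=
  U (n + 1) t k - 1 / 2 * (bd ^ 2) (U n t) (k + 1)

theorem Tower.heatOp {U : ℕ → ℝ → ℤ → ℝ} (h : Tower U) : Tower (heatOp U) :=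
  fun n k t ht => (h (n + 1) k t ht).sub (((h.BD 2) n (k + 1) t ht).const_mul _)

theorem heatOp_pT (t : ℝ) (k : ℤ) : heatOp pT 0 t k = 0 := by
  simp only [heatOp, pT_one, bd_pow_succ', bd_apply, pow_zero, Module.End.one_apply, zero_add]
  ring_nf

theorem DecU.heatOp {ι : Type*} {U : ι → ℕ → ℝ → ℤ → ℝ} (h : DecU 2 U) :
    DecU 4 (fun i => heatOp (U i)) := by
  intro n m
  obtain ⟨A, hA0, hA⟩ := h (n + 1) m
  obtain ⟨B, hB0, hB⟩ := h n (m + 2)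
  refine ⟨A + 2 ^ (4 + 2 * n + m) * B, by positivity, fun i t ht k => ?_⟩
  have e : (bd ^ m) (SemiDiscrete.heatOp (U i) n t) k = (bd ^ m) (U i (n + 1) t) k -
      1 / 2 * (bd ^ (m + 2)) (U i n t) (k + 1) := by
    have e1 : SemiDiscrete.heatOp (U i) n t =
        U i (n + 1) t - (1 / 2 : ℝ) • fun k => (bd ^ 2) (U i n t) (k + 1) := rfl
    rw [e1, map_sub, map_smul, Pi.sub_apply, Pi.smul_apply, smul_eq_mul, bd_pow_shift, bd_pow_add]
  have hw := wt_pos t k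
  have hw' := wt_pos t (k + 1)
  have h1 := hA i t ht k
  have h2 := hB i t ht (k + 1)
  rw [show 2 + 2 * (n + 1) + m = 4 + 2 * n + m by ring] at h1
  rw [show 2 + 2 * n + (m + 2) = 4 + 2 * n + m by ring] at h2
  have h3 : wt t k ^ (4 + 2 * n + m) ≤ 2 ^ (4 + 2 * n + m) * wt t (k + 1) ^ (4 + 2 * n + m) := by
    rw [← mul_pow]
    gcongr
    refine (wt_shift t k 1).trans (le_of_eq ?_)
    norm_num
  have h4 : |(bd ^ (m + 2)) (U i n t) (k + 1)| * wt t k ^ (4 + 2 * n + m) ≤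
      2 ^ (4 + 2 * n + m) * B := by
    refine (mul_le_mul_of_nonneg_left h3 (abs_nonneg _)).trans ?_
    rw [mul_left_comm]
    gcongr
  rw [e]
  calc _ ≤ (|(bd ^ m) (U i (n + 1) t) k| + 1 / 2 * |(bd ^ (m + 2)) (U i n t) (k + 1)|) *
        wt t k ^ (4 + 2 * n + m) := by
        gcongr
        refine (abs_sub _ _).trans (le_of_eq ?_)
        rw [abs_mul, abs_of_pos (by norm_num : (0 : ℝ) < 1 / 2)]
    _ ≤ _ := by
        have : 0 ≤ |(bd ^ (m + 2)) (U i n t) (k + 1)| * wt t k ^ (4 + 2 * n + m) := by positivity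
        linarith

/-- The heat operator of a convolution, taken on the second factor. -/
theorem heatOp_convT {F U : ℕ → ℝ → ℤ → ℝ} (hF : Tower F) (hFs : ∀ n, SumBd (F n)) (hU : Tower U)
    (hUb : ∀ n, SupBd (U n)) {t : ℝ} (ht : 0 ≤ t) (k : ℤ) : heatOp (convT F U) 0 t k =
      cv (F 0) (heatOp U 0) t k + ∑' l, F 0 t l * U 0 0 (k - l) := by
  have s1 := summable_cI (hFs 0) (hUb 1) ht k
  have s2 := summable_mul_of_sumBd (hFs 0) (hUb 0) ht le_rfl k
  have s3 := (summable_cI (hFs 0) (SupBd.BD hUb 2 0) ht (k + 1)).mul_left (1 / 2)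
  have e1 : convT F U 1 t k = cv (F 0) (U 1) t k + ∑' l, F 0 t l * U 0 0 (k - l) := by
    rw [convT_eq_tsum_jt hFs hUb 1 ht, cv, ← s1.tsum_add s2]
    refine tsum_congr fun l => ?_
    -- The cut τ = t puts the time derivative on U and leaves F at time t against U at time 0.
    rw [jt_eq_of_cut hF hU 1 ht le_rfl, intervalIntegral.integral_same]
    simp [cI]
  have e2 : (bd ^ 2) (convT F U 0 t) (k + 1) = cv (F 0) (BD 2 U 0) t (k + 1) := by
    rw [bd_pow_convT hF hFs hU hUb 2 0 ht]
    simp [convT]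
  have e3 : cv (F 0) (heatOp U 0) t k =
      cv (F 0) (U 1) t k - 1 / 2 * cv (F 0) (BD 2 U 0) t (k + 1) := by
    rw [cv, cv, cv, ← tsum_mul_left, ← s1.tsum_sub s3]
    refine tsum_congr fun l => ?_
    have h1 : (fun r => heatOp U 0 r (k - l)) =
        fun r => U 1 r (k - l) + -(1 / 2) * BD 2 U 0 r (k + 1 - l) := by
      ext r
      simp only [heatOp, BD, zero_add]
      rw [show k + 1 - l = k - l + 1 by ring]
      ring
    rw [h1, cI_comm, cI_add_left (hU.continuousOn 1 _)
      (((hU.BD 2).continuousOn 0 _).const_mul (-(1 / 2) : ℝ)) (hF.continuousOn 0 l) ht,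
      cI_mul_left, cI_comm, cI_comm (fun r => BD 2 U 0 r (k + 1 - l))]
    ring
  rw [heatOp, e1, e2, e3]
  ring

/-- The heat operator is applied to h = -λ q ⋆ p - λ q ⋆ h. It annihilates p, whose initial value is
the unit mass and returns q, and the initial value of h is zero. So the result solves y = a + a ⋆ y,
like the Neumann sum, and bounded solutions are unique. -/
theorem csum_eq_heatOp (h : L1Bd (qT 0) Θ) (hΛ : Λ * Θ < 1) (i : Par Λ) {t : ℝ} (ht : 0 ≤ t)
    (k : ℤ) : csum (aKernel 1 i.1) t k = heatOp (solT i.1) 0 t k := by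
  have hC := contr_par h hΛ i
  have hT := tower_solT h hΛ i
  have hb := solT_supBd h hΛ i
  have hy : ∀ t, 0 ≤ t → ∀ k, heatOp (solT i.1) 0 t k =
      -i.1 * qT 0 t k - i.1 * cv (qT 0) (heatOp (solT i.1) 0) t k := by
    intro t ht k
    have h1 := heatOp_convT tower_qT sumBd_qT hT hb ht k
    have h2 := heatOp_convT tower_qT sumBd_qT tower_pT supBd_pT ht k
    have z1 : ∀ l, solT i.1 0 0 l = 0 := by
      intro l
      rw [solT_eq hC 0 le_rfl]
      simp [convT, cv, cI]
    have z2 : cv (qT 0) (heatOp pT 0) t k = 0 := by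
      simp only [cv, heatOp_pT, cI, mul_zero, intervalIntegral.integral_zero, tsum_zero]
    have z3 : ∑' l, qT 0 t l * pT 0 0 (k - l) = qT 0 t k := by
      rw [tsum_eq_single k]
      · simp [pT_zero, heatKernel_one_zero]
      · intro l hl
        rw [pT_zero, heatKernel_one_zero, if_neg (sub_ne_zero.2 hl.symm), mul_zero]
    simp only [z1, mul_zero, tsum_zero, add_zero] at h1
    rw [z2, z3, zero_add] at h2
    have e0 : solT i.1 0 t = (-i.1) • convT qT pT 0 t - i.1 • convT qT (solT i.1) 0 t := by
      ext k; exact solT_eq hC 0 ht k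
    rw [← h1, ← h2]
    simp only [heatOp]
    rw [zero_add, solT_eq hC 1 ht, e0, map_sub, map_smul, map_smul]
    simp only [Pi.sub_apply, Pi.smul_apply, smul_eq_mul]
    ring
  have hyc : SCont (heatOp (solT i.1) 0) := hT.heatOp.sCont 0
  have hyb : SupBd (heatOp (solT i.1) 0) := by
    obtain ⟨M, hM⟩ := (decU_solT h hΛ).heatOp.bdd 0
    exact ⟨M, hM i⟩
  have hybm := bm_zext hyc hyb
  have hfix : ∀ z, zext (heatOp (solT i.1) 0) z = zext (aKernel 1 i.1) z +
      gcv (zext (aKernel 1 i.1)) (zext (heatOp (solT i.1) 0)) z := by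
    rintro ⟨k, t⟩
    rw [← zext_conv hC.int hybm]
    by_cases ht : 0 ≤ t
    · rw [zext_of_nonneg ht, zext_of_nonneg ht, zext_of_nonneg ht, conv_aKernel hyb hyc ht,
        hy t ht, aKernel_one]
      ring
    · simp [zext_of_neg (not_le.1 ht)]
  have hzero := hC.eq_zero_of_eq_gcv (hC.gsum_bm.sub hybm) (fun z => by
    rw [gcv_sub hC.int hC.gsum_bm hybm, hC.gsum_eq z, hfix z]
    ring) (k, t)
  rw [← zext_csum hC, zext_of_nonneg ht, zext_of_nonneg ht] at hzero
  linarith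

end SemiDiscrete

end

/-! ### Return to the lattice of spacing ε, and the lemma. -/

noncomputable section

namespace SemiDiscrete

theorem parNorm_add {ε : ℝ} (hε : 0 < ε) {t : ℝ} (ht : 0 ≤ t) (k : ℤ) :
    parNorm ε t k + ε = ε * wt (t / ε ^ 2) k := by
  rw [parNorm, wt, abs_of_nonneg ht, abs_mul, abs_of_pos hε, Real.sqrt_div ht, Real.sqrt_sq hε.le]
  field_simp
  ring

theorem Tower.timeSmooth {F : ℕ → ℝ → ℤ → ℝ} (h : Tower F) {ε : ℝ} (a : ℝ)
    {f : ℝ → ℤ → ℝ} (hf : ∀ t, 0 ≤ t → ∀ k, f t k = a * F 0 (t / ε ^ 2) k) : TimeSmooth f := by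
  intro k
  have h1 : ContDiffOn ℝ ((⊤ : ℕ∞) : WithTop ℕ∞) (fun t : ℝ => t / ε ^ 2) (Ici 0) := by fun_prop
  have h2 := (h.contDiffOn k).comp h1 fun t (ht : 0 ≤ t) => show (0 : ℝ) ≤ t / ε ^ 2 by positivity
  exact (contDiffOn_const.mul h2).congr fun t ht => hf t ht k

theorem Tower.abs_mixedDeriv_le {F : ℕ → ℝ → ℤ → ℝ} (h : Tower F) {ε : ℝ} (hε : 0 < ε) {a : ℝ}
    (ha : 0 ≤ a) {f : ℝ → ℤ → ℝ} (hf : ∀ t, 0 ≤ t → ∀ k, f t k = a * F 0 (t / ε ^ 2) k)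
    (j : ℕ × ℕ) {p : ℕ} {C : ℝ}
    (hC : ∀ t, 0 ≤ t → ∀ k, |(bd ^ j.2) (F j.1 t) k| * wt t k ^ (p + 2 * j.1 + j.2) ≤ C) {t : ℝ}
    (ht : 0 ≤ t) (k : ℤ) :
    |mixedDeriv ε j f t k| ≤ C * (a * ε ^ p) * (parNorm ε t k + ε) ^ (-(parOrder j : ℝ) - p) := by
  have hw := wt_pos (t / ε ^ 2) k
  have h1 := hC (t / ε ^ 2) (by positivity) k
  rw [add_assoc, ← le_div_iff₀ (by positivity)] at h1
  have e : (-(parOrder j : ℝ) - p) = -((p + (2 * j.1 + j.2) : ℕ) : ℝ) := by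
    rw [parOrder]; push_cast; ring
  rw [h.mixedDeriv_eq hε a hf j ht k, parNorm_add hε ht, e, Real.rpow_neg (by positivity),
    Real.rpow_natCast, abs_mul, abs_of_nonneg (by positivity)]
  calc _ ≤ a * ε⁻¹ ^ (2 * j.1 + j.2) * (C / wt (t / ε ^ 2) k ^ (p + (2 * j.1 + j.2))) := by gcongr
    _ = _ := by
      rw [mul_pow, pow_add ε, inv_pow]
      field_simp

theorem parNorm_nonneg (ε t : ℝ) (k : ℤ) : 0 ≤ parNorm ε t k := by
  unfold parNorm
  positivity

/-- The case α = 1 implies the others: since ε ≤ N, the power ε^(1-α) can be replaced by N^(1-α). -/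
theorem mul_rpow_le_rpow_mul_rpow {ε N α r : ℝ} (hε : 0 < ε) (hN : ε ≤ N) (hα : α ≤ 1) :
    ε * N ^ (r - 2) ≤ ε ^ α * N ^ (r - 1 - α) := by
  have hN0 : 0 < N := hε.trans_le hN
  calc ε * N ^ (r - 2) = ε ^ α * (ε ^ (1 - α) * N ^ (r - 2)) := by
        rw [← mul_assoc, ← Real.rpow_add hε, add_sub_cancel, Real.rpow_one]
    _ ≤ ε ^ α * (N ^ (1 - α) * N ^ (r - 2)) := by
        have := Real.rpow_le_rpow hε.le hN (sub_nonneg.2 hα)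
        gcongr
    _ = _ := by rw [← Real.rpow_add hN0]; ring_nf

theorem DecU.add_dec {ι : Type*} {p p' : ℕ} (hp : p' ≤ p) {U : ι → ℕ → ℝ → ℤ → ℝ} (hU : DecU p U)
    {F : ℕ → ℝ → ℤ → ℝ} (hF : Dec p' F) : DecU p' (fun i n t k => U i n t k + F n t k) := by
  intro n m
  obtain ⟨A, hA0, hA⟩ := hU n m
  obtain ⟨B, hB0, hB⟩ := hF.nonneg_bound n m
  refine ⟨A + B, by positivity, fun i t ht k => ?_⟩
  have e : (fun k => U i n t k + F n t k) = U i n t + F n t := rfl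
  beta_reduce
  rw [e, map_add]
  have hw := wt_pos t k
  calc _ ≤ (|(bd ^ m) (U i n t) k| + |(bd ^ m) (F n t) k|) * wt t k ^ (p' + 2 * n + m) := by
        gcongr; exact abs_add_le _ _
    _ ≤ _ := by
        rw [add_mul]
        refine add_le_add (le_trans ?_ (hA i t ht k)) (hB t ht k)
        gcongr
        exact one_le_wt t k

end SemiDiscrete

end

open SemiDiscrete

theorem lemma4p9 :
    ∃ Θ : ℝ, 0 < Θ ∧ Θ < 1 ∧
      -- the `L¹` bound on `Q^ε`
      (∀ ε : ℝ, 0 < ε →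
        ∫⁻ t in Ici (0 : ℝ), ENNReal.ofReal ε * ∑' k : ℤ, ‖SemiDiscrete.qKernel ε t k‖ₑ
          ≤ ENNReal.ofReal (Θ / ε)) ∧
      ∃ ε₁ : ℝ, 0 < ε₁ ∧ ε₁ < 1 ∧
        -- the inverse operator, its kernel and the modified heat kernel are well defined and smooth
        (∀ ε : ℝ, 0 < ε → ε < ε₁ →
          (∀ t : ℝ, 0 ≤ t → ∀ k : ℤ, Summable fun n : ℕ =>
            (-ε) ^ (n + 1) * (1 + √ε) ^ (n + 1) * SemiDiscrete.qPower ε n t k) ∧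
          SemiDiscrete.IsInverseWithKernel ε (SemiDiscrete.sKernel ε) ∧
          SemiDiscrete.TimeSmooth (SemiDiscrete.sKernel ε) ∧
          SemiDiscrete.TimeSmooth (SemiDiscrete.heatKernel ε) ∧
          SemiDiscrete.TimeSmooth (SemiDiscrete.modHeatKernel ε)) ∧
        -- decay of the kernel of `(𝒬^ε)⁻¹ - Id`
        (∀ j : ℕ × ℕ, ∃ C ε₀ : ℝ, 0 < C ∧ 0 < ε₀ ∧ ε₀ ≤ ε₁ ∧
          ∀ ε : ℝ, 0 < ε → ε < ε₀ → ∀ t : ℝ, 0 ≤ t → ∀ k : ℤ,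
            |SemiDiscrete.mixedDeriv ε j (SemiDiscrete.sKernel ε) t k|
              ≤ C * ε * (SemiDiscrete.parNorm ε t k + ε)
                  ^ (-(SemiDiscrete.parOrder j : ℝ) - 4)) ∧
        -- decay of the modified heat kernel
        (∀ (j : ℕ × ℕ) (α : ℝ), 0 ≤ α → α ≤ 1 → ∃ C ε₀ : ℝ, 0 < C ∧ 0 < ε₀ ∧ ε₀ ≤ ε₁ ∧
          ∀ ε : ℝ, 0 < ε → ε < ε₀ → ∀ t : ℝ, 0 ≤ t → ∀ k : ℤ,
            |SemiDiscrete.mixedDeriv ε j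
                (fun s l => SemiDiscrete.modHeatKernel ε s l - SemiDiscrete.heatKernel ε s l) t k|
              ≤ C * ε ^ α * (SemiDiscrete.parNorm ε t k + ε)
                  ^ (-(SemiDiscrete.parOrder j : ℝ) - 1 - α) ∧
            |SemiDiscrete.mixedDeriv ε j (SemiDiscrete.modHeatKernel ε) t k|
              ≤ C * (SemiDiscrete.parNorm ε t k + ε)
                  ^ (-(SemiDiscrete.parOrder j : ℝ) - 1)) := by
  obtain ⟨Θ, hΘ0, hΘ1, hΘ⟩ := exists_l1Bd_qT
  refine ⟨Θ, hΘ0, hΘ1, fun ε hε => lintegral_qKernel_le hΘ hε, ?_⟩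
  -- With this choice 1 - ΛΘ = (1 - Θ)(2 - Θ) / 2 is positive, and 1 + √ε ≤ Λ means ε ≤ ((1 - Θ) /
  -- 2)², which gives ε₁.
  set Λ : ℝ := 1 + (1 - Θ) / 2 with hΛd
  have hΛ : Λ * Θ < 1 := by nlinarith [mul_pos (sub_pos.2 hΘ1) (sub_pos.2 hΘ1)]
  have hε₁ : 0 < ((1 - Θ) / 2) ^ 2 := by
    have := sub_pos.2 hΘ1
    positivity
  have hpar : ∀ ε : ℝ, ε < ((1 - Θ) / 2) ^ 2 → 0 ≤ 1 + √ε ∧ 1 + √ε ≤ Λ := by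
    intro ε hε
    refine ⟨by positivity, ?_⟩
    have := (Real.sqrt_lt_sqrt_iff_of_pos hε₁).2 hε
    rw [Real.sqrt_sq (by linarith)] at this
    linarith
  have hpT : ∀ ε : ℝ, 0 < ε → ∀ t, 0 ≤ t → ∀ k,
      heatKernel ε t k = ε⁻¹ * pT 0 (t / ε ^ 2) k := fun ε hε t _ k => by
    rw [heatKernel_scale hε, pT_zero]
  have hsub : ∀ ε : ℝ, 0 < ε → ∀ t, 0 ≤ t → ∀ k, modHeatKernel ε t k - heatKernel ε t k =
      ε⁻¹ * solT (1 + √ε) 0 (t / ε ^ 2) k := fun ε hε t _ k => by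
    rw [modHeatKernel_sub_scale hε, solT, hK]
  have hmod : ∀ ε : ℝ, 0 < ε → ∀ t, 0 ≤ t → ∀ k, modHeatKernel ε t k =
      ε⁻¹ * (solT (1 + √ε) 0 (t / ε ^ 2) k + pT 0 (t / ε ^ 2) k) := fun ε hε t ht k => by
    rw [mul_add, ← hsub ε hε t ht, ← hpT ε hε t ht, sub_add_cancel]
  have hker : ∀ ε : ℝ, 0 < ε → ε < ((1 - Θ) / 2) ^ 2 → ∀ t, 0 ≤ t → ∀ k, sKernel ε t k =
      (ε ^ 3)⁻¹ * heatOp (solT (1 + √ε)) 0 (t / ε ^ 2) k := fun ε hε h1 t ht k => by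
    rw [sKernel_scale hε, csum_eq_heatOp hΘ hΛ ⟨1 + √ε, hpar ε h1⟩ (by positivity)]
  have hT : ∀ ε : ℝ, ε < ((1 - Θ) / 2) ^ 2 → Tower (solT (1 + √ε)) :=
    fun ε h1 => tower_solT hΘ hΛ ⟨1 + √ε, hpar ε h1⟩
  have hD := decU_solT hΘ hΛ
  refine ⟨((1 - Θ) / 2) ^ 2, hε₁, by nlinarith, fun ε hε h1 => ?_, fun j => ?_,
    fun j α hα0 hα1 => ?_⟩
  · have hC := contr_aKernel hΘ hε (hpar ε h1).1
      (mul_le_mul_of_nonneg_right (hpar ε h1).2 hΘ0.le) hΛ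
    exact ⟨fun t ht k => summable_qPower hε hC ht k, isInverseWithKernel hε hC,
      (hT ε h1).heatOp.timeSmooth _ (hker ε hε h1), tower_pT.timeSmooth _ (hpT ε hε),
      ((hT ε h1).add tower_pT).timeSmooth _ (hmod ε hε)⟩
  · obtain ⟨C, hC0, hC⟩ := hD.heatOp j.1 j.2
    -- The summand 1 only makes the constant positive. The prefactor ε⁻³ and the order of decay 4
    -- combine to the factor ε, and ε₀ = ε₁ works for every j.
    refine ⟨C + 1, _, by positivity, hε₁, le_rfl, fun ε hε h1 t ht k => ?_⟩
    have h := (hT ε h1).heatOp.abs_mixedDeriv_le hε (by positivity) (hker ε hε h1) j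
      (hC ⟨1 + √ε, hpar ε h1⟩) ht k
    have e : (ε ^ 3)⁻¹ * ε ^ 4 = ε := by field_simp
    rw [e] at h
    have := parNorm_nonneg ε t k
    push_cast at h
    refine h.trans ?_
    gcongr
    linarith
  · obtain ⟨A, hA0, hA⟩ := hD j.1 j.2
    -- For the full modified heat kernel the term p limits the order of decay to 1, which exactly
    -- balances the prefactor ε⁻¹.
    obtain ⟨B, hB0, hB⟩ := hD.add_dec one_le_two dec_pT j.1 j.2
    refine ⟨A + B + 1, _, by positivity, hε₁, le_rfl, fun ε hε h1 t ht k => ?_⟩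
    have hN := parNorm_nonneg ε t k
    constructor
    · have h := (hT ε h1).abs_mixedDeriv_le hε (inv_nonneg.2 hε.le)
        (f := fun s l => modHeatKernel ε s l - heatKernel ε s l) (hsub ε hε) j
        (hA ⟨1 + √ε, hpar ε h1⟩) ht k
      have e : ε⁻¹ * ε ^ 2 = ε := by field_simp
      rw [e, mul_assoc] at h
      push_cast at h
      rw [mul_assoc]
      refine h.trans (mul_le_mul (by linarith)
        (mul_rpow_le_rpow_mul_rpow hε (by linarith) hα1) (by positivity) (by positivity))
    · have h := ((hT ε h1).add tower_pT).abs_mixedDeriv_le hε (inv_nonneg.2 hε.le) (hmod ε hε) j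
        (hB ⟨1 + √ε, hpar ε h1⟩) ht k
      rw [pow_one, inv_mul_cancel₀ hε.ne', mul_one] at h
      push_cast at h
      refine h.trans ?_
      gcongr
      linarith
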